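/- Let $k$ be a commutative ring, $\Gamma$ an abelian group with a symmetric bilinear form $\langle\ ,\ \rangle\colon\Gamma\times\Gamma\to\mathbb Z/2$, and $\iota\in\Gamma$ an element with $\langle\iota,\iota\rangle=1$. Complexes are $\Gamma$-graded $k$-modules with a differential of degree $\iota$, with the Koszul sign rule given by $\langle\ ,\ \rangle$; a complex is contractible if it is homotopy equivalent to $0$. Let $\mathcal C,\mathcal D$ be small dg categories over $k$ whose hom complexes are projective over $k$; write $\langle X|\mathcal C|Y\rangle=\operatorname{Hom}_{\mathcal C}(Y,X)$. A $(\mathcal C,\mathcal D)$-bimodule $B$ consists of complexes $\langle X|B|Y\rangle$ ($X\in\mathcal C$, $Y\in\mathcal D$) with compatible unital and associative left and right actions, which are degree zero chain maps, of the hom complexes of $\mathcal C$ and $\mathcal D$. Bimodules form a dg category $\mathrm{Bim}_{\mathcal C,\mathcal D}$: $\operatorname{Hom}^l_{\mathrm{Bim}}(B,B')$ consists of the families of $k$-linear maps $\varphi$ of degree $l$ with $\varphi(fbg)=(-1)^{\langle l,|f|\rangle}f\varphi(b)g$, with differential $d\circ\varphi-(-1)^{\langle\iota,l\rangle}\varphi\circ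 d$. We write $\simeq$ for homotopy equivalence in this dg category. The tensor product is the underived one, $\langle X|M\otimes_{\mathcal C}N|Z\rangle=\bigl(\bigoplus_Y\langle X|M|Y\rangle\otimes_k\langle Y|N|Z\rangle\bigr)/(mf\otimes n\sim m\otimes fn)$. The bar complex $\mathrm{Bar}(\mathcal C)$ is the $(\mathcal C,\mathcal C)$-bimodule with $$\langle Y|\mathrm{Bar}(\mathcal C)|Z\rangle=\bigoplus_{r\ge0}q^{-r\iota}\bigoplus_{X_0,\dots,X_r}\langle Y|\mathcal C|X_0\rangle\otimes\langle X_0|\mathcal C|X_1\rangle\otimes\cdots\otimes\langle X_r|\mathcal C|Z\rangle ,$$ where $(q^{j}M)^i=M^{i-j}$, with actions $g\cdot[f_0,\dots,f_{r+1}]\cdot g'=(-1)^{r\langle\iota,|g|\rangle}[gf_0,f_1,\dots,f_r,f_{r+1}g']$ and with differential the sum of $(-1)^r$ times the differential of the tensor product and of the map which sends $[f_0,\dots,f_{r+1}]$ to $\sum_{i=0}^{r}(-1)^i[f_0,\dots,f_if_{i+1},\dots,f_{r+1}]$ if $r\ge1$, and to $0$ if $r=0$. A bimodule $B\in\mathrm{Bim}_{\mathcal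 C,\mathcal D}$ is called * acyclic, if $\langle X|B|Y\rangle$ is contractible for all $X\in\mathcal C$, $Y\in\mathcal D$; * projective, if $\operatorname{Hom}_{\mathrm{Bim}}(B,Z)$ is contractible for all acyclic $Z\in\mathrm{Bim}_{\mathcal C,\mathcal D}$; * exact, if the left module $B|Y\rangle=(\langle X|B|Y\rangle)_{X}\in\mathrm{Bim}_{\mathcal C,k}$ is projective for every $Y\in\mathcal D$ and the right module $\langle X|B=(\langle X|B|Y\rangle)_{Y}\in\mathrm{Bim}_{k,\mathcal D}$ is projective for every $X\in\mathcal C$; here $k$ is regarded as a dg category with one object. Then for every $B\in\mathrm{Bim}_{\mathcal C,\mathcal D}$: 1. $B$ is acyclic if and only if $\mathrm{Bar}(\mathcal C)\otimes_{\mathcal C}B\otimes_{\mathcal D}\mathrm{Bar}(\mathcal D)\simeq0$. 2. $B$ is projective if and only if $\mathrm{Bar}(\mathcal C)\otimes_{\mathcal C}B\otimes_{\mathcal D}\mathrm{Bar}(\mathcal D)\simeq B$. 3. $B$ is exact if and only if $\mathrm{Bar}(\mathcal C)\otimes_{\mathcal C}B\simeq B\otimes_{\mathcal D}\mathrm{Bar}(\mathcal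 D)$. -/

import Mathlib

universe u v v' w

open scoped TensorProduct DirectSum

noncomputable section

namespace DG

/-! ### Gradings and signs -/

/-- The data fixed for all gradings: a symmetric bilinear form `⟨·,·⟩ : Γ × Γ → ℤ/2` on the grading
group `Γ`, and an element `ι ∈ Γ` with `⟨ι, ι⟩ = 1`, the degree of all differentials. -/
structure GradingData (Γ : Type w) [AddCommGroup Γ] where
  pair : Γ →+ Γ →+ ZMod 2
  pair_symm : ∀ i j, pair i j = pair j i
  ι : Γ
  pair_ι_ι : pair ι ι = 1

section Sign

variable {Γ : Type w} [AddCommGroup Γ]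

/-- The Koszul sign `(-1)^⟨i,j⟩`, as an element of `k`. -/
def GradingData.sgn (G : GradingData Γ) (k : Type u) [CommRing k] (i j : Γ) : k :=
  if G.pair i j = 0 then 1 else -1

variable (G : GradingData Γ) (k : Type u) [CommRing k]

lemma sgn_symm (i j : Γ) : G.sgn k i j = G.sgn k j i := by
  unfold GradingData.sgn; rw [G.pair_symm]

lemma zmod2_cases : ∀ a b : ZMod 2, (a = 0 ∨ a = 1) ∧ (b = 0 ∨ b = 1) := by decide

lemma sgn_add_left (i i' j : Γ) : G.sgn k (i + i') j = G.sgn k i j * G.sgn k i' j := by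
  unfold GradingData.sgn
  rw [map_add, AddMonoidHom.add_apply]
  rcases zmod2_cases (G.pair i j) (G.pair i' j) with ⟨h | h, h' | h'⟩ <;> rw [h, h'] <;> simp
  exact fun h => absurd h (by decide)

lemma sgn_add_right (i j j' : Γ) : G.sgn k i (j + j') = G.sgn k i j * G.sgn k i j' := by
  rw [sgn_symm, sgn_add_left, sgn_symm G k j, sgn_symm G k j']

lemma sgn_mul_self (i j : Γ) : G.sgn k i j * G.sgn k i j = 1 := by
  unfold GradingData.sgn; split_ifs <;> simp

@[simp] lemma sgn_zero_left (j : Γ) : G.sgn k 0 j = 1 := by simp [GradingData.sgn]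

@[simp] lemma sgn_zero_right (j : Γ) : G.sgn k j 0 = 1 := by simp [GradingData.sgn]

@[simp] lemma sgn_ι_ι : G.sgn k G.ι G.ι = -1 := by simp [GradingData.sgn, G.pair_ι_ι]

lemma sgn_neg_left (i j : Γ) : G.sgn k (-i) j = G.sgn k i j := by
  simp [GradingData.sgn]

end Sign

/-! ### Differential graded modules -/

open scoped Classical in
/-- A differential `Γ`-graded `k`-module: a `k`-module with an internal grading by submodules
`deg i`, `i ∈ Γ`, and a differential of degree `ι`. -/
structure DGMod (k : Type u) [CommRing k] {Γ : Type w} [AddCommGroup Γ] (G : GradingData Γ) where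
  carrier : Type v
  [addCommGroup : AddCommGroup carrier]
  [module : Module k carrier]
  deg : Γ → Submodule k carrier
  internal : DirectSum.IsInternal deg
  d : carrier →ₗ[k] carrier
  d_deg : ∀ {i : Γ} {x : carrier}, x ∈ deg i → d x ∈ deg (i + G.ι)
  d_d : ∀ x : carrier, d (d x) = 0

attribute [instance] DGMod.addCommGroup DGMod.module

instance {k : Type u} [CommRing k] {Γ : Type w} [AddCommGroup Γ] {G : GradingData Γ} :
    CoeSort (DGMod.{u, v, w} k G) (Type v) := ⟨DGMod.carrier⟩

variable {k : Type u} [CommRing k] {Γ : Type w} [AddCommGroup Γ] {G : GradingData Γ}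

section Internal

variable {M : Type*} [AddCommGroup M] [Module k M]

open scoped Classical in
lemma isInternal_of_proj {J : Type*} {deg : J → Submodule k M} (hs : ⨆ i, deg i = ⊤)
    (p : J → M →ₗ[k] M) (h1 : ∀ i, ∀ x ∈ deg i, p i x = x)
    (h2 : ∀ i j, i ≠ j → ∀ x ∈ deg i, p j x = 0) : DirectSum.IsInternal deg := by
  rw [DirectSum.isInternal_submodule_iff_iSupIndep_and_iSup_eq_top]
  refine ⟨fun n => ?_, hs⟩
  rw [Submodule.disjoint_def]
  intro x hx hx'
  have : (⨆ (j) (_ : j ≠ n), deg j) ≤ LinearMap.ker (p n) := by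
    refine iSup₂_le fun j hj y hy => ?_
    exact h2 j n hj y hy
  rw [← h1 n x hx]
  exact this hx'

end Internal

namespace DGMod

section Tools

variable (M : DGMod.{u, v, w} k G)

lemma iSup_deg : ⨆ i, M.deg i = ⊤ := by
  classical
  exact M.internal.submodule_iSup_eq_top

variable {M} in
lemma ext_hom {P : Type*} [AddCommGroup P] [Module k P] {φ ψ : M →ₗ[k] P}
    (h : ∀ i, ∀ x ∈ M.deg i, φ x = ψ x) : φ = ψ := by
  have : (⊤ : Submodule k M) ≤ LinearMap.eqLocus φ ψ := by
    rw [← M.iSup_deg]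
    exact iSup_le fun i x hx => h i x hx
  ext x
  exact this (Submodule.mem_top (x := x))

open scoped Classical in
lemma coe_bijective : Function.Bijective (DirectSum.coeLinearMap M.deg) := M.internal

open scoped Classical in
/-- The linear map which is `φ i` on the degree `i` part. -/
def glue {P : Type*} [AddCommGroup P] [Module k P] (φ : Γ → M →ₗ[k] P) : M →ₗ[k] P :=
  (DirectSum.toModule k Γ P fun i => φ i ∘ₗ (M.deg i).subtype) ∘ₗ
    (LinearEquiv.ofBijective (DirectSum.coeLinearMap M.deg) M.coe_bijective).symm.toLinearMap

lemma glue_apply {P : Type*} [AddCommGroup P] [Module k P] (φ : Γ → M →ₗ[k] P) {i : Γ} {x : M}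
    (hx : x ∈ M.deg i) : M.glue φ x = φ i x := by
  classical
  have : (LinearEquiv.ofBijective (DirectSum.coeLinearMap M.deg) M.coe_bijective).symm x =
      DirectSum.lof k Γ (fun i => M.deg i) i ⟨x, hx⟩ := by
    rw [LinearEquiv.symm_apply_eq]
    simp
  simp only [glue, LinearMap.comp_apply, LinearEquiv.coe_coe, this]
  rw [DirectSum.toModule_lof]
  rfl

/-- The sign operator `x ↦ (-1)^⟨j,|x|⟩ x`. -/
def sOp (j : Γ) : M →ₗ[k] M := M.glue fun i => G.sgn k j i • LinearMap.id

variable {M} in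
lemma sOp_apply (j : Γ) {i : Γ} {x : M} (hx : x ∈ M.deg i) : M.sOp j x = G.sgn k j i • x := by
  rw [sOp, glue_apply _ _ hx]; rfl

open scoped Classical in
/-- The projection to the degree `n` part. -/
def proj (n : Γ) : M →ₗ[k] M := M.glue fun i => if i = n then LinearMap.id else 0

variable {M} in
lemma proj_same {n : Γ} {x : M} (hx : x ∈ M.deg n) : M.proj n x = x := by
  rw [proj, glue_apply _ _ hx]; simp

variable {M} in
lemma proj_ne {i n : Γ} (h : i ≠ n) {x : M} (hx : x ∈ M.deg i) : M.proj n x = 0 := by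
  rw [proj, glue_apply _ _ hx]; simp [h]

end Tools

/-- The zero dg module. -/
def zero : DGMod.{u, v, w} k G where
  carrier := PUnit
  deg _ := ⊤
  internal := isInternal_of_proj (by simp) (fun _ => LinearMap.id) (fun _ _ _ => rfl)
    (fun _ _ _ _ _ => rfl)
  d := 0
  d_deg _ := Submodule.mem_top
  d_d _ := rfl

/-- The ground ring, in degree zero with zero differential. -/
def ground : DGMod.{u, u, w} k G where
  carrier := k
  deg i := ⨆ _ : i = 0, ⊤
  internal := by
    classical
    refine isInternal_of_proj ?_ (fun n => if n = 0 then LinearMap.id else 0) ?_ ?_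
    · rw [eq_top_iff]
      exact le_iSup_of_le 0 (by simp)
    · intro i x hx
      by_cases h : i = 0
      · simp [h]
      · simp [h] at hx; simp [hx]
    · intro i j hij x hx
      by_cases h : i = 0
      · subst h; simp [hij.symm]
      · simp [h] at hx; simp [hx]
  d := 0
  d_deg _ := Submodule.zero_mem _
  d_d _ := rfl

/-- The shift `q^j M`: `(q^j M)^i = M^{i-j}`, with differential `(-1)^⟨j,ι⟩ d`. -/
def shift (j : Γ) (M : DGMod.{u, v, w} k G) : DGMod.{u, v, w} k G where
  carrier := M
  deg i := M.deg (i - j)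
  internal := by
    refine isInternal_of_proj ?_ (fun n => M.proj (n - j)) ?_ ?_
    · rw [← M.iSup_deg]
      exact (Equiv.subRight j).iSup_comp (g := M.deg)
    · intro i x hx
      exact proj_same hx
    · intro i i' h x hx
      exact proj_ne (fun h' => h (sub_left_injective h')) hx
  d := G.sgn k j G.ι • M.d
  d_deg {i x} hx := by
    have := M.d_deg hx
    rw [sub_add_eq_add_sub] at this
    exact Submodule.smul_mem _ _ this
  d_d x := by simp [M.d_d]

/-- The identification of the underlying modules of `M` and `q^j M`. -/
def toShift (j : Γ) (M : DGMod.{u, v, w} k G) : M →ₗ[k] M.shift j := LinearMap.id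

/-- The identification of the underlying modules of `q^j M` and `M`. -/
def ofShift (j : Γ) (M : DGMod.{u, v, w} k G) : M.shift j →ₗ[k] M := LinearMap.id

/-- The twist `tw_α(M)`: the same graded module, with differential `d + α`. -/
def twist (M : DGMod.{u, v, w} k G) (α : M →ₗ[k] M)
    (hα : ∀ {i : Γ} {x : M}, x ∈ M.deg i → α x ∈ M.deg (i + G.ι))
    (hMC : ∀ x, M.d (α x) + α (M.d x) + α (α x) = 0) : DGMod.{u, v, w} k G where
  carrier := M
  deg := M.deg
  internal := M.internal
  d := M.d + α
  d_deg hx := Submodule.add_mem _ (M.d_deg hx) (hα hx)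
  d_d x := by
    have := hMC x
    simp only [LinearMap.add_apply, map_add, M.d_d, zero_add]
    rw [← this]; abel

section DirectSum

variable {I : Type v'}

open scoped Classical in
/-- The direct sum of dg modules. -/
def directSum (M : I → DGMod.{u, v, w} k G) : DGMod.{u, max v v', w} k G where
  carrier := ⨁ i, M i
  deg n := ⨆ i, ((M i).deg n).map (DirectSum.lof k I (fun i => (M i : Type v)) i)
  internal := by
    refine isInternal_of_proj ?_ (fun n => DirectSum.lmap fun i => (M i).proj n) ?_ ?_
    · rw [iSup_comm]
      simp only [← Submodule.map_iSup, iSup_deg, Submodule.map_top]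
      exact DFinsupp.iSup_range_lsingle
    · intro n
      suffices h : (⨆ i, ((M i).deg n).map (DirectSum.lof k I (fun i => (M i : Type v)) i)) ≤
        LinearMap.eqLocus (DirectSum.lmap fun i => (M i).proj n) LinearMap.id from
        fun x hx => h hx
      refine iSup_le fun i => ?_
      rintro _ ⟨x, hx, rfl⟩
      simp [LinearMap.mem_eqLocus, proj_same hx]
    · intro n n' hn
      suffices h : (⨆ i, ((M i).deg n).map (DirectSum.lof k I (fun i => (M i : Type v)) i)) ≤
        LinearMap.ker (DirectSum.lmap fun i => (M i).proj n') from
        fun x hx => h hx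
      refine iSup_le fun i => ?_
      rintro _ ⟨x, hx, rfl⟩
      simp [LinearMap.mem_ker, proj_ne hn hx]
  d := DirectSum.lmap fun i => (M i).d
  d_deg {n} := by
    suffices h : (⨆ i, ((M i).deg n).map (DirectSum.lof k I (fun i => (M i : Type v)) i)) ≤
        (⨆ i, ((M i).deg (n + G.ι)).map (DirectSum.lof k I (fun i => (M i : Type v)) i)).comap
          (DirectSum.lmap fun i => (M i).d) from fun {x} hx => h hx
    refine iSup_le fun i => ?_
    rintro _ ⟨x, hx, rfl⟩
    rw [Submodule.mem_comap, DirectSum.lmap_lof]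
    exact Submodule.mem_iSup_of_mem i ⟨_, (M i).d_deg hx, rfl⟩
  d_d x := by
    have : (DirectSum.lmap fun i => (M i).d) ∘ₗ (DirectSum.lmap fun i => (M i).d) = 0 := by
      refine DirectSum.linearMap_ext k fun i => ?_
      ext x
      simp [(M i).d_d]
    exact LinearMap.congr_fun this x


variable (M : I → DGMod.{u, v, w} k G) {P : Type*} [AddCommGroup P] [Module k P]

open scoped Classical in
/-- The inclusion of a summand. -/
def dof (i : I) : M i →ₗ[k] directSum M := DirectSum.lof k I (fun i => (M i : Type v)) i

variable {M}

open scoped Classical in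
/-- The linear map out of a direct sum given by its restrictions to the summands. -/
def dlift (φ : ∀ i, M i →ₗ[k] P) : directSum M →ₗ[k] P := DirectSum.toModule k I P φ

@[simp] lemma dlift_dof (φ : ∀ i, M i →ₗ[k] P) (i : I) (x : M i) :
    dlift φ (dof M i x) = φ i x := by
  classical
  exact DirectSum.toModule_lof (M := fun i => (M i : Type v)) k i x

lemma dof_mem_deg {i : I} {n : Γ} {x : M i} (hx : x ∈ (M i).deg n) :
    dof M i x ∈ (directSum M).deg n := by
  classical
  have h : DirectSum.lof k I (fun i => (M i : Type v)) i x ∈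
      ⨆ i, ((M i).deg n).map (DirectSum.lof k I (fun i => (M i : Type v)) i) :=
    Submodule.mem_iSup_of_mem i ⟨x, hx, rfl⟩
  exact h

@[simp] lemma directSum_d_dof (i : I) (x : M i) :
    (directSum M).d (dof M i x) = dof M i ((M i).d x) := by
  classical
  exact DirectSum.lmap_lof ..

lemma directSum_mem_le {n : Γ} {S : Submodule k (directSum M)}
    (h : ∀ i, ∀ x ∈ (M i).deg n, dof M i x ∈ S) : (directSum M).deg n ≤ S := by
  classical
  refine iSup_le fun i => ?_
  rintro _ ⟨x, hx, rfl⟩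
  exact h i x hx

end DirectSum

section Tensor

/-- The tensor product of dg modules over `k`, with differential
`d (a ⊗ b) = d a ⊗ b + (-1)^⟨ι,|a|⟩ a ⊗ d b`. -/
def tensor (A B : DGMod.{u, v, w} k G) : DGMod.{u, v, w} k G where
  carrier := A ⊗[k] B
  deg n := Submodule.span k
    {t | ∃ (i j : Γ) (a : A) (b : B), a ∈ A.deg i ∧ b ∈ B.deg j ∧ i + j = n ∧ t = a ⊗ₜ[k] b}
  internal := by
    refine isInternal_of_proj ?_ (fun n => TensorProduct.lift
      (A.glue fun i => (TensorProduct.mk k A B).compl₂ (B.proj (n - i)))) ?_ ?_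
    · rw [eq_top_iff]
      intro t _
      induction t with
      | zero => exact Submodule.zero_mem _
      | add x y hx hy => exact Submodule.add_mem _ (hx trivial) (hy trivial)
      | tmul a b =>
        have ha : a ∈ ⨆ i, A.deg i := by rw [A.iSup_deg]; trivial
        have hb : b ∈ ⨆ i, B.deg i := by rw [B.iSup_deg]; trivial
        induction ha using Submodule.iSup_induction' with
        | zero => simp
        | add x y _ _ hx hy => rw [TensorProduct.add_tmul]; exact Submodule.add_mem _ (hx trivial) (hy trivial)
        | mem i a ha =>
          induction hb using Submodule.iSup_induction' with
          | zero => simp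
          | add x y _ _ hx hy => rw [TensorProduct.tmul_add]; exact Submodule.add_mem _ (hx trivial) (hy trivial)
          | mem j b hb =>
            exact Submodule.mem_iSup_of_mem (i + j)
              (Submodule.subset_span ⟨i, j, a, b, ha, hb, rfl, rfl⟩)
    · intro n x hx
      induction hx using Submodule.span_induction with
      | zero => simp
      | add x y _ _ hx hy => rw [map_add, hx, hy]
      | smul c x _ hx => rw [map_smul, hx]
      | mem x hx =>
        obtain ⟨i, j, a, b, ha, hb, rfl, rfl⟩ := hx
        simp [glue_apply _ _ ha, proj_same hb]
    · intro n n' hn x hx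
      induction hx using Submodule.span_induction with
      | zero => simp
      | add x y _ _ hx hy => rw [map_add, hx, hy, add_zero]
      | smul c x _ hx => rw [map_smul, hx, smul_zero]
      | mem x hx =>
        obtain ⟨i, j, a, b, ha, hb, rfl, rfl⟩ := hx
        have : j ≠ n' - i := by rintro rfl; exact hn (by abel)
        simp [glue_apply _ _ ha, proj_ne this hb]
  d := A.d.rTensor B + TensorProduct.map (A.sOp G.ι) B.d
  d_deg {n} {x} hx := by
    induction hx using Submodule.span_induction with
    | zero => simp
    | add x y _ _ hx hy => rw [map_add]; exact Submodule.add_mem _ hx hy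
    | smul c x _ hx => rw [map_smul]; exact Submodule.smul_mem _ _ hx
    | mem x hx =>
      obtain ⟨i, j, a, b, ha, hb, rfl, rfl⟩ := hx
      simp only [LinearMap.add_apply, LinearMap.rTensor_tmul, TensorProduct.map_tmul,
        sOp_apply _ ha, ← TensorProduct.smul_tmul']
      refine Submodule.add_mem _ (Submodule.subset_span
        ⟨i + G.ι, j, _, _, A.d_deg ha, hb, by abel, rfl⟩) (Submodule.smul_mem _ _
        (Submodule.subset_span ⟨i, j + G.ι, _, _, ha, B.d_deg hb, by abel, rfl⟩))
  d_d x := by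
    induction x with
    | zero => simp
    | add x y hx hy => rw [map_add, map_add, hx, hy, add_zero]
    | tmul a b =>
      revert a
      suffices h : ((A.d.rTensor B + TensorProduct.map (A.sOp G.ι) B.d) ∘ₗ
          (A.d.rTensor B + TensorProduct.map (A.sOp G.ι) B.d)) ∘ₗ
          (TensorProduct.mk k A B).flip b = 0 from fun a => LinearMap.congr_fun h a
      refine ext_hom fun i a ha => ?_
      simp [sOp_apply _ ha, sOp_apply _ (A.d_deg ha), A.d_d, B.d_d, sgn_add_right,
        ← TensorProduct.smul_tmul', TensorProduct.neg_tmul]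

variable {A B : DGMod.{u, v, w} k G} {P : Type*} [AddCommGroup P] [Module k P]

/-- The canonical bilinear map `(a, b) ↦ a ⊗ b`. -/
def tmk (A B : DGMod.{u, v, w} k G) : A →ₗ[k] B →ₗ[k] A.tensor B := TensorProduct.mk k A B

/-- The linear map out of the tensor product given by a bilinear map. -/
def tlift (φ : A →ₗ[k] B →ₗ[k] P) : A.tensor B →ₗ[k] P := TensorProduct.lift φ

@[simp] lemma tlift_tmk (φ : A →ₗ[k] B →ₗ[k] P) (a : A) (b : B) : tlift φ (tmk A B a b) = φ a b :=
  TensorProduct.lift.tmul a b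

lemma tmk_mem_deg {i j n : Γ} {a : A} {b : B} (ha : a ∈ A.deg i) (hb : b ∈ B.deg j)
    (h : i + j = n) : tmk A B a b ∈ (A.tensor B).deg n := by
  have h : a ⊗ₜ[k] b ∈ Submodule.span k {t | ∃ (i j : Γ) (a : A) (b : B),
      a ∈ A.deg i ∧ b ∈ B.deg j ∧ i + j = n ∧ t = a ⊗ₜ[k] b} :=
    Submodule.subset_span ⟨i, j, a, b, ha, hb, h, rfl⟩
  exact h

lemma tensor_d_tmk {i : Γ} {a : A} (ha : a ∈ A.deg i) (b : B) :
    (A.tensor B).d (tmk A B a b) = tmk A B (A.d a) b + G.sgn k G.ι i • tmk A B a (B.d b) := by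
  change (A.d.rTensor B + TensorProduct.map (A.sOp G.ι) B.d) (a ⊗ₜ[k] b) =
    A.d a ⊗ₜ[k] b + G.sgn k G.ι i • (a ⊗ₜ[k] B.d b)
  simp [sOp_apply _ ha, ← TensorProduct.smul_tmul']

lemma tensor_mem_le {n : Γ} {S : Submodule k (A.tensor B)} (h : ∀ i j a b, a ∈ A.deg i →
    b ∈ B.deg j → i + j = n → tmk A B a b ∈ S) : (A.tensor B).deg n ≤ S := by
  refine Submodule.span_le.2 ?_
  rintro _ ⟨i, j, a, b, ha, hb, hn, rfl⟩
  exact h i j a b ha hb hn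

end Tensor

section Quot

/-- The quotient of a dg module by the submodule spanned by a set of homogeneous elements, provided
that this submodule is stable under the differential. -/
def quot (M : DGMod.{u, v, w} k G) (R : Set M) (hR : ∀ r ∈ R, ∃ i, r ∈ M.deg i)
    (hd : ∀ r ∈ R, M.d r ∈ Submodule.span k R) : DGMod.{u, v, w} k G where
  carrier := M ⧸ Submodule.span k R
  deg n := (M.deg n).map (Submodule.span k R).mkQ
  internal := by
    have hp (n : Γ) : Submodule.span k R ≤ (Submodule.span k R).comap (M.proj n) := by
      rw [Submodule.span_le]
      intro r hr
      obtain ⟨i, hi⟩ := hR r hr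
      by_cases h : i = n
      · subst h
        simpa [proj_same hi] using Submodule.subset_span hr
      · simp [proj_ne h hi]
    refine isInternal_of_proj ?_ (fun n => Submodule.mapQ _ _ (M.proj n) (hp n)) ?_ ?_
    · rw [← Submodule.map_iSup, iSup_deg, Submodule.map_top, Submodule.range_mkQ]
    · rintro i _ ⟨x, hx, rfl⟩
      simp [proj_same hx]
    · rintro i j hij _ ⟨x, hx, rfl⟩
      simp [proj_ne hij hx]
  d := Submodule.mapQ _ _ M.d (Submodule.span_le.2 hd)
  d_deg {i x} hx := by
    obtain ⟨x, hx, rfl⟩ := hx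
    exact ⟨_, M.d_deg hx, by simp⟩
  d_d x := by
    obtain ⟨x, rfl⟩ := Submodule.mkQ_surjective _ x
    simp [M.d_d]

variable {M : DGMod.{u, v, w} k G} {R : Set M} {hR : ∀ r ∈ R, ∃ i, r ∈ M.deg i}
  {hd : ∀ r ∈ R, M.d r ∈ Submodule.span k R} {P : Type*} [AddCommGroup P] [Module k P]

/-- The quotient map. -/
def qmk (M : DGMod.{u, v, w} k G) (R : Set M) (hR : ∀ r ∈ R, ∃ i, r ∈ M.deg i)
    (hd : ∀ r ∈ R, M.d r ∈ Submodule.span k R) : M →ₗ[k] M.quot R hR hd :=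
  (Submodule.span k R).mkQ

/-- The linear map out of a quotient given by a linear map which vanishes on the relations. -/
def qlift (φ : M →ₗ[k] P) (h : ∀ r ∈ R, φ r = 0) : M.quot R hR hd →ₗ[k] P :=
  (Submodule.span k R).liftQ φ (Submodule.span_le.2 h)

@[simp] lemma qlift_qmk (φ : M →ₗ[k] P) (h : ∀ r ∈ R, φ r = 0) (x : M) :
    qlift (hR := hR) (hd := hd) φ h (qmk M R hR hd x) = φ x := rfl

lemma qmk_rel {r : M} (hr : r ∈ R) : qmk M R hR hd r = 0 :=
  (Submodule.Quotient.mk_eq_zero _).2 (Submodule.subset_span hr)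

lemma qmk_span {r : M} (hr : r ∈ Submodule.span k R) : qmk M R hR hd r = 0 :=
  (Submodule.Quotient.mk_eq_zero _).2 hr

lemma qmk_surjective : Function.Surjective (qmk M R hR hd) := Submodule.mkQ_surjective _

lemma qmk_mem_deg {n : Γ} {x : M} (hx : x ∈ M.deg n) : qmk M R hR hd x ∈ (M.quot R hR hd).deg n :=
  ⟨x, hx, rfl⟩

lemma quot_d_qmk (x : M) : (M.quot R hR hd).d (qmk M R hR hd x) = qmk M R hR hd (M.d x) := rfl

lemma quot_mem_le {n : Γ} {S : Submodule k (M.quot R hR hd)}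
    (h : ∀ x ∈ M.deg n, qmk M R hR hd x ∈ S) : (M.quot R hR hd).deg n ≤ S := by
  rintro _ ⟨x, hx, rfl⟩
  exact h x hx

end Quot

section SumTensor

variable {I : Type v} (A B A' B' : I → DGMod.{u, v, w} k G)

/-- The dg module `⨁ i, A i ⊗ B i`. -/
def sumTensor : DGMod.{u, v, w} k G := directSum fun i => (A i).tensor (B i)

/-- The element `a ⊗ b` of the `i`-th summand. -/
def smk (i : I) : A i →ₗ[k] B i →ₗ[k] sumTensor A B :=
  (tmk (A i) (B i)).compr₂ (dof (fun i => (A i).tensor (B i)) i)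

variable {A B A' B'} {P : Type*} [AddCommGroup P] [Module k P]

/-- The linear map out of `⨁ i, A i ⊗ B i` given by bilinear maps. -/
def slift (φ : ∀ i, A i →ₗ[k] B i →ₗ[k] P) : sumTensor A B →ₗ[k] P := dlift fun i => tlift (φ i)

@[simp] lemma slift_smk (φ : ∀ i, A i →ₗ[k] B i →ₗ[k] P) (i : I) (a : A i) (b : B i) :
    slift φ (smk A B i a b) = φ i a b := by
  exact (dlift_dof _ _ _).trans (tlift_tmk _ _ _)

lemma smk_mem_deg {x : I} {i j n : Γ} {a : A x} {b : B x} (ha : a ∈ (A x).deg i)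
    (hb : b ∈ (B x).deg j) (h : i + j = n) : smk A B x a b ∈ (sumTensor A B).deg n :=
  dof_mem_deg (tmk_mem_deg ha hb h)

lemma sumTensor_d_smk {x : I} {i : Γ} {a : A x} (ha : a ∈ (A x).deg i) (b : B x) :
    (sumTensor A B).d (smk A B x a b) =
      smk A B x ((A x).d a) b + G.sgn k G.ι i • smk A B x a ((B x).d b) := by
  refine (directSum_d_dof (M := fun i => (A i).tensor (B i)) x (tmk (A x) (B x) a b)).trans ?_
  rw [tensor_d_tmk ha, map_add, map_smul]
  rfl

lemma sumTensor_mem_le {n : Γ} {S : Submodule k (sumTensor A B)} (h : ∀ x i j a b,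
    a ∈ (A x).deg i → b ∈ (B x).deg j → i + j = n → smk A B x a b ∈ S) :
    (sumTensor A B).deg n ≤ S :=
  directSum_mem_le fun x => tensor_mem_le (S := S.comap (dof (fun i => (A i).tensor (B i)) x))
    fun i j a b => h x i j a b

lemma sumTensor_ext_deg {n : Γ} {φ ψ : sumTensor A B →ₗ[k] P} (h : ∀ x i j a b,
    a ∈ (A x).deg i → b ∈ (B x).deg j → i + j = n → φ (smk A B x a b) = ψ (smk A B x a b)) :
    ∀ t ∈ (sumTensor A B).deg n, φ t = ψ t :=
  sumTensor_mem_le (S := LinearMap.eqLocus φ ψ) h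

lemma sumTensor_ext {φ ψ : sumTensor A B →ₗ[k] P} (h : ∀ x i j a b,
    a ∈ (A x).deg i → b ∈ (B x).deg j → φ (smk A B x a b) = ψ (smk A B x a b)) : φ = ψ :=
  ext_hom fun _ => sumTensor_ext_deg fun x i j a b ha hb _ => h x i j a b ha hb

/-- The map `⨁ φ i ⊗ ψ i`. -/
def smap (φ : ∀ i, A i →ₗ[k] A' i) (ψ : ∀ i, B i →ₗ[k] B' i) :
    sumTensor A B →ₗ[k] sumTensor A' B' :=
  slift fun i => (smk A' B' i).compl₁₂ (φ i) (ψ i)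

@[simp] lemma smap_smk (φ : ∀ i, A i →ₗ[k] A' i) (ψ : ∀ i, B i →ₗ[k] B' i) (i : I) (a : A i)
    (b : B i) : smap φ ψ (smk A B i a b) = smk A' B' i (φ i a) (ψ i b) := by
  simp [smap]

/-- The map `⨁ φ i ⊗ id`, bilinear in the parameter on which `φ` depends. -/
def smapL {Q : Type*} [AddCommGroup Q] [Module k Q] (φ : ∀ i, Q →ₗ[k] A i →ₗ[k] A' i) :
    Q →ₗ[k] sumTensor A B →ₗ[k] sumTensor A' B :=
  LinearMap.mk₂ k (fun q t => smap (fun i => φ i q) (fun _ => LinearMap.id) t)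
    (fun q q' t => by
      rw [← LinearMap.add_apply]; congr 1
      exact sumTensor_ext fun x i j a b _ _ => by simp)
    (fun c q t => by
      rw [← LinearMap.smul_apply]; congr 1
      exact sumTensor_ext fun x i j a b _ _ => by simp)
    (fun q t t' => map_add _ _ _) (fun c q t => map_smul _ _ _)

@[simp] lemma smapL_smk {Q : Type*} [AddCommGroup Q] [Module k Q]
    (φ : ∀ i, Q →ₗ[k] A i →ₗ[k] A' i) (q : Q) (i : I) (a : A i) (b : B i) :
    smapL φ q (smk A B i a b) = smk A' B i (φ i q a) b := by
  simp [smapL]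

/-- The map `⨁ id ⊗ ψ i`, bilinear in the parameter on which `ψ` depends. -/
def smapR {Q : Type*} [AddCommGroup Q] [Module k Q] (ψ : ∀ i, B i →ₗ[k] Q →ₗ[k] B' i) :
    sumTensor A B →ₗ[k] Q →ₗ[k] sumTensor A B' :=
  LinearMap.mk₂ k (fun t q => smap (fun _ => LinearMap.id) (fun i => (ψ i).flip q) t)
    (fun t t' q => map_add _ _ _) (fun c t q => map_smul _ _ _)
    (fun t q q' => by
      rw [← LinearMap.add_apply]; congr 1
      exact sumTensor_ext fun x i j a b _ _ => by simp)
    (fun c t q => by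
      rw [← LinearMap.smul_apply]; congr 1
      exact sumTensor_ext fun x i j a b _ _ => by simp)

@[simp] lemma smapR_smk {Q : Type*} [AddCommGroup Q] [Module k Q]
    (ψ : ∀ i, B i →ₗ[k] Q →ₗ[k] B' i) (q : Q) (i : I) (a : A i) (b : B i) :
    smapR ψ (smk A B i a b) q = smk A B' i a (ψ i b q) := by
  simp [smapR]

end SumTensor

open scoped Classical in
/-- The dg module with components `V l`, `l ∈ Γ`, and differential `d l : V l → V (l + ι)`. -/
def ofFamily (V : Γ → Type v) [∀ l, AddCommGroup (V l)] [∀ l, Module k (V l)]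
    (d : ∀ l, V l →ₗ[k] V (l + G.ι)) (hd : ∀ l x, d (l + G.ι) (d l x) = 0) :
    DGMod.{u, max v w, w} k G where
  carrier := ⨁ l, V l
  deg l := LinearMap.range (DirectSum.lof k Γ V l)
  internal := by
    refine isInternal_of_proj DFinsupp.iSup_range_lsingle
      (fun n => DirectSum.lmap fun l => if l = n then LinearMap.id else 0) ?_ ?_
    · rintro n _ ⟨φ, rfl⟩
      rw [DirectSum.lmap_lof, if_pos rfl, LinearMap.id_apply]
    · rintro i j hij _ ⟨φ, rfl⟩
      rw [DirectSum.lmap_lof, if_neg hij, LinearMap.zero_apply, map_zero]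
  d := DirectSum.toModule k Γ _ fun l => DirectSum.lof k Γ V (l + G.ι) ∘ₗ d l
  d_deg := by
    rintro l _ ⟨φ, rfl⟩
    rw [DirectSum.toModule_lof]
    exact ⟨_, rfl⟩
  d_d φ := by
    refine LinearMap.congr_fun (f := (DirectSum.toModule k Γ _ fun l =>
      DirectSum.lof k Γ V (l + G.ι) ∘ₗ d l) ∘ₗ (DirectSum.toModule k Γ _ fun l =>
      DirectSum.lof k Γ V (l + G.ι) ∘ₗ d l)) (g := 0) ?_ φ
    refine DirectSum.linearMap_ext k fun l => ?_
    ext1 φ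
    simp only [LinearMap.comp_apply, DirectSum.toModule_lof, LinearMap.zero_apply, hd, map_zero]

section DirectSumMaps

variable {I : Type v'} {M N : I → DGMod.{u, v, w} k G} {Q : Type*} [AddCommGroup Q] [Module k Q]
  {P : Type*} [AddCommGroup P] [Module k P]

lemma directSum_ext {φ ψ : directSum M →ₗ[k] P} (h : ∀ i x, φ (dof M i x) = ψ (dof M i x)) :
    φ = ψ :=
  ext_hom fun _ => directSum_mem_le (S := LinearMap.eqLocus φ ψ) fun i x _ => h i x

/-- The map `⨁ φ i`, bilinear in the parameter on which `φ` depends. -/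
def dmapL (φ : ∀ i, Q →ₗ[k] M i →ₗ[k] N i) : Q →ₗ[k] directSum M →ₗ[k] directSum N :=
  (dlift fun i => ((φ i).compr₂ (dof N i)).flip).flip

@[simp] lemma dmapL_dof (φ : ∀ i, Q →ₗ[k] M i →ₗ[k] N i) (q : Q) (i : I) (x : M i) :
    dmapL φ q (dof M i x) = dof N i (φ i q x) := by
  simp [dmapL]

/-- The map `⨁ φ i`, bilinear in the parameter on which `φ` depends. -/
def dmapR (φ : ∀ i, M i →ₗ[k] Q →ₗ[k] N i) : directSum M →ₗ[k] Q →ₗ[k] directSum N :=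
  dlift fun i => (φ i).compr₂ (dof N i)

@[simp] lemma dmapR_dof (φ : ∀ i, M i →ₗ[k] Q →ₗ[k] N i) (q : Q) (i : I) (x : M i) :
    dmapR φ (dof M i x) q = dof N i (φ i x q) := by
  simp [dmapR]

end DirectSumMaps

/-- Two dg modules are homotopy equivalent if there are degree zero chain maps between them which
are mutually inverse up to homotopy. -/
def HEquiv (M : DGMod.{u, v, w} k G) (N : DGMod.{u, v', w} k G) : Prop :=
  ∃ (f : M →ₗ[k] N) (g : N →ₗ[k] M) (h : M →ₗ[k] M) (h' : N →ₗ[k] N),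
    (∀ i, ∀ x ∈ M.deg i, f x ∈ N.deg i) ∧ (∀ i, ∀ x ∈ N.deg i, g x ∈ M.deg i) ∧
    (∀ i, ∀ x ∈ M.deg i, h x ∈ M.deg (i - G.ι)) ∧ (∀ i, ∀ x ∈ N.deg i, h' x ∈ N.deg (i - G.ι)) ∧
    (∀ x, N.d (f x) = f (M.d x)) ∧ (∀ x, M.d (g x) = g (N.d x)) ∧
    (∀ x, g (f x) - x = M.d (h x) + h (M.d x)) ∧ (∀ x, f (g x) - x = N.d (h' x) + h' (N.d x))

end DGMod
/-! ### Differential graded categories and bimodules -/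

/-- A (small) dg category.  Here `C.bk X Y` is the complex `⟨X|C|Y⟩ = Hom_C(Y, X)`, so that
composition is a map `⟨X|C|Y⟩ ⊗ ⟨Y|C|Z⟩ → ⟨X|C|Z⟩`. -/
structure DGCat (k : Type u) [CommRing k] {Γ : Type w} [AddCommGroup Γ] (G : GradingData Γ) where
  Obj : Type u
  bk : Obj → Obj → DGMod.{u, u, w} k G
  comp : ∀ {X Y Z : Obj}, bk X Y →ₗ[k] bk Y Z →ₗ[k] bk X Z
  id : ∀ X : Obj, bk X X
  comp_deg : ∀ {X Y Z : Obj} {i j : Γ} {f : bk X Y} {g : bk Y Z},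
    f ∈ (bk X Y).deg i → g ∈ (bk Y Z).deg j → comp f g ∈ (bk X Z).deg (i + j)
  comp_d : ∀ {X Y Z : Obj} {i : Γ} {f : bk X Y} (g : bk Y Z), f ∈ (bk X Y).deg i →
    (bk X Z).d (comp f g) = comp ((bk X Y).d f) g + G.sgn k G.ι i • comp f ((bk Y Z).d g)
  id_deg : ∀ X : Obj, id X ∈ (bk X X).deg 0
  d_id : ∀ X : Obj, (bk X X).d (id X) = 0
  id_comp : ∀ {X Y : Obj} (f : bk X Y), comp (id X) f = f
  comp_id : ∀ {X Y : Obj} (f : bk X Y), comp f (id Y) = f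
  assoc : ∀ {X Y Z W : Obj} (f : bk X Y) (g : bk Y Z) (h : bk Z W),
    comp (comp f g) h = comp f (comp g h)

/-- All hom complexes are projective over `k` (in each degree). -/
def DGCat.HomProjective (C : DGCat.{u, w} k G) : Prop :=
  ∀ (X Y : C.Obj) (i : Γ), Module.Projective k ((C.bk X Y).deg i)

lemma ground_cases {i : Γ} {c : k} (hc : c ∈ ⨆ _ : i = 0, (⊤ : Submodule k k)) :
    i = 0 ∨ c = 0 := by
  by_cases hi : i = 0
  · exact Or.inl hi
  · simp only [hi, iSup_false, Submodule.mem_bot] at hc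
    exact Or.inr hc

lemma ground_mem (c : k) : c ∈ ⨆ _ : (0 : Γ) = 0, (⊤ : Submodule k k) := by simp

lemma smul_mem_deg_left (M : DGMod.{u, v, w} k G) {i j : Γ} {c : k} {m : M}
    (hc : c ∈ ⨆ _ : i = 0, (⊤ : Submodule k k)) (hm : m ∈ M.deg j) : c • m ∈ M.deg (i + j) := by
  rcases ground_cases hc with rfl | rfl
  · rw [zero_add]; exact Submodule.smul_mem _ _ hm
  · rw [zero_smul]; exact Submodule.zero_mem _

lemma smul_mem_deg_right (M : DGMod.{u, v, w} k G) {i j : Γ} {c : k} {m : M}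
    (hm : m ∈ M.deg i) (hc : c ∈ ⨆ _ : j = 0, (⊤ : Submodule k k)) : c • m ∈ M.deg (i + j) := by
  rw [add_comm]; exact smul_mem_deg_left M hc hm

lemma smul_d_left (M : DGMod.{u, v, w} k G) {i : Γ} {c : k} (m : M)
    (hc : c ∈ ⨆ _ : i = 0, (⊤ : Submodule k k)) :
    M.d (c • m) = (0 : k) • m + G.sgn k G.ι i • c • M.d m := by
  rcases ground_cases hc with rfl | rfl <;> simp

lemma smul_d_right (M : DGMod.{u, v, w} k G) (m : M) (c s : k) :
    M.d (c • m) = c • M.d m + s • (0 : k) • m := by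
  simp

/-- The ground ring as a dg category with one object. -/
def DGCat.unit : DGCat.{u, w} k G where
  Obj := PUnit
  bk _ _ := DGMod.ground
  comp := LinearMap.mul k k
  id _ := (1 : k)
  comp_deg {_ _ _ _ _} := fun {_ g : k} hf hg =>
    smul_mem_deg_left (DGMod.ground : DGMod.{u, u, w} k G) (m := g) hf hg
  comp_d {_ _ _ _} := fun {_ : k} (g : k) hf =>
    smul_d_left (DGMod.ground : DGMod.{u, u, w} k G) g hf
  id_deg _ := ground_mem (1 : k)
  d_id _ := rfl
  id_comp := fun (f : k) => one_mul f
  comp_id := fun (f : k) => mul_one f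
  assoc := fun (f g h : k) => mul_assoc f g h

/-- A `(C, D)`-bimodule: complexes `⟨X|M|Y⟩` for `X ∈ C`, `Y ∈ D` with commuting left and right
actions `⟨X'|C|X⟩ ⊗ ⟨X|M|Y⟩ → ⟨X'|M|Y⟩` and `⟨X|M|Y⟩ ⊗ ⟨Y|D|Y'⟩ → ⟨X|M|Y'⟩` which are chain
maps of degree zero. -/
structure Bimod (C D : DGCat.{u, w} k G) where
  obj : C.Obj → D.Obj → DGMod.{u, u, w} k G
  lact : ∀ {X' X : C.Obj} {Y : D.Obj}, C.bk X' X →ₗ[k] obj X Y →ₗ[k] obj X' Y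
  ract : ∀ {X : C.Obj} {Y Y' : D.Obj}, obj X Y →ₗ[k] D.bk Y Y' →ₗ[k] obj X Y'
  lact_deg : ∀ {X' X : C.Obj} {Y : D.Obj} {i j : Γ} {f : C.bk X' X} {m : obj X Y},
    f ∈ (C.bk X' X).deg i → m ∈ (obj X Y).deg j → lact f m ∈ (obj X' Y).deg (i + j)
  ract_deg : ∀ {X : C.Obj} {Y Y' : D.Obj} {i j : Γ} {m : obj X Y} {g : D.bk Y Y'},
    m ∈ (obj X Y).deg i → g ∈ (D.bk Y Y').deg j → ract m g ∈ (obj X Y').deg (i + j)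
  lact_d : ∀ {X' X : C.Obj} {Y : D.Obj} {i : Γ} {f : C.bk X' X} (m : obj X Y),
    f ∈ (C.bk X' X).deg i →
    (obj X' Y).d (lact f m) = lact ((C.bk X' X).d f) m + G.sgn k G.ι i • lact f ((obj X Y).d m)
  ract_d : ∀ {X : C.Obj} {Y Y' : D.Obj} {i : Γ} {m : obj X Y} (g : D.bk Y Y'),
    m ∈ (obj X Y).deg i →
    (obj X Y').d (ract m g) = ract ((obj X Y).d m) g + G.sgn k G.ι i • ract m ((D.bk Y Y').d g)
  id_lact : ∀ {X : C.Obj} {Y : D.Obj} (m : obj X Y), lact (C.id X) m = m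
  ract_id : ∀ {X : C.Obj} {Y : D.Obj} (m : obj X Y), ract m (D.id Y) = m
  lact_lact : ∀ {X'' X' X : C.Obj} {Y : D.Obj} (f : C.bk X'' X') (f' : C.bk X' X) (m : obj X Y),
    lact (C.comp f f') m = lact f (lact f' m)
  ract_ract : ∀ {X : C.Obj} {Y Y' Y'' : D.Obj} (m : obj X Y) (g : D.bk Y Y') (g' : D.bk Y' Y''),
    ract m (D.comp g g') = ract (ract m g) g'
  lact_ract : ∀ {X' X : C.Obj} {Y Y' : D.Obj} (f : C.bk X' X) (m : obj X Y) (g : D.bk Y Y'),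
    ract (lact f m) g = lact f (ract m g)

namespace Bimod

variable {A C D E : DGCat.{u, w} k G}

/-- The identity bimodule. -/
def one (C : DGCat.{u, w} k G) : Bimod C C where
  obj := C.bk
  lact := C.comp
  ract := C.comp
  lact_deg := C.comp_deg
  ract_deg := C.comp_deg
  lact_d := C.comp_d
  ract_d := C.comp_d
  id_lact := C.id_comp
  ract_id := C.comp_id
  lact_lact := C.assoc
  ract_ract m g g' := (C.assoc m g g').symm
  lact_ract := C.assoc

/-- The zero bimodule. -/
def zero : Bimod C D where
  obj _ _ := (DGMod.zero : DGMod.{u, u, w} k G)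
  lact := 0
  ract := 0
  lact_deg _ _ := trivial
  ract_deg _ _ := trivial
  lact_d _ _ := Subsingleton.elim (α := PUnit) _ _
  ract_d _ _ := Subsingleton.elim (α := PUnit) _ _
  id_lact _ := rfl
  ract_id _ := rfl
  lact_lact _ _ _ := rfl
  ract_ract _ _ _ := rfl
  lact_ract _ _ _ := rfl

/-- The left module `M|Y⟩`, with components `⟨X|M|Y⟩`. -/
def ket (M : Bimod C D) (Y : D.Obj) : Bimod C (DGCat.unit : DGCat.{u, w} k G) where
  obj X _ := M.obj X Y
  lact := M.lact
  ract {X _ _} := (LinearMap.lsmul k (M.obj X Y)).flip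
  lact_deg := M.lact_deg
  ract_deg {X _ _ _ _ _} := fun {_ : k} hm hc => smul_mem_deg_right (M.obj X Y) hm hc
  lact_d := M.lact_d
  ract_d {X _ _ _ m} := fun (c : k) _ => smul_d_right (M.obj X Y) m c _
  id_lact := M.id_lact
  ract_id m := one_smul k m
  lact_lact := M.lact_lact
  ract_ract := fun m (c c' : k) => by
    change (c * c') • m = c' • c • m
    rw [smul_smul, mul_comm]
  lact_ract := fun f m (c : k) => ((M.lact f).map_smul c m).symm

/-- The right module `⟨X|M`, with components `⟨X|M|Y⟩`. -/
def bra (X : C.Obj) (M : Bimod C D) : Bimod (DGCat.unit : DGCat.{u, w} k G) D where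
  obj _ Y := M.obj X Y
  lact {_ _ Y} := LinearMap.lsmul k (M.obj X Y)
  ract := M.ract
  lact_deg {_ _ Y _ _} := fun {_ : k} _ hc hm => smul_mem_deg_left (M.obj X Y) hc hm
  ract_deg := M.ract_deg
  lact_d {_ _ Y _} := fun {_ : k} m hc => smul_d_left (M.obj X Y) m hc
  ract_d := M.ract_d
  id_lact m := one_smul k m
  ract_id := M.ract_id
  lact_lact := fun (c c' : k) m => mul_smul c c' m
  ract_ract := M.ract_ract
  lact_ract := fun (c : k) m g => LinearMap.map_smul₂ M.ract c m g

/-- The `(C, D)`-bimodule `⨁_X |X⟩ ⊗ ⟨X|M`, with components `⨁_X ⟨Y|X⟩ ⊗ ⟨X|M|Z⟩`, on which `C`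
acts through the factors `⟨Y|X⟩` and `D` through the factors `⟨X|M|Z⟩`. -/
def free (M : Bimod C D) : Bimod C D where
  obj Y Z := DGMod.sumTensor (fun X => C.bk Y X) (fun X => M.obj X Z)
  lact := DGMod.smapL fun _ => C.comp
  ract := DGMod.smapR fun _ => M.ract
  lact_deg {Y' Y Z i j f m} hf hm := by
    refine DGMod.sumTensor_mem_le (S := ((DGMod.sumTensor (fun X => C.bk Y' X)
      (fun X => M.obj X Z)).deg (i + j)).comap (DGMod.smapL (fun _ => C.comp) f)) ?_ hm
    intro X p q a b ha hb h
    rw [Submodule.mem_comap, DGMod.smapL_smk]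
    exact DGMod.smk_mem_deg (C.comp_deg hf ha) hb (by rw [← h, add_assoc])
  ract_deg {Y Z Z' i j m g} hm hg := by
    refine DGMod.sumTensor_mem_le (S := ((DGMod.sumTensor (fun X => C.bk Y X)
      (fun X => M.obj X Z')).deg (i + j)).comap
        ((DGMod.smapR (fun _ => M.ract)).flip g)) ?_ hm
    intro X p q a b ha hb h
    rw [Submodule.mem_comap, LinearMap.flip_apply, DGMod.smapR_smk]
    exact DGMod.smk_mem_deg ha (M.ract_deg hb hg) (by rw [← h, add_assoc])
  lact_d {Y' Y Z i f} m hf := by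
    refine LinearMap.congr_fun (f := DGMod.d _ ∘ₗ DGMod.smapL (fun _ => C.comp) f)
      (g := DGMod.smapL (fun _ => C.comp) ((C.bk Y' Y).d f) + G.sgn k G.ι i •
        (DGMod.smapL (fun _ => C.comp) f ∘ₗ DGMod.d _)) ?_ m
    refine DGMod.sumTensor_ext fun X p q a b ha hb => ?_
    simp [DGMod.sumTensor_d_smk ha, DGMod.sumTensor_d_smk (C.comp_deg hf ha), C.comp_d _ hf,
      sgn_add_right, mul_smul, add_assoc]
  ract_d {Y Z Z' i m} g hm := by
    refine DGMod.sumTensor_ext_deg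
      (φ := DGMod.d _ ∘ₗ (DGMod.smapR (fun _ => M.ract)).flip g)
      (ψ := (DGMod.smapR (fun _ => M.ract)).flip g ∘ₗ DGMod.d _ + G.sgn k G.ι i •
        (DGMod.smapR (fun _ => M.ract)).flip ((D.bk Z Z').d g)) ?_ m hm
    rintro X p q a b ha hb rfl
    simp [DGMod.sumTensor_d_smk ha, M.ract_d _ hb, sgn_add_right, mul_smul, add_assoc]
  id_lact {Y Z} m := by
    refine LinearMap.congr_fun (f := DGMod.smapL (fun _ => C.comp) (C.id Y))
      (g := LinearMap.id) (DGMod.sumTensor_ext fun X p q a b ha hb => ?_) m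
    simp [C.id_comp]
  ract_id {Y Z} m := by
    refine LinearMap.congr_fun (f := (DGMod.smapR (fun _ => M.ract)).flip (D.id Z))
      (g := LinearMap.id) (DGMod.sumTensor_ext fun X p q a b ha hb => ?_) m
    simp [M.ract_id]
  lact_lact f f' m := by
    refine LinearMap.congr_fun (f := DGMod.smapL (fun _ => C.comp) (C.comp f f'))
      (g := DGMod.smapL (fun _ => C.comp) f ∘ₗ DGMod.smapL (fun _ => C.comp) f')
      (DGMod.sumTensor_ext fun X p q a b ha hb => ?_) m
    simp [C.assoc]
  ract_ract m g g' := by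
    refine LinearMap.congr_fun (f := (DGMod.smapR (fun _ => M.ract)).flip (D.comp g g'))
      (g := (DGMod.smapR (fun _ => M.ract)).flip g' ∘ₗ (DGMod.smapR (fun _ => M.ract)).flip g)
      (DGMod.sumTensor_ext fun X p q a b ha hb => ?_) m
    simp [M.ract_ract]
  lact_ract f m g := by
    refine LinearMap.congr_fun
      (f := (DGMod.smapR (fun _ => M.ract)).flip g ∘ₗ DGMod.smapL (fun _ => C.comp) f)
      (g := DGMod.smapL (fun _ => C.comp) f ∘ₗ (DGMod.smapR (fun _ => M.ract)).flip g)
      (DGMod.sumTensor_ext fun X p q a b ha hb => ?_) m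
    simp

section Shift

variable (j : Γ) (M : Bimod C D) {X'' X' X : C.Obj} {Y Y' : D.Obj}

lemma sOp_comp (f : C.bk X'' X') (f' : C.bk X' X) : (C.bk X'' X).sOp j (C.comp f f') =
    C.comp ((C.bk X'' X').sOp j f) ((C.bk X' X).sOp j f') := by
  refine LinearMap.congr_fun (f := (C.bk X'' X).sOp j ∘ₗ C.comp.flip f')
    (g := C.comp.flip ((C.bk X' X).sOp j f') ∘ₗ (C.bk X'' X').sOp j)
    (DGMod.ext_hom fun i f hf => ?_) f
  refine LinearMap.congr_fun (f := (C.bk X'' X).sOp j ∘ₗ C.comp f)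
    (g := C.comp ((C.bk X'' X').sOp j f) ∘ₗ (C.bk X' X).sOp j)
    (DGMod.ext_hom fun i' f' hf' => ?_) f'
  simp only [LinearMap.comp_apply, DGMod.sOp_apply _ hf, DGMod.sOp_apply _ hf',
    DGMod.sOp_apply _ (C.comp_deg hf hf'), sgn_add_right, mul_smul, map_smul,
    LinearMap.smul_apply]
  rw [smul_comm]

lemma shift_lact_deg {i l : Γ} {f : C.bk X' X} {m : M.obj X Y} (hf : f ∈ (C.bk X' X).deg i)
    (hm : m ∈ (M.obj X Y).deg (l - j)) :
    M.lact ((C.bk X' X).sOp j f) m ∈ (M.obj X' Y).deg (i + l - j) := by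
  rw [DGMod.sOp_apply _ hf, LinearMap.map_smul₂, add_sub_assoc]
  exact Submodule.smul_mem _ _ (M.lact_deg hf hm)

lemma shift_lact_d {i : Γ} {f : C.bk X' X} (m : M.obj X Y) (hf : f ∈ (C.bk X' X).deg i) :
    G.sgn k j G.ι • (M.obj X' Y).d (M.lact ((C.bk X' X).sOp j f) m) =
      M.lact ((C.bk X' X).sOp j ((C.bk X' X).d f)) m + G.sgn k G.ι i •
        M.lact ((C.bk X' X).sOp j f) (G.sgn k j G.ι • (M.obj X Y).d m) := by
  rw [DGMod.sOp_apply _ hf, DGMod.sOp_apply _ ((C.bk X' X).d_deg hf)]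
  simp only [map_smul, LinearMap.smul_apply, M.lact_d m hf, sgn_add_right]
  module

lemma shift_ract_d {i : Γ} {m : M.obj X Y} (g : D.bk Y Y') (hm : m ∈ (M.obj X Y).deg (i - j)) :
    G.sgn k j G.ι • (M.obj X Y').d (M.ract m g) =
      M.ract (G.sgn k j G.ι • (M.obj X Y).d m) g + G.sgn k G.ι i • M.ract m ((D.bk Y Y').d g) := by
  have h : G.sgn k j G.ι * G.sgn k G.ι (i - j) = G.sgn k G.ι i := by
    rw [sgn_symm, ← sgn_add_right, add_sub_cancel]
  rw [M.ract_d g hm, LinearMap.map_smul₂, smul_add, smul_smul, h]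

lemma shift_id_lact (m : M.obj X Y) : M.lact ((C.bk X X).sOp j (C.id X)) m = m := by
  rw [DGMod.sOp_apply _ (C.id_deg X), sgn_zero_right, one_smul, M.id_lact]

lemma shift_lact_lact (f : C.bk X'' X') (f' : C.bk X' X) (m : M.obj X Y) :
    M.lact ((C.bk X'' X).sOp j (C.comp f f')) m =
      M.lact ((C.bk X'' X').sOp j f) (M.lact ((C.bk X' X).sOp j f') m) := by
  rw [sOp_comp, M.lact_lact]

/-- The shift `q^j M`; the left action is `f · m = (-1)^⟨j,|f|⟩ f m`. -/
def shift : Bimod C D where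
  obj X Y := (M.obj X Y).shift j
  lact {X' X Y} := (M.lact (Y := Y)) ∘ₗ (C.bk X' X).sOp j
  ract := M.ract
  lact_deg := M.shift_lact_deg j
  ract_deg {X Y Y' i l m g} hm hg := by
    change M.ract m g ∈ (M.obj X Y').deg (i + l - j)
    rw [add_sub_right_comm]
    exact M.ract_deg hm hg
  lact_d := M.shift_lact_d j
  ract_d := M.shift_ract_d j
  id_lact := M.shift_id_lact j
  ract_id := M.ract_id
  lact_lact := M.shift_lact_lact j
  ract_ract := M.ract_ract
  lact_ract {X' X Y Y'} f m g := M.lact_ract ((C.bk X' X).sOp j f) m g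

end Shift

/-- The direct sum of bimodules. -/
def directSum {I : Type} (M : I → Bimod C D) : Bimod C D where
  obj X Y := DGMod.directSum fun i => (M i).obj X Y
  lact := DGMod.dmapL fun i => (M i).lact
  ract := DGMod.dmapR fun i => (M i).ract
  lact_deg {X' X Y p q f m} hf hm := by
    refine DGMod.directSum_mem_le (S := ((DGMod.directSum fun i => (M i).obj X' Y).deg
      (p + q)).comap (DGMod.dmapL (fun i => (M i).lact) f)) ?_ hm
    intro i x hx
    rw [Submodule.mem_comap, DGMod.dmapL_dof]
    exact DGMod.dof_mem_deg ((M i).lact_deg hf hx)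
  ract_deg {X Y Y' p q m g} hm hg := by
    refine DGMod.directSum_mem_le (S := ((DGMod.directSum fun i => (M i).obj X Y').deg
      (p + q)).comap ((DGMod.dmapR fun i => (M i).ract).flip g)) ?_ hm
    intro i x hx
    rw [Submodule.mem_comap, LinearMap.flip_apply, DGMod.dmapR_dof]
    exact DGMod.dof_mem_deg ((M i).ract_deg hx hg)
  lact_d {X' X Y p f} m hf := by
    refine LinearMap.congr_fun (f := DGMod.d _ ∘ₗ DGMod.dmapL (fun i => (M i).lact) f)
      (g := DGMod.dmapL (fun i => (M i).lact) ((C.bk X' X).d f) + G.sgn k G.ι p •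
        (DGMod.dmapL (fun i => (M i).lact) f ∘ₗ DGMod.d _)) ?_ m
    refine DGMod.directSum_ext fun i x => ?_
    simp [(M i).lact_d _ hf]
  ract_d {X Y Y' p m} g hm := by
    refine DGMod.directSum_mem_le (S := LinearMap.eqLocus
      (DGMod.d _ ∘ₗ (DGMod.dmapR fun i => (M i).ract).flip g)
      ((DGMod.dmapR fun i => (M i).ract).flip g ∘ₗ DGMod.d _ + G.sgn k G.ι p •
        (DGMod.dmapR fun i => (M i).ract).flip ((D.bk Y Y').d g))) ?_ hm
    intro i x hx
    simp [LinearMap.mem_eqLocus, (M i).ract_d _ hx]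
  id_lact {X Y} m := by
    refine LinearMap.congr_fun (f := DGMod.dmapL (fun i => (M i).lact) (C.id X))
      (g := LinearMap.id) (DGMod.directSum_ext fun i x => ?_) m
    simp [(M i).id_lact]
  ract_id {X Y} m := by
    refine LinearMap.congr_fun (f := (DGMod.dmapR fun i => (M i).ract).flip (D.id Y))
      (g := LinearMap.id) (DGMod.directSum_ext fun i x => ?_) m
    simp [(M i).ract_id]
  lact_lact f f' m := by
    refine LinearMap.congr_fun (f := DGMod.dmapL (fun i => (M i).lact) (C.comp f f'))
      (g := DGMod.dmapL (fun i => (M i).lact) f ∘ₗ DGMod.dmapL (fun i => (M i).lact) f')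
      (DGMod.directSum_ext fun i x => ?_) m
    simp [(M i).lact_lact]
  ract_ract m g g' := by
    refine LinearMap.congr_fun (f := (DGMod.dmapR fun i => (M i).ract).flip (D.comp g g'))
      (g := (DGMod.dmapR fun i => (M i).ract).flip g' ∘ₗ
        (DGMod.dmapR fun i => (M i).ract).flip g)
      (DGMod.directSum_ext fun i x => ?_) m
    simp [(M i).ract_ract]
  lact_ract f m g := by
    refine LinearMap.congr_fun
      (f := (DGMod.dmapR fun i => (M i).ract).flip g ∘ₗ DGMod.dmapL (fun i => (M i).lact) f)
      (g := DGMod.dmapL (fun i => (M i).lact) f ∘ₗ (DGMod.dmapR fun i => (M i).ract).flip g)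
      (DGMod.directSum_ext fun i x => ?_) m
    simp [(M i).lact_ract]

/-- The bimodule maps `M → N` of degree `l`: families of `k`-linear maps of degree `l` such that
`φ(f m) = (-1)^⟨l,|f|⟩ f φ(m)` and `φ(m g) = φ(m) g`. -/
def homSub (M N : Bimod C D) (l : Γ) : Submodule k (∀ X Y, M.obj X Y →ₗ[k] N.obj X Y) where
  carrier := {φ |
    (∀ X Y i, ∀ m ∈ (M.obj X Y).deg i, φ X Y m ∈ (N.obj X Y).deg (i + l)) ∧
    (∀ X' X Y i, ∀ f ∈ (C.bk X' X).deg i, ∀ m : M.obj X Y,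
      φ X' Y (M.lact f m) = G.sgn k l i • N.lact f (φ X Y m)) ∧
    (∀ X Y Y' (m : M.obj X Y) (g : D.bk Y Y'), φ X Y' (M.ract m g) = N.ract (φ X Y m) g)}
  add_mem' := by
    rintro φ ψ ⟨h1, h2, h3⟩ ⟨h1', h2', h3'⟩
    refine ⟨fun X Y i m hm => Submodule.add_mem _ (h1 X Y i m hm) (h1' X Y i m hm),
      fun X' X Y i f hf m => ?_, fun X Y Y' m g => ?_⟩
    · simp [h2 _ _ _ _ f hf, h2' _ _ _ _ f hf]
    · simp [h3, h3']
  zero_mem' := ⟨fun _ _ _ _ _ => Submodule.zero_mem _, by simp, by simp⟩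
  smul_mem' := by
    rintro c φ ⟨h1, h2, h3⟩
    refine ⟨fun X Y i m hm => Submodule.smul_mem _ _ (h1 X Y i m hm),
      fun X' X Y i f hf m => ?_, fun X Y Y' m g => ?_⟩
    · simp [h2 _ _ _ _ f hf, smul_comm c]
    · simp [h3]

/-- The differential `d(φ) = d ∘ φ - (-1)^⟨ι,l⟩ φ ∘ d` of a bimodule map of degree `l`. -/
def dHom (M N : Bimod C D) (l : Γ) : homSub M N l →ₗ[k] homSub M N (l + G.ι) where
  toFun φ := ⟨fun X Y => (N.obj X Y).d ∘ₗ φ.1 X Y - G.sgn k G.ι l • φ.1 X Y ∘ₗ (M.obj X Y).d, by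
    obtain ⟨φ, h1, h2, h3⟩ := φ
    refine ⟨fun X Y i m hm => ?_, fun X' X Y i f hf m => ?_, fun X Y Y' m g => ?_⟩
    · refine Submodule.sub_mem _ ?_ (Submodule.smul_mem _ _ ?_)
      · rw [← add_assoc]; exact (N.obj X Y).d_deg (h1 X Y i m hm)
      · have := h1 X Y _ _ ((M.obj X Y).d_deg hm)
        rwa [add_assoc, add_comm G.ι, ← add_assoc, add_assoc] at this
    · have hdf := (C.bk X' X).d_deg hf
      simp only [LinearMap.sub_apply, LinearMap.smul_apply, LinearMap.comp_apply,
        h2 _ _ _ _ f hf, M.lact_d _ hf, N.lact_d _ hf, map_add, map_smul, map_sub,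
        h2 _ _ _ _ _ hdf, sgn_add_right, sgn_add_left, smul_add, smul_sub, smul_smul]
      have e : G.sgn k G.ι l * (G.sgn k l i * G.sgn k l G.ι) = G.sgn k l i := by
        rw [sgn_symm G k l G.ι, mul_left_comm, sgn_mul_self, mul_one]
      rw [e]
      module
    · refine LinearMap.congr_fun (f := ((N.obj X Y').d ∘ₗ φ X Y' -
        G.sgn k G.ι l • φ X Y' ∘ₗ (M.obj X Y').d) ∘ₗ M.ract.flip g)
        (g := N.ract.flip g ∘ₗ ((N.obj X Y).d ∘ₗ φ X Y -
        G.sgn k G.ι l • φ X Y ∘ₗ (M.obj X Y).d)) (DGMod.ext_hom fun i m hm => ?_) m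
      simp only [LinearMap.sub_apply, LinearMap.smul_apply, LinearMap.comp_apply,
        LinearMap.flip_apply, h3, M.ract_d g hm, N.ract_d g (h1 _ _ _ _ hm), map_add, map_smul,
        map_sub, sgn_add_right, smul_add, smul_smul]
      module⟩
  map_add' φ ψ := by
    ext X Y m
    simp only [Submodule.coe_add, Pi.add_apply, LinearMap.sub_apply, LinearMap.smul_apply,
      LinearMap.comp_apply, LinearMap.add_apply, map_add, smul_add]
    abel
  map_smul' c φ := by
    ext X Y m
    simp only [SetLike.val_smul, Pi.smul_apply, LinearMap.sub_apply, LinearMap.smul_apply,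
      LinearMap.comp_apply, map_smul, smul_sub, RingHom.id_apply, smul_comm c]

lemma dHom_apply {M N : Bimod C D} {l : Γ} (φ : homSub M N l) (X : C.Obj) (Y : D.Obj)
    (m : M.obj X Y) : (dHom M N l φ).1 X Y m =
      (N.obj X Y).d (φ.1 X Y m) - G.sgn k G.ι l • φ.1 X Y ((M.obj X Y).d m) := rfl

/-- The dg module `Hom_Bim(M, N)`. -/
def Hom (M N : Bimod C D) : DGMod.{u, max u w, w} k G :=
  DGMod.ofFamily (fun l => homSub M N l) (dHom M N) (fun l φ => by
    ext X Y m
    rw [dHom_apply, dHom_apply, dHom_apply]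
    simp [(M.obj X Y).d_d, (N.obj X Y).d_d, sgn_add_right])

/-- Homotopy equivalence of bimodules: closed degree zero bimodule maps `f`, `g` with `g ∘ f - id`
and `f ∘ g - id` exact. -/
def HEquiv (M N : Bimod C D) : Prop :=
  ∃ (f : homSub M N 0) (g : homSub N M 0) (h : homSub M M (-G.ι)) (h' : homSub N N (-G.ι)),
    dHom M N 0 f = 0 ∧ dHom N M 0 g = 0 ∧
    (∀ X Y, g.1 X Y ∘ₗ f.1 X Y - LinearMap.id = (dHom M M (-G.ι) h).1 X Y) ∧
    (∀ X Y, f.1 X Y ∘ₗ g.1 X Y - LinearMap.id = (dHom N N (-G.ι) h').1 X Y)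

section Twist

variable (M : Bimod C D) (α : homSub M M G.ι)
  (hMC : ∀ X Y m, (M.obj X Y).d (α.1 X Y m) + α.1 X Y ((M.obj X Y).d m) +
    α.1 X Y (α.1 X Y m) = 0)

/-- The twist `tw_α(M)`: the same bimodule, with differential `d + α`. -/
def twist : Bimod C D where
  obj X Y := (M.obj X Y).twist (α.1 X Y) (fun hx => α.2.1 X Y _ _ hx) (hMC X Y)
  lact := M.lact
  ract := M.ract
  lact_deg := M.lact_deg
  ract_deg := M.ract_deg
  lact_d {X' X Y i f} := fun (m : M.obj X Y) hf => by
    change (M.obj X' Y).d (M.lact f m) + α.1 X' Y (M.lact f m) = M.lact ((C.bk X' X).d f) m +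
      G.sgn k G.ι i • M.lact f ((M.obj X Y).d m + α.1 X Y m)
    rw [M.lact_d m hf, α.2.2.1 _ _ _ _ f hf, map_add, smul_add, add_assoc]
  ract_d {X Y Y' i} := fun {m : M.obj X Y} g hm => by
    change (M.obj X Y').d (M.ract m g) + α.1 X Y' (M.ract m g) =
      M.ract ((M.obj X Y).d m + α.1 X Y m) g + G.sgn k G.ι i • M.ract m ((D.bk Y Y').d g)
    rw [M.ract_d g hm, α.2.2.2, LinearMap.map_add₂]
    abel
  id_lact := M.id_lact
  ract_id := M.ract_id
  lact_lact := M.lact_lact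
  ract_ract := M.ract_ract
  lact_ract := M.lact_ract

end Twist

section TensorOver

/-- The relations `m f ⊗ n - m ⊗ f n` for homogeneous `m`, `f`, `n`. -/
def rel (M : Bimod A C) (N : Bimod C D) (X : A.Obj) (Z : D.Obj) :
    Set (DGMod.sumTensor (fun Y => M.obj X Y) (fun Y => N.obj Y Z)) :=
  {r | ∃ (Y Y' : C.Obj) (p q l : Γ) (m : M.obj X Y) (f : C.bk Y Y') (n : N.obj Y' Z),
    m ∈ (M.obj X Y).deg p ∧ f ∈ (C.bk Y Y').deg q ∧ n ∈ (N.obj Y' Z).deg l ∧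
    r = DGMod.smk (fun Y => M.obj X Y) (fun Y => N.obj Y Z) Y' (M.ract m f) n -
      DGMod.smk (fun Y => M.obj X Y) (fun Y => N.obj Y Z) Y m (N.lact f n)}

variable (M : Bimod A C) (N : Bimod C D)

lemma rel_hom (X : A.Obj) (Z : D.Obj) : ∀ r ∈ rel M N X Z,
    ∃ i, r ∈ (DGMod.sumTensor (fun Y => M.obj X Y) (fun Y => N.obj Y Z)).deg i := by
  rintro _ ⟨Y, Y', p, q, l, m, f, n, hm, hf, hn, rfl⟩
  exact ⟨p + q + l, Submodule.sub_mem _ (DGMod.smk_mem_deg (M.ract_deg hm hf) hn rfl)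
    (DGMod.smk_mem_deg hm (N.lact_deg hf hn) (add_assoc _ _ _).symm)⟩

lemma rel_d (X : A.Obj) (Z : D.Obj) : ∀ r ∈ rel M N X Z,
    (DGMod.sumTensor (fun Y => M.obj X Y) (fun Y => N.obj Y Z)).d r ∈
      Submodule.span k (rel M N X Z) := by
  rintro _ ⟨Y, Y', p, q, l, m, f, n, hm, hf, hn, rfl⟩
  have h1 := Submodule.subset_span (R := k) (s := rel M N X Z)
    ⟨Y, Y', p + G.ι, q, l, (M.obj X Y).d m, f, n, (M.obj X Y).d_deg hm, hf, hn, rfl⟩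
  have h2 := Submodule.subset_span (R := k) (s := rel M N X Z)
    ⟨Y, Y', p, q + G.ι, l, m, (C.bk Y Y').d f, n, hm, (C.bk Y Y').d_deg hf, hn, rfl⟩
  have h3 := Submodule.subset_span (R := k) (s := rel M N X Z)
    ⟨Y, Y', p, q, l + G.ι, m, f, (N.obj Y' Z).d n, hm, hf, (N.obj Y' Z).d_deg hn, rfl⟩
  have h := Submodule.add_mem _ (Submodule.add_mem _ h1 (Submodule.smul_mem _ (G.sgn k G.ι p) h2))
    (Submodule.smul_mem _ (G.sgn k G.ι (p + q)) h3)
  convert h using 1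
  rw [map_sub, DGMod.sumTensor_d_smk (M.ract_deg hm hf), DGMod.sumTensor_d_smk hm,
    M.ract_d _ hm, N.lact_d _ hf, sgn_add_right]
  simp only [map_add, map_smul, LinearMap.add_apply, LinearMap.smul_apply]
  module

/-- The complex `⟨X|M ⊗_C N|Z⟩`, the quotient of `⨁_Y ⟨X|M|Y⟩ ⊗ ⟨Y|N|Z⟩` by `m f ⊗ n ∼ m ⊗ f n`. -/
def tensorObj (X : A.Obj) (Z : D.Obj) : DGMod.{u, u, w} k G :=
  (DGMod.sumTensor (fun Y => M.obj X Y) (fun Y => N.obj Y Z)).quot (rel M N X Z)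
    (rel_hom M N X Z) (rel_d M N X Z)

/-- The class of `m ⊗ n` in `⟨X|M ⊗_C N|Z⟩`. -/
def tmk {X : A.Obj} {Z : D.Obj} (Y : C.Obj) :
    M.obj X Y →ₗ[k] N.obj Y Z →ₗ[k] tensorObj M N X Z :=
  (DGMod.smk (fun Y => M.obj X Y) (fun Y => N.obj Y Z) Y).compr₂
    (DGMod.qmk _ (rel M N X Z) (rel_hom M N X Z) (rel_d M N X Z))

variable {M N} {X : A.Obj} {Z : D.Obj}

lemma tensorObj_mem_le {n : Γ} {S : Submodule k (tensorObj M N X Z)} (h : ∀ Y i j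
    (a : M.obj X Y) (b : N.obj Y Z), a ∈ (M.obj X Y).deg i → b ∈ (N.obj Y Z).deg j → i + j = n →
    tmk M N Y a b ∈ S) : (tensorObj M N X Z).deg n ≤ S :=
  DGMod.quot_mem_le fun _ hx => DGMod.sumTensor_mem_le
    (S := S.comap (DGMod.qmk _ (rel M N X Z) (rel_hom M N X Z) (rel_d M N X Z))) h hx

lemma tensorObj_ext_deg {P : Type*} [AddCommGroup P] [Module k P] {n : Γ}
    {φ ψ : tensorObj M N X Z →ₗ[k] P} (h : ∀ Y i j (a : M.obj X Y) (b : N.obj Y Z),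
      a ∈ (M.obj X Y).deg i → b ∈ (N.obj Y Z).deg j → i + j = n →
      φ (tmk M N Y a b) = ψ (tmk M N Y a b)) : ∀ t ∈ (tensorObj M N X Z).deg n, φ t = ψ t :=
  tensorObj_mem_le (S := LinearMap.eqLocus φ ψ) h

lemma tensorObj_ext {P : Type*} [AddCommGroup P] [Module k P]
    {φ ψ : tensorObj M N X Z →ₗ[k] P} (h : ∀ Y i j (a : M.obj X Y) (b : N.obj Y Z),
      a ∈ (M.obj X Y).deg i → b ∈ (N.obj Y Z).deg j →
      φ (tmk M N Y a b) = ψ (tmk M N Y a b)) : φ = ψ :=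
  DGMod.ext_hom fun _ => tensorObj_ext_deg fun Y i j a b ha hb _ => h Y i j a b ha hb

lemma tmk_mem_deg {Y : C.Obj} {i j n : Γ} {a : M.obj X Y} {b : N.obj Y Z}
    (ha : a ∈ (M.obj X Y).deg i) (hb : b ∈ (N.obj Y Z).deg j) (h : i + j = n) :
    tmk M N Y a b ∈ (tensorObj M N X Z).deg n :=
  DGMod.qmk_mem_deg (DGMod.smk_mem_deg ha hb h)

lemma tensorObj_d_tmk {Y : C.Obj} {i : Γ} {a : M.obj X Y} (ha : a ∈ (M.obj X Y).deg i)
    (b : N.obj Y Z) : (tensorObj M N X Z).d (tmk M N Y a b) =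
      tmk M N Y ((M.obj X Y).d a) b + G.sgn k G.ι i • tmk M N Y a ((N.obj Y Z).d b) := by
  refine (DGMod.quot_d_qmk _).trans ?_
  rw [DGMod.sumTensor_d_smk ha, map_add, map_smul]
  rfl

/-- The relation `m f ⊗ n = m ⊗ f n`, for all `m`, `f`, `n`. -/
lemma tmk_ract {Y Y' : C.Obj} (m : M.obj X Y) (f : C.bk Y Y') (n : N.obj Y' Z) :
    tmk M N Y' (M.ract m f) n = tmk M N Y m (N.lact f n) := by
  refine LinearMap.congr_fun (f := (tmk M N Y').flip n ∘ₗ M.ract.flip f)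
    (g := (tmk M N Y).flip (N.lact f n)) (DGMod.ext_hom fun p m hm => ?_) m
  refine LinearMap.congr_fun (f := (tmk M N Y').flip n ∘ₗ M.ract m)
    (g := tmk M N Y m ∘ₗ N.lact.flip n) (DGMod.ext_hom fun q f hf => ?_) f
  refine LinearMap.congr_fun (f := tmk M N Y' (M.ract m f))
    (g := tmk M N Y m ∘ₗ N.lact f) (DGMod.ext_hom fun l n hn => ?_) n
  have h := DGMod.qmk_rel (hR := rel_hom M N X Z) (hd := rel_d M N X Z)
    ⟨Y, Y', p, q, l, m, f, n, hm, hf, hn, rfl⟩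
  rw [map_sub, sub_eq_zero] at h
  exact h

variable (M N)

/-- The left action of `A` on `M ⊗_C N`. -/
def tensorLact {X' X : A.Obj} {Z : D.Obj} :
    A.bk X' X →ₗ[k] tensorObj M N X Z →ₗ[k] tensorObj M N X' Z :=
  (DGMod.qlift ((DGMod.smapL fun _ => M.lact).compr₂
    (DGMod.qmk _ (rel M N X' Z) (rel_hom M N X' Z) (rel_d M N X' Z))).flip (by
      rintro _ ⟨Y, Y', p, q, l, m, f, n, hm, hf, hn, rfl⟩
      ext g
      simp only [map_sub, LinearMap.sub_apply, LinearMap.flip_apply, LinearMap.compr₂_apply,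
        DGMod.smapL_smk, LinearMap.zero_apply, sub_eq_zero, ← M.lact_ract]
      exact tmk_ract (M := M) (N := N) (M.lact g m) f n)).flip

/-- The right action of `D` on `M ⊗_C N`. -/
def tensorRact {X : A.Obj} {Z Z' : D.Obj} :
    tensorObj M N X Z →ₗ[k] D.bk Z Z' →ₗ[k] tensorObj M N X Z' :=
  DGMod.qlift ((DGMod.smapR fun _ => N.ract).compr₂
    (DGMod.qmk _ (rel M N X Z') (rel_hom M N X Z') (rel_d M N X Z'))) (by
      rintro _ ⟨Y, Y', p, q, l, m, f, n, hm, hf, hn, rfl⟩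
      ext g
      have h1 := congrArg (DGMod.qmk _ (rel M N X Z') (rel_hom M N X Z') (rel_d M N X Z'))
        (DGMod.smapR_smk (A := fun Y => M.obj X Y) (B := fun Y => N.obj Y Z)
          (B' := fun Y => N.obj Y Z') (fun _ => N.ract) g Y' (M.ract m f) n)
      have h2 := congrArg (DGMod.qmk _ (rel M N X Z') (rel_hom M N X Z') (rel_d M N X Z'))
        (DGMod.smapR_smk (A := fun Y => M.obj X Y) (B := fun Y => N.obj Y Z)
          (B' := fun Y => N.obj Y Z') (fun _ => N.ract) g Y m (N.lact f n))
      rw [N.lact_ract] at h2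
      rw [map_sub, LinearMap.sub_apply, LinearMap.zero_apply, sub_eq_zero]
      exact h1.trans ((tmk_ract m f (N.ract n g)).trans h2.symm))

variable {M N}

@[simp] lemma tensorLact_tmk {X' X : A.Obj} {Y : C.Obj} {Z : D.Obj} (f : A.bk X' X)
    (m : M.obj X Y) (n : N.obj Y Z) :
    tensorLact M N f (tmk M N Y m n) = tmk M N Y (M.lact f m) n := by
  have h := DGMod.smapL_smk (A := fun Y => M.obj X Y) (B := fun Y => N.obj Y Z)
    (fun _ => M.lact) f Y m n
  exact congrArg (DGMod.qmk _ (rel M N X' Z) (rel_hom M N X' Z) (rel_d M N X' Z)) h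

@[simp] lemma tensorRact_tmk {X : A.Obj} {Y : C.Obj} {Z Z' : D.Obj} (m : M.obj X Y)
    (n : N.obj Y Z) (g : D.bk Z Z') :
    tensorRact M N (tmk M N Y m n) g = tmk M N Y m (N.ract n g) := by
  have h := DGMod.smapR_smk (A := fun Y => M.obj X Y) (B := fun Y => N.obj Y Z)
    (fun _ => N.ract) g Y m n
  exact congrArg (DGMod.qmk _ (rel M N X Z') (rel_hom M N X Z') (rel_d M N X Z')) h

variable (M N)

/-- The tensor product `M ⊗_C N` of bimodules. -/
def tensor : Bimod A D where
  obj := tensorObj M N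
  lact := tensorLact M N
  ract := tensorRact M N
  lact_deg {X' X Z i j f m} hf hm := by
    refine tensorObj_mem_le (S := ((tensorObj M N X' Z).deg (i + j)).comap
      (tensorLact M N f)) ?_ hm
    intro Y p q a b ha hb h
    rw [Submodule.mem_comap, tensorLact_tmk]
    exact tmk_mem_deg (M.lact_deg hf ha) hb (by rw [← h, add_assoc])
  ract_deg {X Z Z' i j m g} hm hg := by
    refine tensorObj_mem_le (S := ((tensorObj M N X Z').deg (i + j)).comap
      ((tensorRact M N).flip g)) ?_ hm
    intro Y p q a b ha hb h
    rw [Submodule.mem_comap, LinearMap.flip_apply, tensorRact_tmk]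
    exact tmk_mem_deg ha (N.ract_deg hb hg) (by rw [← h, add_assoc])
  lact_d {X' X Z i f} m hf := by
    refine LinearMap.congr_fun (f := DGMod.d _ ∘ₗ tensorLact M N f)
      (g := tensorLact M N ((A.bk X' X).d f) + G.sgn k G.ι i •
        (tensorLact M N f ∘ₗ DGMod.d _)) ?_ m
    refine tensorObj_ext fun Y p q a b ha hb => ?_
    simp [tensorObj_d_tmk ha, tensorObj_d_tmk (M.lact_deg hf ha), M.lact_d _ hf,
      sgn_add_right, mul_smul, add_assoc]
  ract_d {X Z Z' i m} g hm := by
    refine tensorObj_ext_deg (φ := DGMod.d _ ∘ₗ (tensorRact M N).flip g)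
      (ψ := (tensorRact M N).flip g ∘ₗ DGMod.d _ + G.sgn k G.ι i •
        (tensorRact M N).flip ((D.bk Z Z').d g)) ?_ m hm
    rintro Y p q a b ha hb rfl
    simp [tensorObj_d_tmk ha, N.ract_d _ hb, sgn_add_right, mul_smul, add_assoc]
  id_lact {X Z} m := by
    refine LinearMap.congr_fun (f := tensorLact M N (A.id X)) (g := LinearMap.id)
      (tensorObj_ext fun Y p q a b ha hb => ?_) m
    simp [M.id_lact]
  ract_id {X Z} m := by
    refine LinearMap.congr_fun (f := (tensorRact M N).flip (D.id Z)) (g := LinearMap.id)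
      (tensorObj_ext fun Y p q a b ha hb => ?_) m
    simp [N.ract_id]
  lact_lact f f' m := by
    refine LinearMap.congr_fun (f := tensorLact M N (A.comp f f'))
      (g := tensorLact M N f ∘ₗ tensorLact M N f') (tensorObj_ext fun Y p q a b ha hb => ?_) m
    simp [M.lact_lact]
  ract_ract m g g' := by
    refine LinearMap.congr_fun (f := (tensorRact M N).flip (D.comp g g'))
      (g := (tensorRact M N).flip g' ∘ₗ (tensorRact M N).flip g)
      (tensorObj_ext fun Y p q a b ha hb => ?_) m
    simp [N.ract_ract]
  lact_ract f m g := by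
    refine LinearMap.congr_fun (f := (tensorRact M N).flip g ∘ₗ tensorLact M N f)
      (g := tensorLact M N f ∘ₗ (tensorRact M N).flip g)
      (tensorObj_ext fun Y p q a b ha hb => ?_) m
    simp

end TensorOver

/-! ### The bar complex -/

/-! ### The bar complex -/

section Free

variable (N : Bimod C D)

/-- The element `f ⊗ n` of `⨁_X ⟨Y|C|X⟩ ⊗ ⟨X|N|Z⟩`. -/
def fmk {Y : C.Obj} {Z : D.Obj} (X : C.Obj) : C.bk Y X →ₗ[k] N.obj X Z →ₗ[k] N.free.obj Y Z :=
  DGMod.smk (fun X => C.bk Y X) (fun X => N.obj X Z) X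

variable {N}

lemma fmk_mem_deg {Y X : C.Obj} {Z : D.Obj} {i j n : Γ} {f : C.bk Y X} {m : N.obj X Z}
    (hf : f ∈ (C.bk Y X).deg i) (hm : m ∈ (N.obj X Z).deg j) (h : i + j = n) :
    N.fmk X f m ∈ (N.free.obj Y Z).deg n :=
  DGMod.smk_mem_deg hf hm h

lemma free_d_fmk {Y X : C.Obj} {Z : D.Obj} {i : Γ} {f : C.bk Y X} (hf : f ∈ (C.bk Y X).deg i)
    (m : N.obj X Z) : (N.free.obj Y Z).d (N.fmk X f m) =
      N.fmk X ((C.bk Y X).d f) m + G.sgn k G.ι i • N.fmk X f ((N.obj X Z).d m) :=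
  DGMod.sumTensor_d_smk (A := fun X => C.bk Y X) (B := fun X => N.obj X Z) hf m

lemma free_mem_le {Y : C.Obj} {Z : D.Obj} {n : Γ} {S : Submodule k (N.free.obj Y Z)}
    (h : ∀ X i j (f : C.bk Y X) (m : N.obj X Z), f ∈ (C.bk Y X).deg i → m ∈ (N.obj X Z).deg j →
      i + j = n → N.fmk X f m ∈ S) : (N.free.obj Y Z).deg n ≤ S :=
  DGMod.sumTensor_mem_le h

lemma free_ext {Y : C.Obj} {Z : D.Obj} {P : Type*} [AddCommGroup P] [Module k P]
    {φ ψ : N.free.obj Y Z →ₗ[k] P} (h : ∀ X i j (f : C.bk Y X) (m : N.obj X Z),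
      f ∈ (C.bk Y X).deg i → m ∈ (N.obj X Z).deg j → φ (N.fmk X f m) = ψ (N.fmk X f m)) :
    φ = ψ :=
  DGMod.sumTensor_ext h

@[simp] lemma free_lact_fmk {Y' Y X : C.Obj} {Z : D.Obj} (g : C.bk Y' Y) (f : C.bk Y X)
    (m : N.obj X Z) : N.free.lact g (N.fmk X f m) = N.fmk X (C.comp g f) m :=
  DGMod.smapL_smk ..

@[simp] lemma free_ract_fmk {Y X : C.Obj} {Z Z' : D.Obj} (f : C.bk Y X)
    (m : N.obj X Z) (g : D.bk Z Z') : N.free.ract (N.fmk X f m) g = N.fmk X f (N.ract m g) :=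
  DGMod.smapR_smk ..

/-- The linear map out of `⨁_X ⟨Y|C|X⟩ ⊗ ⟨X|N|Z⟩` given by bilinear maps. -/
def flift {Y : C.Obj} {Z : D.Obj} {P : Type*} [AddCommGroup P] [Module k P]
    (φ : ∀ X, C.bk Y X →ₗ[k] N.obj X Z →ₗ[k] P) : N.free.obj Y Z →ₗ[k] P :=
  DGMod.slift φ

@[simp] lemma flift_fmk {Y X : C.Obj} {Z : D.Obj} {P : Type*} [AddCommGroup P] [Module k P]
    (φ : ∀ X, C.bk Y X →ₗ[k] N.obj X Z →ₗ[k] P) (f : C.bk Y X) (m : N.obj X Z) :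
    flift φ (N.fmk X f m) = φ X f m :=
  DGMod.slift_smk ..

variable (N)

/-- The action map `⨁_X ⟨Y|C|X⟩ ⊗ ⟨X|N|Z⟩ → ⟨Y|N|Z⟩`. -/
def act : homSub N.free N 0 :=
  ⟨fun _ _ => flift fun _ => N.lact, by
    refine ⟨fun Y Z n t ht => ?_, fun Y' Y Z i g _ t => ?_, fun Y Z Z' t g => ?_⟩
    · refine free_mem_le (S := ((N.obj Y Z).deg (n + 0)).comap (flift fun _ => N.lact)) ?_ ht
      rintro X i j f m hf hm rfl
      rw [Submodule.mem_comap, flift_fmk, add_zero]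
      exact N.lact_deg hf hm
    · refine LinearMap.congr_fun (f := (flift fun _ => N.lact) ∘ₗ N.free.lact g)
        (g := G.sgn k 0 i • (N.lact g ∘ₗ flift fun _ => N.lact)) (free_ext ?_) t
      intro X i j f m _ _
      simp [N.lact_lact]
    · refine LinearMap.congr_fun (f := (flift fun _ => N.lact) ∘ₗ N.free.ract.flip g)
        (g := N.ract.flip g ∘ₗ flift fun _ => N.lact) (free_ext ?_) t
      intro X i j f m _ _
      simp [N.lact_ract]⟩

@[simp] lemma act_fmk {Y X : C.Obj} {Z : D.Obj} (f : C.bk Y X) (m : N.obj X Z) :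
    (act N).1 Y Z (N.fmk X f m) = N.lact f m :=
  flift_fmk ..

lemma act_d {Y : C.Obj} {Z : D.Obj} (t : N.free.obj Y Z) :
    (act N).1 Y Z ((N.free.obj Y Z).d t) = (N.obj Y Z).d ((act N).1 Y Z t) := by
  refine LinearMap.congr_fun (f := (act N).1 Y Z ∘ₗ (N.free.obj Y Z).d)
    (g := (N.obj Y Z).d ∘ₗ (act N).1 Y Z) (free_ext ?_) t
  intro X i j f m hf _
  simp [free_d_fmk hf, N.lact_d _ hf]

variable {N}

lemma homSub_lact {M : Bimod C D} (φ : homSub M N 0) {X' X : C.Obj} {Y : D.Obj} (f : C.bk X' X)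
    (m : M.obj X Y) : φ.1 X' Y (M.lact f m) = N.lact f (φ.1 X Y m) := by
  refine LinearMap.congr_fun (f := φ.1 X' Y ∘ₗ M.lact.flip m) (g := N.lact.flip (φ.1 X Y m))
    (DGMod.ext_hom fun i f hf => ?_) f
  simp [φ.2.2.1 _ _ _ _ f hf]

lemma homSub_deg {M : Bimod C D} (φ : homSub M N 0) {X : C.Obj} {Y : D.Obj} {i : Γ}
    {m : M.obj X Y} (hm : m ∈ (M.obj X Y).deg i) : φ.1 X Y m ∈ (N.obj X Y).deg i := by
  simpa using φ.2.1 X Y i m hm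

/-- From `δ : ⨁_X |X⟩ ⊗ ⟨X|N → N`, the map `f ⊗ t ↦ f t - f ⊗ δ(t)`. -/
def step (δ : homSub N.free N 0) : homSub N.free.free N.free 0 :=
  ⟨fun Y Z => flift fun X => N.free.lact - (N.fmk X).compl₂ (δ.1 X Z), by
    refine ⟨fun Y Z n t ht => ?_, fun Y' Y Z i g _ t => ?_, fun Y Z Z' t g => ?_⟩
    · refine free_mem_le (S := ((N.free.obj Y Z).deg (n + 0)).comap
        (flift fun X => N.free.lact - (N.fmk X).compl₂ (δ.1 X Z))) ?_ ht
      rintro X i j f m hf hm rfl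
      rw [Submodule.mem_comap, flift_fmk, add_zero]
      exact Submodule.sub_mem _ (N.free.lact_deg hf hm) (fmk_mem_deg hf (homSub_deg δ hm) rfl)
    · refine LinearMap.congr_fun
        (f := (flift fun X => N.free.lact - (N.fmk X).compl₂ (δ.1 X Z)) ∘ₗ N.free.free.lact g)
        (g := G.sgn k 0 i • (N.free.lact g ∘ₗ
          flift fun X => N.free.lact - (N.fmk X).compl₂ (δ.1 X Z))) (free_ext ?_) t
      intro X i j f m _ _
      simp [N.free.lact_lact]
    · refine LinearMap.congr_fun
        (f := (flift fun X => N.free.lact - (N.fmk X).compl₂ (δ.1 X Z')) ∘ₗ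
          N.free.free.ract.flip g)
        (g := N.free.ract.flip g ∘ₗ
          flift fun X => N.free.lact - (N.fmk X).compl₂ (δ.1 X Z)) (free_ext ?_) t
      intro X i j f m _ _
      simp [N.free.lact_ract, δ.2.2.2]⟩

@[simp] lemma step_fmk (δ : homSub N.free N 0) {Y X : C.Obj} {Z : D.Obj} (f : C.bk Y X)
    (t : N.free.obj X Z) : (step δ).1 Y Z (N.free.fmk X f t) =
      N.free.lact f t - N.fmk X f (δ.1 X Z t) :=
  flift_fmk ..

lemma step_d (δ : homSub N.free N 0) (hδ : ∀ Y Z (t : N.free.obj Y Z),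
    δ.1 Y Z ((N.free.obj Y Z).d t) = (N.obj Y Z).d (δ.1 Y Z t)) {Y : C.Obj} {Z : D.Obj}
    (t : N.free.free.obj Y Z) : (step δ).1 Y Z ((N.free.free.obj Y Z).d t) =
      (N.free.obj Y Z).d ((step δ).1 Y Z t) := by
  refine LinearMap.congr_fun (f := (step δ).1 Y Z ∘ₗ (N.free.free.obj Y Z).d)
    (g := (N.free.obj Y Z).d ∘ₗ (step δ).1 Y Z) (free_ext ?_) t
  intro X i j f m hf _
  simp only [LinearMap.comp_apply, free_d_fmk hf, N.free.lact_d _ hf, step_fmk, map_add, map_sub,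
    map_smul, hδ, smul_sub]
  abel

lemma step_step (δ : homSub N.free N 0) (h : ∀ Y Z (t : N.free.free.obj Y Z),
    δ.1 Y Z ((step δ).1 Y Z t) = 0) {Y : C.Obj} {Z : D.Obj} (t : N.free.free.free.obj Y Z) :
    (step δ).1 Y Z ((step (step δ)).1 Y Z t) = 0 := by
  refine LinearMap.congr_fun (f := (step δ).1 Y Z ∘ₗ (step (step δ)).1 Y Z) (g := 0)
    (free_ext ?_) t
  intro X i j f m _ _
  simp only [LinearMap.comp_apply, step_fmk, map_sub, homSub_lact, h, map_zero, sub_zero,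
    LinearMap.zero_apply, sub_self]

lemma act_step {Y : C.Obj} {Z : D.Obj} (t : N.free.free.obj Y Z) :
    (act N).1 Y Z ((step (act N)).1 Y Z t) = 0 := by
  refine LinearMap.congr_fun (f := (act N).1 Y Z ∘ₗ (step (act N)).1 Y Z) (g := 0)
    (free_ext ?_) t
  intro X i j f m _ _
  simp only [LinearMap.comp_apply, step_fmk, map_sub, homSub_lact, act_fmk,
    LinearMap.zero_apply, sub_self]

end Free

section ShiftSum

/-- The bimodule `⨁_r q^{j_r} T_r`. -/
def shiftSum (T : ℕ → Bimod C D) (j : ℕ → Γ) : Bimod C D := directSum fun r => (T r).shift (j r)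

variable {T : ℕ → Bimod C D} {j : ℕ → Γ} {P : Type*} [AddCommGroup P] [Module k P]

/-- The inclusion of the `r`-th summand (of degree `j r`). -/
def bmk (r : ℕ) (Y : C.Obj) (Z : D.Obj) : (T r).obj Y Z →ₗ[k] (shiftSum T j).obj Y Z :=
  DGMod.dof (fun r => ((T r).obj Y Z).shift (j r)) r ∘ₗ DGMod.toShift (j r) ((T r).obj Y Z)

/-- The linear map out of `⨁_r q^{j_r} T_r` given by its restrictions to the summands. -/
def blift {Y : C.Obj} {Z : D.Obj} (φ : ∀ r, (T r).obj Y Z →ₗ[k] P) :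
    (shiftSum T j).obj Y Z →ₗ[k] P :=
  DGMod.dlift (M := fun r => ((T r).obj Y Z).shift (j r))
    fun r => φ r ∘ₗ DGMod.ofShift (j r) ((T r).obj Y Z)

@[simp] lemma blift_bmk {Y : C.Obj} {Z : D.Obj} (φ : ∀ r, (T r).obj Y Z →ₗ[k] P) (r : ℕ)
    (x : (T r).obj Y Z) : blift (j := j) φ (bmk r Y Z x) = φ r x :=
  DGMod.dlift_dof (M := fun r => ((T r).obj Y Z).shift (j r)) _ r _

lemma bmk_mem_deg {Y : C.Obj} {Z : D.Obj} {r : ℕ} {i : Γ} {x : (T r).obj Y Z}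
    (hx : x ∈ ((T r).obj Y Z).deg (i - j r)) :
    bmk r Y Z x ∈ ((shiftSum T j).obj Y Z).deg i :=
  DGMod.dof_mem_deg (M := fun r => ((T r).obj Y Z).shift (j r)) (i := r) (x := x) hx

lemma shiftSum_mem_le {Y : C.Obj} {Z : D.Obj} {i : Γ} {S : Submodule k ((shiftSum T j).obj Y Z)}
    (h : ∀ r (x : (T r).obj Y Z), x ∈ ((T r).obj Y Z).deg (i - j r) → bmk r Y Z x ∈ S) :
    ((shiftSum T j).obj Y Z).deg i ≤ S :=
  DGMod.directSum_mem_le (M := fun r => ((T r).obj Y Z).shift (j r)) h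

lemma shiftSum_ext {Y : C.Obj} {Z : D.Obj} {φ ψ : (shiftSum T j).obj Y Z →ₗ[k] P}
    (h : ∀ r x, φ (bmk r Y Z x) = ψ (bmk r Y Z x)) : φ = ψ :=
  DGMod.directSum_ext (M := fun r => ((T r).obj Y Z).shift (j r)) h

lemma shiftSum_d_bmk {Y : C.Obj} {Z : D.Obj} (r : ℕ) (x : (T r).obj Y Z) :
    ((shiftSum T j).obj Y Z).d (bmk r Y Z x) =
      G.sgn k (j r) G.ι • bmk r Y Z (((T r).obj Y Z).d x) := by
  refine (DGMod.directSum_d_dof (M := fun r => ((T r).obj Y Z).shift (j r)) r x).trans ?_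
  rw [← map_smul]
  rfl

lemma shiftSum_lact_bmk {Y' Y : C.Obj} {Z : D.Obj} {r : ℕ} {i : Γ} {f : C.bk Y' Y}
    (hf : f ∈ (C.bk Y' Y).deg i) (x : (T r).obj Y Z) :
    (shiftSum T j).lact f (bmk r Y Z x) = G.sgn k (j r) i • bmk r Y' Z ((T r).lact f x) := by
  refine (DGMod.dmapL_dof (M := fun r => ((T r).obj Y Z).shift (j r))
    (N := fun r => ((T r).obj Y' Z).shift (j r))
    (fun r => ((T r).shift (j r)).lact) f r x).trans ?_
  change bmk r Y' Z ((T r).lact ((C.bk Y' Y).sOp (j r) f) x) = _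
  rw [DGMod.sOp_apply _ hf, map_smul, LinearMap.smul_apply, map_smul]

lemma shiftSum_ract_bmk {Y : C.Obj} {Z Z' : D.Obj} {r : ℕ} (x : (T r).obj Y Z) (g : D.bk Z Z') :
    (shiftSum T j).ract (bmk r Y Z x) g = bmk r Y Z' ((T r).ract x g) :=
  DGMod.dmapR_dof (M := fun r => ((T r).obj Y Z).shift (j r))
    (N := fun r => ((T r).obj Y Z').shift (j r)) (fun r => ((T r).shift (j r)).ract) g r x

end ShiftSum

section Tot

lemma sgn_succ_ι (r : ℕ) (i : Γ) :
    G.sgn k (-((r + 1) • G.ι)) i = G.sgn k G.ι i * G.sgn k (-(r • G.ι)) i := by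
  rw [sgn_neg_left, sgn_neg_left, succ_nsmul, sgn_add_left, mul_comm]

/-- The bimodule `⨁_r q^{-rι} T_r`. -/
abbrev totSum (T : ℕ → Bimod C D) : Bimod C D := shiftSum T fun r => -(r • G.ι)

variable (T : ℕ → Bimod C D) (δ : ∀ r, homSub (T (r + 1)) (T r) 0)

/-- The components of the twist: `0` on the summand `r = 0`, and `δ r` from the summand `r + 1` to
the summand `r`. -/
def totComp (Y : C.Obj) (Z : D.Obj) : ∀ r : ℕ, (T r).obj Y Z →ₗ[k] (totSum T).obj Y Z
  | 0 => 0
  | r + 1 => bmk r Y Z ∘ₗ (δ r).1 Y Z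

/-- The maps `δ r`, assembled to a bimodule map of degree `ι`. -/
def totDiff : homSub (totSum T) (totSum T) G.ι :=
  ⟨fun Y Z => blift (totComp T δ Y Z), by
    refine ⟨fun Y Z n t ht => ?_, fun Y' Y Z i g hg t => ?_, fun Y Z Z' t g => ?_⟩
    · refine shiftSum_mem_le (S := (((totSum T).obj Y Z).deg (n + G.ι)).comap
        (blift (totComp T δ Y Z))) ?_ ht
      rintro (_ | r) x hx
      · rw [Submodule.mem_comap, blift_bmk]
        exact Submodule.zero_mem _
      · rw [Submodule.mem_comap, blift_bmk]
        refine bmk_mem_deg ?_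
        have := homSub_deg (δ r) hx
        rwa [show n + G.ι - -(r • G.ι) = n - -((r + 1) • G.ι) by rw [succ_nsmul]; abel]
    · refine LinearMap.congr_fun (f := blift (totComp T δ Y' Z) ∘ₗ (totSum T).lact g)
        (g := G.sgn k G.ι i • ((totSum T).lact g ∘ₗ blift (totComp T δ Y Z))) (shiftSum_ext ?_) t
      rintro (_ | r) x
      · simp [shiftSum_lact_bmk hg, totComp]
      · simp only [LinearMap.comp_apply, shiftSum_lact_bmk hg, map_smul, blift_bmk, totComp,
          LinearMap.smul_apply, homSub_lact, sgn_succ_ι, mul_smul]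
    · refine LinearMap.congr_fun (f := blift (totComp T δ Y Z') ∘ₗ (totSum T).ract.flip g)
        (g := (totSum T).ract.flip g ∘ₗ blift (totComp T δ Y Z)) (shiftSum_ext ?_) t
      rintro (_ | r) x
      · simp [shiftSum_ract_bmk, totComp]
      · simp only [LinearMap.comp_apply, LinearMap.flip_apply, shiftSum_ract_bmk, blift_bmk,
          totComp, (δ r).2.2.2]⟩

lemma totDiff_bmk_zero {Y : C.Obj} {Z : D.Obj} (x : (T 0).obj Y Z) :
    (totDiff T δ).1 Y Z (bmk 0 Y Z x) = 0 :=
  blift_bmk ..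

lemma totDiff_bmk_succ {Y : C.Obj} {Z : D.Obj} (r : ℕ) (x : (T (r + 1)).obj Y Z) :
    (totDiff T δ).1 Y Z (bmk (r + 1) Y Z x) = bmk r Y Z ((δ r).1 Y Z x) :=
  blift_bmk ..

lemma totDiff_mc
    (hd : ∀ (r : ℕ) Y Z (t : (T (r + 1)).obj Y Z),
    (δ r).1 Y Z (((T (r + 1)).obj Y Z).d t) = ((T r).obj Y Z).d ((δ r).1 Y Z t))
    (hδ : ∀ (r : ℕ) Y Z (t : (T (r + 2)).obj Y Z), (δ r).1 Y Z ((δ (r + 1)).1 Y Z t) = 0)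
    (Y : C.Obj) (Z : D.Obj) (t : (totSum T).obj Y Z) :
    ((totSum T).obj Y Z).d ((totDiff T δ).1 Y Z t) +
      (totDiff T δ).1 Y Z (((totSum T).obj Y Z).d t) +
      (totDiff T δ).1 Y Z ((totDiff T δ).1 Y Z t) = 0 := by
  refine LinearMap.congr_fun (f := ((totSum T).obj Y Z).d ∘ₗ (totDiff T δ).1 Y Z +
    (totDiff T δ).1 Y Z ∘ₗ ((totSum T).obj Y Z).d + (totDiff T δ).1 Y Z ∘ₗ (totDiff T δ).1 Y Z)
    (g := 0) (shiftSum_ext ?_) t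
  have key : ∀ r (x : (T (r + 1)).obj Y Z),
      ((totSum T).obj Y Z).d ((totDiff T δ).1 Y Z (bmk (r + 1) Y Z x)) +
        (totDiff T δ).1 Y Z (((totSum T).obj Y Z).d (bmk (r + 1) Y Z x)) = 0 := by
    intro r x
    rw [shiftSum_d_bmk, map_smul, totDiff_bmk_succ, totDiff_bmk_succ, shiftSum_d_bmk, hd,
      sgn_succ_ι, sgn_ι_ι]
    module
  rintro (_ | _ | r) x
  · simp only [LinearMap.add_apply, LinearMap.comp_apply, totDiff_bmk_zero, map_zero,
      shiftSum_d_bmk, map_smul, smul_zero, add_zero, LinearMap.zero_apply]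
  · simp only [LinearMap.add_apply, LinearMap.comp_apply, key, LinearMap.zero_apply, zero_add]
    rw [totDiff_bmk_succ, totDiff_bmk_zero]
  · simp only [LinearMap.add_apply, LinearMap.comp_apply, key, LinearMap.zero_apply, zero_add]
    rw [totDiff_bmk_succ, totDiff_bmk_succ, hδ, map_zero]

/-- The total bimodule `tw_δ(⨁_r q^{-rι} T_r)` of a complex of bimodules
`⋯ → T_2 → T_1 → T_0`. -/
def tot
    (hd : ∀ (r : ℕ) Y Z (t : (T (r + 1)).obj Y Z),
    (δ r).1 Y Z (((T (r + 1)).obj Y Z).d t) = ((T r).obj Y Z).d ((δ r).1 Y Z t))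
    (hδ : ∀ (r : ℕ) Y Z (t : (T (r + 2)).obj Y Z), (δ r).1 Y Z ((δ (r + 1)).1 Y Z t) = 0) :
    Bimod C D := (totSum T).twist (totDiff T δ) (totDiff_mc T δ hd hδ)

end Tot

section Bar

variable (C)

/-- `barTerm C n` is the bimodule with components
`⨁_{X_1,…,X_n} ⟨Y|X_1⟩ ⊗ ⟨X_1|X_2⟩ ⊗ ⋯ ⊗ ⟨X_n|Z⟩`. -/
def barTerm : ℕ → Bimod C C
  | 0 => one C
  | n + 1 => (barTerm n).free

/-- The map `barTerm C (n + 1) → barTerm C n` given by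
`f_0 ⊗ ⋯ ⊗ f_{n+1} ↦ ∑_i (-1)^i f_0 ⊗ ⋯ ⊗ f_i f_{i+1} ⊗ ⋯ ⊗ f_{n+1}`; recursively,
`f_0 ⊗ t ↦ f_0 t - f_0 ⊗ δ(t)`. -/
def delta : ∀ n : ℕ, homSub (barTerm C (n + 1)) (barTerm C n) 0
  | 0 => act (one C)
  | n + 1 => step (delta n)

lemma delta_d : ∀ (n : ℕ) (Y Z : C.Obj) (t : (barTerm C (n + 1)).obj Y Z),
    (delta C n).1 Y Z (((barTerm C (n + 1)).obj Y Z).d t) =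
      ((barTerm C n).obj Y Z).d ((delta C n).1 Y Z t)
  | 0, _, _, t => act_d (one C) t
  | n + 1, _, _, t => step_d (delta C n) (delta_d n) t

lemma delta_delta : ∀ (n : ℕ) (Y Z : C.Obj) (t : (barTerm C (n + 2)).obj Y Z),
    (delta C n).1 Y Z ((delta C (n + 1)).1 Y Z t) = 0
  | 0, _, _, t => act_step t
  | n + 1, _, _, t => step_step (delta C n) (delta_delta n) t

/-- The two-sided bar complex
`tw_δ(⨁_{r ≥ 0} q^{-rι} ⨁_{X_0,…,X_r} |X_0⟩ ⊗ ⟨X_0|X_1⟩ ⊗ ⋯ ⊗ ⟨X_{r-1}|X_r⟩ ⊗ ⟨X_r|)`, with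
`δ [f_0,…,f_{r+1}] = ∑_{0 ≤ i ≤ r} (-1)^i [f_0,…,f_i f_{i+1},…,f_{r+1}]` for `r ≥ 1`, and `δ = 0`
for `r = 0`. -/
def bar : Bimod C C :=
  tot (fun r => barTerm C (r + 1)) (fun r => delta C (r + 1)) (fun r => delta_d C (r + 1))
    (fun r => delta_delta C (r + 1))

end Bar

/-! ### Acyclic, projective and exact bimodules -/

/-- `B` is acyclic if every `⟨X|B|Y⟩` is contractible. -/
def IsAcyclic (B : Bimod C D) : Prop :=
  ∀ X Y, (B.obj X Y).HEquiv (DGMod.zero : DGMod.{u, u, w} k G)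

/-- `B` is projective if `Hom_Bim(B, Z)` is contractible for all acyclic `Z`. -/
def IsProjective (B : Bimod C D) : Prop :=
  ∀ Z : Bimod C D, Z.IsAcyclic → (Hom B Z).HEquiv (DGMod.zero : DGMod.{u, u, w} k G)

/-- `B` is left exact if the left module `B|Y⟩` is projective for all `Y`. -/
def IsLeftExact (B : Bimod C D) : Prop := ∀ Y, (B.ket Y).IsProjective

/-- `B` is right exact if the right module `⟨X|B` is projective for all `X`. -/
def IsRightExact (B : Bimod C D) : Prop := ∀ X, (B.bra X).IsProjective

/-- `B` is exact if it is left and right exact. -/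
def IsExact (B : Bimod C D) : Prop := B.IsLeftExact ∧ B.IsRightExact

end Bimod

end DG

end

/-! Everything is reduced to contractions: maps `h` of degree `-ι` with `d h + h d = 1`, together
with a record of which actions `h` respects. This is `Contractible a b M`, where `a` asks for left
linearity and `b` for right linearity. Acyclic means `Contractible False False` (`isAcyclic_iff`),
and homotopy equivalent to zero means `Contractible True True` (`hEquiv_zero_iff`).

Write Bar for the bar complex and Aug for its augmentation `⋯ → C ⊗ C ⊗ C → C ⊗ C → C` (tensor
products over `k`, summed over objects), which is the cone of `ε : Bar → C`. Two facts about them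
carry the proof.

First, Aug has the right linear contraction `x ↦ 1 ⊗ x` (`contractible_aug_right`) and the left
linear contraction `x ↦ ± x ⊗ 1` (`contractible_aug_left`). So Aug `⊗ M` is always contractible as a
right module and `M ⊗` Aug as a left module. As Aug `⊗ M` is the cone of Bar `⊗ M → M`, a bilinear
contraction of it gives Bar `⊗ M ≃ M`.

Second, every summand of Bar has the form `C ⊗_k N`. A merely linear contraction of `K` therefore
yields a left linear one of Bar `⊗ K` (`Contractible.bar_tensor`) and a right linear one of `K ⊗`
Bar (`Contractible.tensor_bar`), with linearity on the other side preserved. The summands are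
contracted one at a time, and the error made by ignoring the bar differential is locally nilpotent
(`contractible_of_layers`). Both facts together give bilinear contractions of Aug `⊗` Bar `⊗ M` and
`M ⊗` Bar `⊗` Aug.

Acyclicity: the second fact makes Bar `⊗ B ⊗` Bar contractible when `B` is acyclic. For the
converse, the cones of Bar `⊗ B ⊗` Bar `→` Bar `⊗ B → B` are linearly contractible by the first
fact.

Projectivity: if `B` is projective, the inclusion of `B` into the acyclic Aug `⊗ B` is
nullhomotopic, so `B` is a homotopy retract of Bar `⊗ B`. Hence Aug `⊗ B` is a retract of Aug `⊗`
Bar `⊗ B` and is contractible; the other side is the same. Conversely, if Aug `⊗ B` and `B ⊗` Aug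
are contractible, then `Hom(B, Z)` is a homotopy retract of `Hom(B,` Bar `⊗ Z ⊗` Bar`)`, whose
target is contractible for acyclic `Z`.

Exactness: the one-sided version of this argument shows that left exactness means a left linear
contraction of Aug `⊗ B`, and right exactness a right linear one of `B ⊗` Aug. For exact `B`, both
Bar `⊗ B` and `B ⊗` Bar are then equivalent to Bar `⊗ B ⊗` Bar. Conversely, an equivalence between
them makes Aug `⊗ B ⊗` Bar and Bar `⊗ B ⊗` Aug contractible, and the outer Bar is removed by the
cone argument. -/

noncomputable section

namespace DG

variable {k : Type u} [CommRing k] {Γ : Type w} [AddCommGroup Γ] {G : GradingData Γ}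

namespace Bimod

variable {A C D E : DGCat.{u, w} k G}

/-! ### Families of linear maps between bimodules -/

/-- Families of linear maps between the components of two bimodules. -/
abbrev Fam (M N : Bimod C D) := ∀ X Y, M.obj X Y →ₗ[k] N.obj X Y

variable {M N P K : Bimod C D}

/-- `φ` is right linear. -/
def IsRightLinear (φ : Fam M N) : Prop :=
  ∀ X Y Y' (m : M.obj X Y) (g : D.bk Y Y'), φ X Y' (M.ract m g) = N.ract (φ X Y m) g

/-- `φ` is left linear, as a map of degree `l`. -/
def IsLeftLinear (φ : Fam M N) (l : Γ) : Prop :=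
  ∀ X' X Y i, ∀ f ∈ (C.bk X' X).deg i, ∀ m : M.obj X Y,
    φ X' Y (M.lact f m) = G.sgn k l i • N.lact f (φ X Y m)

/-- `φ` has degree `l`, is left linear if `a` holds, and right linear if `b` holds. -/
structure IsMap (a b : Prop) (φ : Fam M N) (l : Γ) : Prop where
  deg : ∀ X Y i, ∀ m ∈ (M.obj X Y).deg i, φ X Y m ∈ (N.obj X Y).deg (i + l)
  left : a → IsLeftLinear φ l
  right : b → IsRightLinear φ

lemma isMap_iff {φ : Fam M N} {l : Γ} : IsMap True True φ l ↔ φ ∈ homSub M N l :=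
  ⟨fun h => ⟨h.deg, h.left trivial, h.right trivial⟩,
    fun h => ⟨h.1, fun _ => h.2.1, fun _ => h.2.2⟩⟩

/-- `φ` commutes with the differentials. -/
def IsChain (φ : Fam M N) : Prop :=
  ∀ X Y (m : M.obj X Y), (N.obj X Y).d (φ X Y m) = φ X Y ((M.obj X Y).d m)

namespace IsMap

variable {a b a' b' : Prop} {l l' n : Γ} {φ φ' : Fam M N} {ψ : Fam N P}

lemma mono (h : IsMap a b φ l) (ha : a' → a) (hb : b' → b) : IsMap a' b' φ l :=
  ⟨h.deg, fun x => h.left (ha x), fun x => h.right (hb x)⟩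

lemma of_full (h : IsMap True True φ l) : IsMap a b φ l :=
  h.mono (fun _ => trivial) fun _ => trivial

lemma deg_zero (h : IsMap a b φ 0) {X : C.Obj} {Y : D.Obj} {i : Γ} {m : M.obj X Y}
    (hm : m ∈ (M.obj X Y).deg i) : φ X Y m ∈ (N.obj X Y).deg i := by
  simpa using h.deg X Y i m hm

lemma comp (hψ : IsMap a b ψ l') (hφ : IsMap a b φ l) (h : l + l' = n) :
    IsMap a b (fun X Y => ψ X Y ∘ₗ φ X Y) n := by
  subst h
  refine ⟨fun X Y i m hm => ?_, fun ha X' X Y i f hf m => ?_, fun hb X Y Y' m g => ?_⟩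
  · rw [← add_assoc]
    exact hψ.deg _ _ _ _ (hφ.deg _ _ _ _ hm)
  · simp only [LinearMap.comp_apply]
    rw [hφ.left ha _ _ _ _ f hf, map_smul, hψ.left ha _ _ _ _ f hf, smul_smul, sgn_add_left]
  · simp only [LinearMap.comp_apply]
    rw [hφ.right hb, hψ.right hb]

lemma add (h : IsMap a b φ l) (h' : IsMap a b φ' l) :
    IsMap a b (fun X Y => φ X Y + φ' X Y) l := by
  refine ⟨fun X Y i m hm => Submodule.add_mem _ (h.deg _ _ _ _ hm) (h'.deg _ _ _ _ hm),
    fun ha X' X Y i f hf m => ?_, fun hb X Y Y' m g => ?_⟩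
  · simp [h.left ha _ _ _ _ f hf, h'.left ha _ _ _ _ f hf]
  · simp [h.right hb X Y Y' m g, h'.right hb X Y Y' m g]

lemma smul (c : k) (h : IsMap a b φ l) : IsMap a b (fun X Y => c • φ X Y) l := by
  refine ⟨fun X Y i m hm => Submodule.smul_mem _ _ (h.deg _ _ _ _ hm),
    fun ha X' X Y i f hf m => ?_, fun hb X Y Y' m g => ?_⟩
  · simp [h.left ha _ _ _ _ f hf, smul_comm c]
  · simp [h.right hb X Y Y' m g]

lemma neg (h : IsMap a b φ l) : IsMap a b (fun X Y => -φ X Y) l := by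
  simpa using h.smul (-1)

lemma id : IsMap a b (fun X Y => (LinearMap.id : M.obj X Y →ₗ[k] M.obj X Y)) 0 :=
  ⟨fun X Y i m hm => by simpa using hm, fun _ X' X Y i f hf m => by simp, fun _ X Y Y' m g => rfl⟩

end IsMap

/-! ### Contractions -/

/-- `h` is a contraction of `M`, left linear if `a` holds, and right linear if `b` holds. -/
structure IsContraction (a b : Prop) (h : Fam M M) : Prop extends IsMap a b h (-G.ι) where
  eq : ∀ X Y (m : M.obj X Y), (M.obj X Y).d (h X Y m) + h X Y ((M.obj X Y).d m) = m

/-- `M` has a contraction, left linear if `a` holds, and right linear if `b` holds. -/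
def Contractible (a b : Prop) (M : Bimod C D) : Prop := ∃ h : Fam M M, IsContraction a b h

lemma IsContraction.mono {a b a' b' : Prop} {h : Fam M M} (H : IsContraction a b h)
    (ha : a' → a) (hb : b' → b) : IsContraction a' b' h :=
  ⟨H.toIsMap.mono ha hb, H.eq⟩

lemma Contractible.mono {a b a' b' : Prop} (H : Contractible a b M)
    (ha : a' → a) (hb : b' → b) : Contractible a' b' M :=
  H.imp fun _ h => h.mono ha hb

/-- A homotopy retract of a contractible bimodule is contractible. -/
lemma Contractible.of_retract {a b : Prop} (H : Contractible a b N) {f : Fam M N} {g : Fam N M}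
    {s : Fam M M} (hf : IsMap a b f 0) (hg : IsMap a b g 0) (hs : IsMap a b s (-G.ι))
    (cf : IsChain f) (cg : IsChain g)
    (e : ∀ X Y m, g X Y (f X Y m) - m = (M.obj X Y).d (s X Y m) + s X Y ((M.obj X Y).d m)) :
    Contractible a b M := by
  obtain ⟨h, hh⟩ := H
  -- The map `g h f` is a nullhomotopy of `g f`, and `s` is a homotopy from `1` to `g f`; their
  -- difference contracts `1`.
  refine ⟨fun X Y => g X Y ∘ₗ h X Y ∘ₗ f X Y + -s X Y,
    (hg.comp (hh.toIsMap.comp hf (zero_add _)) (add_zero _)).add hs.neg, fun X Y m => ?_⟩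
  have h1 := hh.eq X Y (f X Y m)
  have h2 := e X Y m
  have h3 := congrArg (g X Y) h1
  simp only [LinearMap.add_apply, LinearMap.comp_apply, LinearMap.neg_apply, map_add, map_neg,
    cg X Y, ← cf X Y] at h3 ⊢
  rw [sub_eq_iff_eq_add] at h2
  rw [h2] at h3
  rw [eq_comm, ← sub_eq_zero] at h3 ⊢
  rw [← h3]
  abel

/-- Contractions and locally nilpotent perturbations: if `d h + h d` differs from the identity by a
locally nilpotent map, then `M` is contractible. -/
lemma Contractible.of_nilpotent {a b : Prop} {h : Fam M M} (hh : IsMap a b h (-G.ι))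
    (ν : Fam M M)
    (e : ∀ X Y m, (M.obj X Y).d (h X Y m) + h X Y ((M.obj X Y).d m) = m - ν X Y m)
    (nil : ∀ X Y m, ∃ n, (ν X Y ^ n) m = 0) : Contractible a b M := by
  -- The map `u = 1 - ν` commutes with `d` and inherits the linearity of `h`. Once it is invertible,
  -- `h u⁻¹` is the contraction.
  let u : Fam M M := fun X Y => (M.obj X Y).d ∘ₗ h X Y + h X Y ∘ₗ (M.obj X Y).d
  have hu (X Y m) : u X Y m = m - ν X Y m := e X Y m
  have hud : IsChain u := fun X Y m => by simp [u, (M.obj X Y).d_d]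
  have hudeg : ∀ X Y i, ∀ m ∈ (M.obj X Y).deg i, u X Y m ∈ (M.obj X Y).deg i := by
    intro X Y i m hm
    refine Submodule.add_mem _ ?_ ?_
    · simpa using (M.obj X Y).d_deg (hh.deg _ _ _ _ hm)
    · simpa using hh.deg _ _ _ _ ((M.obj X Y).d_deg hm)
  -- The terms containing `d f` arise once from `d h` and once from `h d`, with opposite signs.
  have hul : a → IsLeftLinear u 0 := by
    intro ha X' X Y i f hf m
    have hs : G.sgn k (-G.ι) i * G.sgn k G.ι i = 1 := by rw [sgn_neg_left, sgn_mul_self]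
    have hs' : G.sgn k G.ι i * G.sgn k (-G.ι) i = 1 := by rw [sgn_neg_left, sgn_mul_self]
    have hdf := (C.bk X' X).d_deg hf
    simp only [u, LinearMap.add_apply, LinearMap.comp_apply, hh.left ha _ _ _ _ f hf, map_smul,
      M.lact_d _ hf, map_add, smul_add, smul_smul, hs, hs', hh.left ha _ _ _ _ _ hdf,
      sgn_add_right, sgn_zero_left, one_smul]
    rw [sgn_neg_left, sgn_neg_left, sgn_ι_ι]
    module
  have hur : b → IsRightLinear u := by
    intro hb X Y Y' m g
    refine LinearMap.congr_fun (f := u X Y' ∘ₗ M.ract.flip g)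
        (g := M.ract.flip g ∘ₗ u X Y) (DGMod.ext_hom fun i m hm => ?_) m
    have hhm := hh.deg _ _ _ _ hm
    simp only [u, LinearMap.add_apply, LinearMap.comp_apply, LinearMap.flip_apply,
      hh.right hb X Y Y', M.ract_d g hm, M.ract_d g hhm, map_add, map_smul, sgn_add_right,
      (show G.sgn k G.ι (-G.ι) = -1 by rw [sgn_symm, sgn_neg_left, sgn_ι_ι])]
    module
  -- A vector killed by `u` is fixed by `ν`, hence by every power of `ν`, and some power kills it.
  have hinj (X Y) : Function.Injective (u X Y) := by
    rw [← LinearMap.ker_eq_bot, LinearMap.ker_eq_bot']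
    intro m hm
    rw [hu, sub_eq_zero] at hm
    obtain ⟨n, hn⟩ := nil X Y m
    have : ∀ n, (ν X Y ^ n) m = m := by
      intro n
      induction n with
      | zero => rfl
      | succ n ih => rw [pow_succ, Module.End.mul_apply, ← hm, ih]
    rw [← this n, hn]
  have hνdeg : ∀ X Y i, ∀ m ∈ (M.obj X Y).deg i, ν X Y m ∈ (M.obj X Y).deg i := by
    intro X Y i m hm
    have : ν X Y m = m - u X Y m := by rw [hu]; abel
    rw [this]
    exact Submodule.sub_mem _ hm (hudeg _ _ _ _ hm)
  -- The preimage is the finite geometric series `m + ν m + ν² m + ⋯`. Its degree is recorded so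
  -- that the inverse of `u` is seen to have degree zero.
  have key : ∀ X Y n (m : M.obj X Y), (ν X Y ^ n) m = 0 → ∃ y, u X Y y = m ∧
      ∀ i, m ∈ (M.obj X Y).deg i → y ∈ (M.obj X Y).deg i := by
    intro X Y n
    induction n with
    | zero => exact fun m hm => ⟨0, by simpa using hm.symm, fun i _ => Submodule.zero_mem _⟩
    | succ n ih =>
      intro m hm
      rw [pow_succ, Module.End.mul_apply] at hm
      obtain ⟨y, hy, hy'⟩ := ih _ hm
      refine ⟨m + y, ?_, fun i hi => Submodule.add_mem _ hi (hy' i (hνdeg _ _ _ _ hi))⟩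
      rw [map_add, hy, hu, sub_add_cancel]
  have hsurj (X Y) : Function.Surjective (u X Y) := fun m => by
    obtain ⟨n, hn⟩ := nil X Y m
    obtain ⟨y, hy, -⟩ := key X Y n m hn
    exact ⟨y, hy⟩
  let U (X Y) : M.obj X Y ≃ₗ[k] M.obj X Y := LinearEquiv.ofBijective (u X Y) ⟨hinj X Y, hsurj X Y⟩
  have hU (X Y m) : u X Y ((U X Y).symm m) = m := (U X Y).apply_symm_apply m
  have hV : IsMap a b (fun X Y => ((U X Y).symm : M.obj X Y →ₗ[k] M.obj X Y)) 0 := by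
    refine ⟨fun X Y i m hm => ?_, fun ha X' X Y i f hf m => ?_, fun hb X Y Y' m g => ?_⟩
    · obtain ⟨n, hn⟩ := nil X Y m
      obtain ⟨y, hy, hy'⟩ := key X Y n m hn
      have : (U X Y).symm m = y := hinj X Y (by rw [hU, hy])
      simpa [this] using hy' i hm
    · refine hinj X' Y ?_
      simp only [LinearEquiv.coe_coe, hU, hul ha _ _ _ _ f hf, sgn_zero_left, one_smul]
    · refine hinj X Y' ?_
      simp only [LinearEquiv.coe_coe, hU, hur hb X Y Y']
  refine ⟨fun X Y => h X Y ∘ₗ ((U X Y).symm : M.obj X Y →ₗ[k] M.obj X Y),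
    hh.comp hV (zero_add _), fun X Y m => ?_⟩
  have : (U X Y).symm ((M.obj X Y).d m) = (M.obj X Y).d ((U X Y).symm m) :=
    hinj X Y (by rw [hU, ← hud, hU])
  simp only [LinearMap.comp_apply, LinearEquiv.coe_coe, this]
  exact hU X Y m

/-! ### Homotopy equivalences -/

/-- `f` and `g` are mutually inverse homotopy equivalences. -/
lemma HEquiv.mk {f : Fam M N} {g : Fam N M} {h : Fam M M} {h' : Fam N N}
    (hf : IsMap True True f 0) (hg : IsMap True True g 0) (hh : IsMap True True h (-G.ι))
    (hh' : IsMap True True h' (-G.ι)) (cf : IsChain f) (cg : IsChain g)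
    (e : ∀ X Y m, g X Y (f X Y m) - m = (M.obj X Y).d (h X Y m) + h X Y ((M.obj X Y).d m))
    (e' : ∀ X Y m, f X Y (g X Y m) - m = (N.obj X Y).d (h' X Y m) + h' X Y ((N.obj X Y).d m)) :
    M.HEquiv N := by
  have hs : G.sgn k G.ι (-G.ι) = -1 := by rw [sgn_symm, sgn_neg_left, sgn_ι_ι]
  refine ⟨⟨f, isMap_iff.1 hf⟩, ⟨g, isMap_iff.1 hg⟩, ⟨h, isMap_iff.1 hh⟩, ⟨h', isMap_iff.1 hh'⟩,
    ?_, ?_, fun X Y => ?_, fun X Y => ?_⟩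
  · ext X Y m
    simpa [dHom_apply, sub_eq_zero] using cf X Y m
  · ext X Y m
    simpa [dHom_apply, sub_eq_zero] using cg X Y m
  · ext m
    simpa [dHom_apply, hs] using e X Y m
  · ext m
    simpa [dHom_apply, hs] using e' X Y m

lemma HEquiv.exists (H : M.HEquiv N) : ∃ (f : Fam M N) (g : Fam N M) (h : Fam M M) (h' : Fam N N),
    IsMap True True f 0 ∧ IsMap True True g 0 ∧ IsMap True True h (-G.ι) ∧
    IsMap True True h' (-G.ι) ∧ IsChain f ∧ IsChain g ∧
    (∀ X Y m, g X Y (f X Y m) - m = (M.obj X Y).d (h X Y m) + h X Y ((M.obj X Y).d m)) ∧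
    (∀ X Y m, f X Y (g X Y m) - m = (N.obj X Y).d (h' X Y m) + h' X Y ((N.obj X Y).d m)) := by
  have hs : G.sgn k G.ι (-G.ι) = -1 := by rw [sgn_symm, sgn_neg_left, sgn_ι_ι]
  obtain ⟨f, g, h, h', cf, cg, e, e'⟩ := H
  refine ⟨f.1, g.1, h.1, h'.1, isMap_iff.2 f.2, isMap_iff.2 g.2, isMap_iff.2 h.2, isMap_iff.2 h'.2,
    fun X Y m => ?_, fun X Y m => ?_, fun X Y m => ?_, fun X Y m => ?_⟩
  · have := dHom_apply f X Y m
    rw [cf] at this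
    simpa [sub_eq_zero] using this.symm
  · have := dHom_apply g X Y m
    rw [cg] at this
    simpa [sub_eq_zero] using this.symm
  · have := LinearMap.congr_fun (e X Y) m
    simpa [dHom_apply, hs] using this
  · have := LinearMap.congr_fun (e' X Y) m
    simpa [dHom_apply, hs] using this

lemma HEquiv.symm (H : M.HEquiv N) : N.HEquiv M := by
  obtain ⟨f, g, h, h', cf, cg, e, e'⟩ := H
  exact ⟨g, f, h', h, cg, cf, e', e⟩

lemma HEquiv.trans (H : M.HEquiv N) (H' : N.HEquiv P) : M.HEquiv P := by
  obtain ⟨f, g, s, t, hf, hg, hs, ht, cf, cg, e, e'⟩ := H.exists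
  obtain ⟨f', g', s', t', hf', hg', hs', ht', cf', cg', j, j'⟩ := H'.exists
  -- The homotopies come from `g g' f' f - 1 = g (g' f' - 1) f + (g f - 1)` and its mirror image.
  refine HEquiv.mk (hf'.comp hf (add_zero _)) (hg.comp hg' (add_zero _))
    (hs.add (hg.comp (hs'.comp hf (zero_add _)) (add_zero _)))
    (ht'.add (hf'.comp (ht.comp hg' (zero_add _)) (add_zero _)))
    (fun X Y m => by simp [cf X Y, cf' X Y]) (fun X Y m => by simp [cg X Y, cg' X Y])
    (fun X Y m => ?_) (fun X Y m => ?_)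
  · have h1 := congrArg (g X Y) (j X Y (f X Y m))
    have h2 := e X Y m
    simp only [LinearMap.add_apply, LinearMap.comp_apply, map_add, map_sub, cg X Y, ← cf X Y]
      at h1 ⊢
    rw [sub_eq_iff_eq_add] at h1 h2
    rw [h1, h2]
    abel
  · have h1 := congrArg (f' X Y) (e' X Y (g' X Y m))
    have h2 := j' X Y m
    simp only [LinearMap.add_apply, LinearMap.comp_apply, map_add, map_sub, cf' X Y, ← cg' X Y]
      at h1 ⊢
    rw [sub_eq_iff_eq_add] at h1 h2
    rw [h1, h2]
    abel

/-- A bimodule is homotopy equivalent to zero if and only if it is contractible. -/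
lemma hEquiv_zero_iff : M.HEquiv zero ↔ Contractible True True M := by
  constructor
  · intro H
    obtain ⟨f, g, h, -, hf, hg, hh, -, cf, cg, e, -⟩ := H.exists
    -- Since `g f = 0`, the homotopy satisfies `d h + h d = -1`, whence the sign.
    refine ⟨_, hh.neg, fun X Y m => ?_⟩
    have h0 : f X Y m = 0 := Subsingleton.elim (α := PUnit) _ _
    have := e X Y m
    rw [h0, map_zero, zero_sub] at this
    simp only [LinearMap.neg_apply, map_neg, ← neg_add, ← this, neg_neg]
  · rintro ⟨h, hh⟩
    refine HEquiv.mk (f := fun X Y => 0) (g := fun X Y => 0) (h' := fun X Y => 0)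
      (isMap_iff.2 (Submodule.zero_mem _)) (isMap_iff.2 (Submodule.zero_mem _))
      hh.toIsMap.neg (isMap_iff.2 (Submodule.zero_mem _)) (fun X Y m => by simp)
      (fun X Y m => by simp) (fun X Y m => ?_) (fun X Y m => Subsingleton.elim (α := PUnit) _ _)
    simp [← neg_add, hh.eq]

/-- Contractibility is invariant under homotopy equivalence. -/
lemma Contractible.of_hEquiv {a b : Prop} (H : Contractible a b N) (e : M.HEquiv N) :
    Contractible a b M := by
  obtain ⟨f, g, h, -, hf, hg, hh, -, cf, cg, e, -⟩ := e.exists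
  exact H.of_retract hf.of_full hg.of_full hh.of_full cf cg e

/-- An isomorphism of bimodules is a homotopy equivalence. -/
lemma HEquiv.of_iso {f : Fam M N} {g : Fam N M} (hf : IsMap True True f 0)
    (hg : IsMap True True g 0) (cf : IsChain f) (cg : IsChain g) (e : ∀ X Y m, g X Y (f X Y m) = m)
    (e' : ∀ X Y m, f X Y (g X Y m) = m) : M.HEquiv N :=
  HEquiv.mk (h := fun _ _ => 0) (h' := fun _ _ => 0) hf hg
    (isMap_iff.2 (Submodule.zero_mem _)) (isMap_iff.2 (Submodule.zero_mem _)) cf cg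
    (fun X Y m => by simp [e]) (fun X Y m => by simp [e'])

/-- A bimodule is acyclic if and only if it has a contraction by linear maps. -/
lemma isAcyclic_iff : M.IsAcyclic ↔ Contractible False False M := by
  constructor
  · intro H
    choose f g h h' hf hg hh hh' cf cg e e' using H
    -- The homotopies for different pairs `X`, `Y` are chosen independently; this is enough because
    -- no linearity is demanded.
    refine ⟨fun X Y => -h X Y, ⟨fun X Y i m hm => ?_, False.elim, False.elim⟩, fun X Y m => ?_⟩
    · rw [← sub_eq_add_neg]
      exact Submodule.neg_mem _ (hh X Y i m hm)
    · have h0 : f X Y m = 0 := Subsingleton.elim (α := PUnit) _ _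
      have := e X Y m
      rw [h0, map_zero, zero_sub] at this
      simp only [LinearMap.neg_apply, map_neg, ← neg_add, ← this, neg_neg]
  · rintro ⟨h, hh⟩ X Y
    refine ⟨0, 0, -h X Y, 0, by simp, by simp, fun i x hx => ?_, by simp, by simp, by simp,
      fun x => ?_, fun x => Subsingleton.elim (α := PUnit) _ _⟩
    · rw [sub_eq_add_neg]
      exact Submodule.neg_mem _ (hh.deg X Y i x hx)
    · simp [← neg_add, hh.eq]

end Bimod

end DG

end
noncomputable section

namespace DG

variable {k : Type u} [CommRing k] {Γ : Type w} [AddCommGroup Γ] {G : GradingData Γ}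

namespace Bimod

variable {A C D E : DGCat.{u, w} k G}

/-! ### The tensor product of bimodules -/

section Tens

variable (M M' : Bimod A C) (N N' : Bimod C D) {X : A.Obj} {Z : D.Obj}

/-- The element `m ⊗ n` of `⟨X|M ⊗_C N|Z⟩`. -/
def tens (Y : C.Obj) : M.obj X Y →ₗ[k] N.obj Y Z →ₗ[k] (M.tensor N).obj X Z := tmk M N Y

variable {M M' N N'}

lemma tens_ract {Y Y' : C.Obj} (m : M.obj X Y) (f : C.bk Y Y') (n : N.obj Y' Z) :
    tens M N Y' (M.ract m f) n = tens M N Y m (N.lact f n) :=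
  tmk_ract m f n

lemma tens_mem_deg {Y : C.Obj} {i j n : Γ} {a : M.obj X Y} {b : N.obj Y Z}
    (ha : a ∈ (M.obj X Y).deg i) (hb : b ∈ (N.obj Y Z).deg j) (h : i + j = n) :
    tens M N Y a b ∈ ((M.tensor N).obj X Z).deg n :=
  tmk_mem_deg ha hb h

lemma tensor_d_tens {Y : C.Obj} {i : Γ} {a : M.obj X Y} (ha : a ∈ (M.obj X Y).deg i)
    (b : N.obj Y Z) : ((M.tensor N).obj X Z).d (tens M N Y a b) =
      tens M N Y ((M.obj X Y).d a) b + G.sgn k G.ι i • tens M N Y a ((N.obj Y Z).d b) :=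
  tensorObj_d_tmk ha b

@[simp] lemma tensor_lact_tens {X' X : A.Obj} {Y : C.Obj} {Z : D.Obj} (f : A.bk X' X)
    (m : M.obj X Y) (n : N.obj Y Z) :
    (M.tensor N).lact f (tens M N Y m n) = tens M N Y (M.lact f m) n :=
  tensorLact_tmk f m n

@[simp] lemma tensor_ract_tens {X : A.Obj} {Y : C.Obj} {Z Z' : D.Obj} (m : M.obj X Y)
    (n : N.obj Y Z) (g : D.bk Z Z') :
    (M.tensor N).ract (tens M N Y m n) g = tens M N Y m (N.ract n g) :=
  tensorRact_tmk m n g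

lemma tensor_mem_le {n : Γ} {S : Submodule k ((M.tensor N).obj X Z)} (h : ∀ Y i j
    (a : M.obj X Y) (b : N.obj Y Z), a ∈ (M.obj X Y).deg i → b ∈ (N.obj Y Z).deg j → i + j = n →
    tens M N Y a b ∈ S) : ((M.tensor N).obj X Z).deg n ≤ S :=
  tensorObj_mem_le h

lemma tensor_ext {Q : Type*} [AddCommGroup Q] [Module k Q]
    {φ ψ : (M.tensor N).obj X Z →ₗ[k] Q} (h : ∀ Y i j (a : M.obj X Y) (b : N.obj Y Z),
      a ∈ (M.obj X Y).deg i → b ∈ (N.obj Y Z).deg j →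
      φ (tens M N Y a b) = ψ (tens M N Y a b)) : φ = ψ :=
  tensorObj_ext h

/-- The linear map out of `⟨X|M ⊗_C N|Z⟩` given by balanced bilinear maps. -/
def tdesc {Q : Type*} [AddCommGroup Q] [Module k Q]
    (φ : ∀ Y, M.obj X Y →ₗ[k] N.obj Y Z →ₗ[k] Q)
    (h : ∀ Y Y' p q l (m : M.obj X Y) (f : C.bk Y Y') (n : N.obj Y' Z), m ∈ (M.obj X Y).deg p →
      f ∈ (C.bk Y Y').deg q → n ∈ (N.obj Y' Z).deg l → φ Y' (M.ract m f) n = φ Y m (N.lact f n)) :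
    (M.tensor N).obj X Z →ₗ[k] Q :=
  DGMod.qlift (hR := rel_hom M N X Z) (hd := rel_d M N X Z) (DGMod.slift φ) (by
    rintro _ ⟨Y, Y', p, q, l, m, f, n, hm, hf, hn, rfl⟩
    rw [map_sub, DGMod.slift_smk, DGMod.slift_smk, sub_eq_zero]
    exact h _ _ _ _ _ _ _ _ hm hf hn)

@[simp] lemma tdesc_tens {Q : Type*} [AddCommGroup Q] [Module k Q]
    (φ : ∀ Y, M.obj X Y →ₗ[k] N.obj Y Z →ₗ[k] Q)
    (h : ∀ Y Y' p q l (m : M.obj X Y) (f : C.bk Y Y') (n : N.obj Y' Z), m ∈ (M.obj X Y).deg p →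
      f ∈ (C.bk Y Y').deg q → n ∈ (N.obj Y' Z).deg l → φ Y' (M.ract m f) n = φ Y m (N.lact f n))
    {Y : C.Obj} (m : M.obj X Y) (n : N.obj Y Z) : tdesc φ h (tens M N Y m n) = φ Y m n :=
  DGMod.slift_smk ..

/-- To check that a family of maps out of a tensor product is a map of degree `l`, it suffices to
consider the elements `m ⊗ n`. -/
lemma isMap_tensor {a b : Prop} {l : Γ} {P : Bimod A D} {φ : Fam (M.tensor N) P}
    (hd : ∀ X Y Z i j (m : M.obj X Y) (n : N.obj Y Z), m ∈ (M.obj X Y).deg i →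
      n ∈ (N.obj Y Z).deg j → φ X Z (tens M N Y m n) ∈ (P.obj X Z).deg (i + j + l))
    (hl : a → ∀ X' X Y Z i j p f (m : M.obj X Y) (n : N.obj Y Z), f ∈ (A.bk X' X).deg p →
      m ∈ (M.obj X Y).deg i → n ∈ (N.obj Y Z).deg j →
      φ X' Z (tens M N Y (M.lact f m) n) = G.sgn k l p • P.lact f (φ X Z (tens M N Y m n)))
    (hr : b → ∀ X Y Z Z' i j (m : M.obj X Y) (n : N.obj Y Z) (g : D.bk Z Z'),
      m ∈ (M.obj X Y).deg i → n ∈ (N.obj Y Z).deg j →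
      φ X Z' (tens M N Y m (N.ract n g)) = P.ract (φ X Z (tens M N Y m n)) g) :
    IsMap a b φ l := by
  refine ⟨fun X Z n t ht => ?_, fun ha X' X Z p f hf t => ?_, fun hb X Z Z' t g => ?_⟩
  · refine tensor_mem_le (S := ((P.obj X Z).deg (n + l)).comap (φ X Z)) ?_ ht
    rintro Y i j m n hm hn rfl
    exact hd _ _ _ _ _ _ _ hm hn
  · refine LinearMap.congr_fun (f := φ X' Z ∘ₗ (M.tensor N).lact f)
      (g := G.sgn k l p • (P.lact f ∘ₗ φ X Z)) (tensor_ext fun Y i j m n hm hn => ?_) t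
    simpa using hl ha _ _ _ _ _ _ _ _ _ _ hf hm hn
  · refine LinearMap.congr_fun (f := φ X Z' ∘ₗ (M.tensor N).ract.flip g)
      (g := P.ract.flip g ∘ₗ φ X Z) (tensor_ext fun Y i j m n hm hn => ?_) t
    simpa using hr hb _ _ _ _ _ _ _ _ _ hm hn

end Tens

/-! ### Functoriality of the tensor product in either factor. -/

section Whisker

variable {M M' M'' : Bimod A C} {N N' N'' : Bimod C D}

/-- The family `φ ⊗ 1`. -/
def rwh (φ : Fam M M') (hφ : IsRightLinear φ) (N : Bimod C D) : Fam (M.tensor N) (M'.tensor N) :=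
  fun X _ => tdesc (fun Y => tens M' N Y ∘ₗ φ X Y) (by
    intro Y Y' p q l m f n _ _ _
    simp [hφ X Y Y', tens_ract])

@[simp] lemma rwh_tens (φ : Fam M M') (hφ : IsRightLinear φ) {X : A.Obj} {Y : C.Obj} {Z : D.Obj}
    (m : M.obj X Y) (n : N.obj Y Z) :
    rwh φ hφ N X Z (tens M N Y m n) = tens M' N Y (φ X Y m) n :=
  tdesc_tens ..

lemma IsMap.rwh {a b : Prop} {l : Γ} {φ : Fam M M'} (h : IsMap a b φ l) (hφ : IsRightLinear φ)
    (N : Bimod C D) : IsMap a True (rwh φ hφ N) l := by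
  refine isMap_tensor ?_ ?_ ?_
  · intro X Y Z i j m n hm hn
    rw [rwh_tens]
    exact tens_mem_deg (h.deg _ _ _ _ hm) hn (by abel)
  · intro ha X' X Y Z i j p f m n hf hm hn
    simp [h.left ha _ _ _ _ f hf]
  · intro _ X Y Z Z' i j m n g hm hn
    simp

/-- With `ψ` the Hom differential of `φ`, this says that `- ⊗ N` is a dg functor. It is applied to
contractions (`ψ = 1`), to homotopies (`ψ = g f - 1`) and to arbitrary bimodule maps. -/
lemma rwh_d {l : Γ} {φ ψ : Fam M M'} (hd : IsMap False False φ l) (hφ : IsRightLinear φ)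
    (hψ : IsRightLinear ψ)
    (e : ∀ X Y m, (M'.obj X Y).d (φ X Y m) - G.sgn k G.ι l • φ X Y ((M.obj X Y).d m) = ψ X Y m)
    (X : A.Obj) (Z : D.Obj) (t : (M.tensor N).obj X Z) :
    ((M'.tensor N).obj X Z).d (rwh φ hφ N X Z t) -
      G.sgn k G.ι l • rwh φ hφ N X Z (((M.tensor N).obj X Z).d t) = rwh ψ hψ N X Z t := by
  refine LinearMap.congr_fun (f := ((M'.tensor N).obj X Z).d ∘ₗ rwh φ hφ N X Z -
      G.sgn k G.ι l • rwh φ hφ N X Z ∘ₗ ((M.tensor N).obj X Z).d) (g := rwh ψ hψ N X Z)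
      (tensor_ext fun Y i j m n hm hn => ?_) t
  simp only [LinearMap.sub_apply, LinearMap.smul_apply, LinearMap.comp_apply, rwh_tens,
    tensor_d_tens hm, tensor_d_tens (hd.deg _ _ _ _ hm), ← e, map_add, map_sub, map_smul,
    sgn_add_right]
  module

/-- The family `1 ⊗ φ`, for `φ` of degree `l`: it maps `m ⊗ n` to `(-1)^⟨l,|m|⟩ m ⊗ φ(n)`. -/
def lwh (l : Γ) (φ : Fam N N') (hφ : IsLeftLinear φ l) (M : Bimod A C) :
    Fam (M.tensor N) (M.tensor N') :=
  fun X Z => tdesc (fun Y => (tens M N' Y).compl₁₂ ((M.obj X Y).sOp l) (φ Y Z)) (by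
    intro Y Y' p q r m f n hm hf _
    simp only [LinearMap.compl₁₂_apply, DGMod.sOp_apply _ hm, DGMod.sOp_apply _ (M.ract_deg hm hf),
      hφ _ _ _ _ f hf, map_smul, LinearMap.smul_apply, sgn_add_right, smul_smul, tens_ract,
      mul_comm])

lemma lwh_tens {l : Γ} (φ : Fam N N') (hφ : IsLeftLinear φ l) {X : A.Obj} {Y : C.Obj} {Z : D.Obj}
    {i : Γ} {m : M.obj X Y} (hm : m ∈ (M.obj X Y).deg i) (n : N.obj Y Z) :
    lwh l φ hφ M X Z (tens M N Y m n) = G.sgn k l i • tens M N' Y m (φ Y Z n) := by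
  rw [lwh, tdesc_tens]
  simp [DGMod.sOp_apply _ hm]

-- In degree zero the Koszul sign is trivial, so `m` need not be homogeneous.
@[simp] lemma lwh_zero_tens (φ : Fam N N') (hφ : IsLeftLinear φ 0) {X : A.Obj} {Y : C.Obj}
    {Z : D.Obj} (m : M.obj X Y) (n : N.obj Y Z) :
    lwh 0 φ hφ M X Z (tens M N Y m n) = tens M N' Y m (φ Y Z n) := by
  refine LinearMap.congr_fun (f := lwh 0 φ hφ M X Z ∘ₗ (tens M N Y).flip n)
    (g := (tens M N' Y).flip (φ Y Z n)) (DGMod.ext_hom fun i m hm => ?_) m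
  simp [lwh_tens _ _ hm]

lemma IsMap.lwh {a b : Prop} {l : Γ} {φ : Fam N N'} (h : IsMap a b φ l) (hφ : IsLeftLinear φ l)
    (M : Bimod A C) : IsMap True b (lwh l φ hφ M) l := by
  refine isMap_tensor ?_ ?_ ?_
  · intro X Y Z i j m n hm hn
    rw [lwh_tens _ _ hm]
    exact Submodule.smul_mem _ _ (tens_mem_deg hm (h.deg _ _ _ _ hn) (by abel))
  · intro _ X' X Y Z i j p f m n hf hm hn
    rw [lwh_tens _ _ (M.lact_deg hf hm), lwh_tens _ _ hm]
    simp [sgn_add_right, mul_smul]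
  · intro hb X Y Z Z' i j m n g hm hn
    rw [lwh_tens _ _ hm, lwh_tens _ _ hm]
    simp [h.right hb Y Z Z']

/-- This is the dg functoriality of `M ⊗ -`. The degree `l'` of `ψ` is a separate variable because
`-ι + ι` is only propositionally `0`. -/
lemma lwh_d {l l' : Γ} {φ ψ : Fam N N'} (hφ : IsLeftLinear φ l) (hψ : IsLeftLinear ψ l')
    (hl : l + G.ι = l')
    (e : ∀ X Y m, (N'.obj X Y).d (φ X Y m) - G.sgn k G.ι l • φ X Y ((N.obj X Y).d m) = ψ X Y m)
    (X : A.Obj) (Z : D.Obj) (t : (M.tensor N).obj X Z) :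
    ((M.tensor N').obj X Z).d (lwh l φ hφ M X Z t) -
      G.sgn k G.ι l • lwh l φ hφ M X Z (((M.tensor N).obj X Z).d t) = lwh l' ψ hψ M X Z t := by
  subst hl
  refine LinearMap.congr_fun (f := ((M.tensor N').obj X Z).d ∘ₗ lwh l φ hφ M X Z -
      G.sgn k G.ι l • lwh l φ hφ M X Z ∘ₗ ((M.tensor N).obj X Z).d) (g := lwh _ ψ hψ M X Z)
      (tensor_ext fun Y i j m n hm hn => ?_) t
  have h1 : G.sgn k G.ι l * G.sgn k l G.ι = 1 := by rw [sgn_symm, sgn_mul_self]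
  simp only [LinearMap.sub_apply, LinearMap.smul_apply, LinearMap.comp_apply, lwh_tens _ _ hm,
    tensor_d_tens hm, ← e, map_add, map_sub, map_smul,
    lwh_tens _ _ ((M.obj X Y).d_deg hm), sgn_add_right, sgn_add_left, smul_add, smul_smul]
  rw [show G.sgn k G.ι l * (G.sgn k l i * G.sgn k l G.ι) = G.sgn k l i by
    rw [mul_left_comm, h1, mul_one]]
  module

lemma IsChain.rwh {φ : Fam M M'} (h : IsChain φ) (hd : IsMap False False φ 0)
    (hφ : IsRightLinear φ) (N : Bimod C D) : IsChain (rwh φ hφ N) := by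
  intro X Z t
  refine LinearMap.congr_fun (f := ((M'.tensor N).obj X Z).d ∘ₗ Bimod.rwh φ hφ N X Z)
      (g := Bimod.rwh φ hφ N X Z ∘ₗ ((M.tensor N).obj X Z).d)
      (tensor_ext fun Y i j m n hm hn => ?_) t
  simp [tensor_d_tens hm, tensor_d_tens (hd.deg_zero hm), h X Y m]

lemma IsChain.lwh {φ : Fam N N'} (h : IsChain φ)
    (hφ : IsLeftLinear φ 0) (M : Bimod A C) : IsChain (lwh 0 φ hφ M) := by
  intro X Z t
  refine LinearMap.congr_fun (f := ((M.tensor N').obj X Z).d ∘ₗ Bimod.lwh 0 φ hφ M X Z)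
      (g := Bimod.lwh 0 φ hφ M X Z ∘ₗ ((M.tensor N).obj X Z).d)
      (tensor_ext fun Y i j m n hm hn => ?_) t
  simp [tensor_d_tens hm, h Y Z]

lemma sgn_ι_neg_ι : G.sgn k G.ι (-G.ι) = -1 := by rw [sgn_symm, sgn_neg_left, sgn_ι_ι]

/-- A right linear contraction of `M` induces a contraction of `M ⊗ N`. -/
lemma Contractible.tensorRight {a : Prop} (H : Contractible a True M) (N : Bimod C D) :
    Contractible a True (M.tensor N) := by
  obtain ⟨h, hh⟩ := H
  refine ⟨_, hh.toIsMap.rwh (hh.right trivial) N, fun X Z t => ?_⟩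
  -- A contraction is a map of degree `-ι` whose Hom differential is the identity; the sign
  -- `(-1)^⟨ι,-ι⟩ = -1` turns the difference into `d h + h d`.
  have := rwh_d (N := N) (hh.toIsMap.mono False.elim False.elim) (hh.right trivial)
    ((IsMap.id (a := True) (b := True)).right trivial)
    (fun X Y m => by rw [sgn_ι_neg_ι, neg_smul, one_smul, sub_neg_eq_add, hh.eq]; rfl) X Z t
  rw [sgn_ι_neg_ι, neg_smul, one_smul, sub_neg_eq_add] at this
  rw [this]
  exact LinearMap.congr_fun (g := LinearMap.id) (tensor_ext fun Y i j m n hm hn => by simp) t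

/-- A left linear contraction of `N` induces a contraction of `M ⊗ N`. -/
lemma Contractible.tensorLeft {b : Prop} (H : Contractible True b N) (M : Bimod A C) :
    Contractible True b (M.tensor N) := by
  obtain ⟨h, hh⟩ := H
  refine ⟨_, hh.toIsMap.lwh (hh.left trivial) M, fun X Z t => ?_⟩
  have := lwh_d (M := M) (hh.left trivial) ((IsMap.id (a := True) (b := True)).left trivial)
    (by simp)
    (fun X Y m => by rw [sgn_ι_neg_ι, neg_smul, one_smul, sub_neg_eq_add, hh.eq]; rfl) X Z t
  rw [sgn_ι_neg_ι, neg_smul, one_smul, sub_neg_eq_add] at this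
  rw [this]
  exact LinearMap.congr_fun (g := LinearMap.id) (tensor_ext fun Y i j m n hm hn => by simp) t

end Whisker

/-! ### Homotopy retracts -/

section Retract

/-- `M` is a homotopy retract of `N`. -/
def IsRetract (M N : Bimod C D) : Prop :=
  ∃ (f : Fam M N) (g : Fam N M) (s : Fam M M), IsMap True True f 0 ∧ IsMap True True g 0 ∧
    IsMap True True s (-G.ι) ∧ IsChain f ∧ IsChain g ∧
    ∀ X Y m, g X Y (f X Y m) - m = (M.obj X Y).d (s X Y m) + s X Y ((M.obj X Y).d m)

lemma HEquiv.isRetract {M N : Bimod C D} (H : M.HEquiv N) : IsRetract M N := by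
  obtain ⟨f, g, h, -, hf, hg, hh, -, cf, cg, e, -⟩ := H.exists
  exact ⟨f, g, h, hf, hg, hh, cf, cg, e⟩

lemma IsRetract.contractible {M N : Bimod C D} {a b : Prop} (H : IsRetract M N)
    (h : Contractible a b N) : Contractible a b M := by
  obtain ⟨f, g, s, hf, hg, hs, cf, cg, e⟩ := H
  exact h.of_retract hf.of_full hg.of_full hs.of_full cf cg e

/-- The retraction data are tensored with the identity of `N`; dg functoriality carries the homotopy
along. A retract is all that is needed to transport contractibility. -/
lemma IsRetract.tensorRight {M M' : Bimod A C} (H : IsRetract M M') (N : Bimod C D) :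
    IsRetract (M.tensor N) (M'.tensor N) := by
  obtain ⟨f, g, s, hf, hg, hs, cf, cg, e⟩ := H
  refine ⟨_, _, _, hf.rwh (hf.right trivial) N, hg.rwh (hg.right trivial) N,
    hs.rwh (hs.right trivial) N, cf.rwh hf.of_full _ _, cg.rwh hg.of_full _ _, fun X Z t => ?_⟩
  have := rwh_d (N := N) (ψ := fun X Y => g X Y ∘ₗ f X Y + -LinearMap.id) hs.of_full
    (hs.right trivial) (((hg.comp hf (add_zero _)).add IsMap.id.neg).right trivial)
    (fun X Y m => by rw [sgn_ι_neg_ι, neg_smul, one_smul, sub_neg_eq_add, ← e]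
                     simp [sub_eq_add_neg]) X Z t
  rw [sgn_ι_neg_ι, neg_smul, one_smul, sub_neg_eq_add] at this
  rw [this]
  refine LinearMap.congr_fun (f := rwh g (hg.right trivial) N X Z ∘ₗ
      rwh f (hf.right trivial) N X Z - LinearMap.id)
    (tensor_ext fun Y i j m n hm hn => ?_) t
  simp [sub_eq_add_neg]

lemma IsRetract.tensorLeft {N N' : Bimod C D} (H : IsRetract N N') (M : Bimod A C) :
    IsRetract (M.tensor N) (M.tensor N') := by
  obtain ⟨f, g, s, hf, hg, hs, cf, cg, e⟩ := H
  refine ⟨_, _, _, hf.lwh (hf.left trivial) M, hg.lwh (hg.left trivial) M,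
    hs.lwh (hs.left trivial) M, cf.lwh _ _, cg.lwh _ _, fun X Z t => ?_⟩
  have := lwh_d (M := M) (ψ := fun X Y => g X Y ∘ₗ f X Y + -LinearMap.id)
    (hs.left trivial) (((hg.comp hf (add_zero _)).add IsMap.id.neg).left trivial) (by simp)
    (fun X Y m => by rw [sgn_ι_neg_ι, neg_smul, one_smul, sub_neg_eq_add, ← e]
                     simp [sub_eq_add_neg]) X Z t
  rw [sgn_ι_neg_ι, neg_smul, one_smul, sub_neg_eq_add] at this
  rw [this]
  refine LinearMap.congr_fun (f := lwh 0 g (hg.left trivial) M X Z ∘ₗ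
      lwh 0 f (hf.left trivial) M X Z - LinearMap.id)
    (tensor_ext fun Y i j m n hm hn => ?_) t
  simp [sub_eq_add_neg]

end Retract

/-! ### Associativity and unit -/

section Assoc

variable (M : Bimod A C) (N : Bimod C D) (P : Bimod D E)

/-- The bilinear map `(m ⊗ n, p) ↦ m ⊗ (n ⊗ p)`. -/
def assocHomAux (X : A.Obj) (Z : D.Obj) (W : E.Obj) :
    (M.tensor N).obj X Z →ₗ[k] P.obj Z W →ₗ[k] (M.tensor (N.tensor P)).obj X W :=
  tdesc (fun Y => LinearMap.mk₂ k
      (fun m n => (tens M (N.tensor P) (Z := W) Y m) ∘ₗ (tens N P Z n))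
      (fun m m' n => by ext; simp) (fun c m n => by ext; simp)
      (fun m n n' => by ext; simp) (fun c m n => by ext; simp))
    (fun Y Y' p q l m f n _ _ _ => by ext x; simp [tens_ract, ← tensor_lact_tens])

@[simp] lemma assocHomAux_tens {X : A.Obj} {Y : C.Obj} {Z : D.Obj} {W : E.Obj} (m : M.obj X Y)
    (n : N.obj Y Z) (x : P.obj Z W) : assocHomAux M N P X Z W (tens M N Y m n) x =
      tens M (N.tensor P) Y m (tens N P Z n x) := by
  simp [assocHomAux]

/-- The map `(m ⊗ n) ⊗ p ↦ m ⊗ (n ⊗ p)`. -/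
def assocHom : Fam ((M.tensor N).tensor P) (M.tensor (N.tensor P)) := fun X W =>
  tdesc (fun Z => assocHomAux M N P X Z W) (fun Z Z' p q l t g x _ _ _ => by
    refine LinearMap.congr_fun
      (f := (assocHomAux M N P X Z' W).flip x ∘ₗ (M.tensor N).ract.flip g)
      (g := (assocHomAux M N P X Z W).flip (P.lact g x)) (tensor_ext fun Y i j m n hm hn => ?_) t
    simp [tens_ract])

@[simp] lemma assocHom_tens {X : A.Obj} {Y : C.Obj} {Z : D.Obj} {W : E.Obj} (m : M.obj X Y)
    (n : N.obj Y Z) (x : P.obj Z W) :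
    assocHom M N P X W (tens (M.tensor N) P Z (tens M N Y m n) x) =
      tens M (N.tensor P) Y m (tens N P Z n x) :=
  (tdesc_tens ..).trans (assocHomAux_tens ..)

/-- The bilinear map `(n ⊗ p, m) ↦ (m ⊗ n) ⊗ p`. -/
def assocInvAux (X : A.Obj) (Y : C.Obj) (W : E.Obj) :
    (N.tensor P).obj Y W →ₗ[k] M.obj X Y →ₗ[k] ((M.tensor N).tensor P).obj X W :=
  tdesc (fun Z => LinearMap.mk₂ k
      (fun n x => (tens (M.tensor N) P Z).flip x ∘ₗ (tens M N Y).flip n)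
      (fun m m' n => by ext; simp) (fun c m n => by ext; simp)
      (fun m n n' => by ext; simp) (fun c m n => by ext; simp))
    (fun Z Z' p q l n g x _ _ _ => by ext m; simp [← tens_ract])

@[simp] lemma assocInvAux_tens {X : A.Obj} {Y : C.Obj} {Z : D.Obj} {W : E.Obj} (m : M.obj X Y)
    (n : N.obj Y Z) (x : P.obj Z W) : assocInvAux M N P X Y W (tens N P Z n x) m =
      tens (M.tensor N) P Z (tens M N Y m n) x := by
  simp [assocInvAux]

/-- The map `m ⊗ (n ⊗ p) ↦ (m ⊗ n) ⊗ p`. -/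
def assocInv : Fam (M.tensor (N.tensor P)) ((M.tensor N).tensor P) := fun X W =>
  tdesc (fun Y => (assocInvAux M N P X Y W).flip) (fun Y Y' p q l m f t _ _ _ => by
    refine LinearMap.congr_fun (f := (assocInvAux M N P X Y' W).flip (M.ract m f))
      (g := (assocInvAux M N P X Y W).flip m ∘ₗ (N.tensor P).lact f)
      (tensor_ext fun Z i j n x hn hx => ?_) t
    simp [tens_ract])

@[simp] lemma assocInv_tens {X : A.Obj} {Y : C.Obj} {Z : D.Obj} {W : E.Obj} (m : M.obj X Y)
    (n : N.obj Y Z) (x : P.obj Z W) :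
    assocInv M N P X W (tens M (N.tensor P) Y m (tens N P Z n x)) =
      tens (M.tensor N) P Z (tens M N Y m n) x := by
  simp [assocInv]

lemma tensor_ext₃ {X : A.Obj} {W : E.Obj} {Q : Type*} [AddCommGroup Q] [Module k Q]
    {φ ψ : ((M.tensor N).tensor P).obj X W →ₗ[k] Q}
    (h : ∀ Y Z i j l (m : M.obj X Y) (n : N.obj Y Z) (x : P.obj Z W), m ∈ (M.obj X Y).deg i →
      n ∈ (N.obj Y Z).deg j → x ∈ (P.obj Z W).deg l →
      φ (tens (M.tensor N) P Z (tens M N Y m n) x) =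
        ψ (tens (M.tensor N) P Z (tens M N Y m n) x)) : φ = ψ :=
  tensor_ext fun Z _ _ _ x _ hx => LinearMap.congr_fun
    (f := φ ∘ₗ (tens (M.tensor N) P Z).flip x) (g := ψ ∘ₗ (tens (M.tensor N) P Z).flip x)
    (tensor_ext fun _ _ _ _ _ hm hn => h _ _ _ _ _ _ _ _ hm hn hx) _

lemma tensor_ext₃' {X : A.Obj} {W : E.Obj} {Q : Type*} [AddCommGroup Q] [Module k Q]
    {φ ψ : (M.tensor (N.tensor P)).obj X W →ₗ[k] Q}
    (h : ∀ Y Z i j l (m : M.obj X Y) (n : N.obj Y Z) (x : P.obj Z W), m ∈ (M.obj X Y).deg i →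
      n ∈ (N.obj Y Z).deg j → x ∈ (P.obj Z W).deg l →
      φ (tens M (N.tensor P) Y m (tens N P Z n x)) =
        ψ (tens M (N.tensor P) Y m (tens N P Z n x))) : φ = ψ :=
  tensor_ext fun Y _ _ m _ hm _ => LinearMap.congr_fun
    (f := φ ∘ₗ tens M (N.tensor P) Y m) (g := ψ ∘ₗ tens M (N.tensor P) Y m)
    (tensor_ext fun _ _ _ _ _ hn hx => h _ _ _ _ _ _ _ _ hm hn hx) _

/-- Associativity of the tensor product. -/
lemma tensor_assoc : ((M.tensor N).tensor P).HEquiv (M.tensor (N.tensor P)) := by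
  have e (X W t) : assocInv M N P X W (assocHom M N P X W t) = t :=
    LinearMap.congr_fun (f := assocInv M N P X W ∘ₗ assocHom M N P X W) (g := LinearMap.id)
      (tensor_ext₃ M N P fun Y Z i j l m n x _ _ _ => by simp) t
  have e' (X W t) : assocHom M N P X W (assocInv M N P X W t) = t :=
    LinearMap.congr_fun (f := assocHom M N P X W ∘ₗ assocInv M N P X W) (g := LinearMap.id)
      (tensor_ext₃' M N P fun Y Z i j l m n x _ _ _ => by simp) t
  have c : IsChain (assocHom M N P) := fun X W t => by
    refine LinearMap.congr_fun (f := DGMod.d _ ∘ₗ assocHom M N P X W)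
      (g := assocHom M N P X W ∘ₗ DGMod.d _)
      (tensor_ext₃ M N P fun Y Z i j l m n x hm hn hx => ?_) t
    simp [tensor_d_tens hm, tensor_d_tens hn, tensor_d_tens (tens_mem_deg hm hn rfl),
      sgn_add_right, mul_smul, add_assoc]
  have hl (X' X W) (f : A.bk X' X) (t) : assocHom M N P X' W (((M.tensor N).tensor P).lact f t) =
      (M.tensor (N.tensor P)).lact f (assocHom M N P X W t) := by
    refine LinearMap.congr_fun (f := assocHom M N P X' W ∘ₗ ((M.tensor N).tensor P).lact f)
      (g := (M.tensor (N.tensor P)).lact f ∘ₗ assocHom M N P X W)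
      (tensor_ext₃ M N P fun Y Z i j l m n x hm hn hx => ?_) t
    simp
  have hr : IsRightLinear (assocHom M N P) := fun X W W' t g => by
    refine LinearMap.congr_fun (f := assocHom M N P X W' ∘ₗ ((M.tensor N).tensor P).ract.flip g)
      (g := (M.tensor (N.tensor P)).ract.flip g ∘ₗ assocHom M N P X W)
      (tensor_ext₃ M N P fun Y Z i j l m n x hm hn hx => ?_) t
    simp
  -- Injectivity transfers linearity and compatibility with `d` from `assocHom` to its inverse,
  -- without a second computation on generators.
  have hinj (X W) : Function.Injective (assocHom M N P X W) := fun x y h => by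
    rw [← e X W x, h, e]
  refine HEquiv.of_iso (f := assocHom M N P) (g := assocInv M N P) ⟨fun X W n t ht => ?_,
    fun _ X' X W i f _ t => by rw [hl, sgn_zero_left, one_smul], fun _ => hr⟩
    ⟨fun X W n t ht => ?_, fun _ X' X W i f _ t => hinj _ _ ?_, fun _ X W W' t g => hinj _ _ ?_⟩
    c (fun X W t => hinj _ _ ?_) e e'
  · rw [add_zero]
    refine tensor_mem_le (S := (((M.tensor (N.tensor P)).obj X W).deg n).comap
      (assocHom M N P X W)) ?_ ht
    rintro Z i j s x hs hx rfl
    refine tensor_mem_le (S := (((M.tensor (N.tensor P)).obj X W).deg (i + j)).comap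
      (assocHom M N P X W ∘ₗ (tens (M.tensor N) P Z).flip x)) ?_ hs
    rintro Y i l m n hm hn rfl
    simpa using tens_mem_deg hm (tens_mem_deg hn hx rfl) (add_assoc _ _ _).symm
  · rw [add_zero]
    refine tensor_mem_le (S := ((((M.tensor N).tensor P).obj X W).deg n).comap
      (assocInv M N P X W)) ?_ ht
    rintro Y i j m s hm hs rfl
    refine tensor_mem_le (S := ((((M.tensor N).tensor P).obj X W).deg (i + j)).comap
      (assocInv M N P X W ∘ₗ (tens M (N.tensor P) Y m))) ?_ hs
    rintro Z j l n x hn hx rfl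
    simpa using tens_mem_deg (tens_mem_deg hm hn rfl) hx (add_assoc _ _ _)
  · rw [e', sgn_zero_left, one_smul, hl, e']
  · rw [e', hr, e']
  · rw [← c, e', e']

end Assoc

end Bimod

end DG

end
noncomputable section

namespace DG

variable {k : Type u} [CommRing k] {Γ : Type w} [AddCommGroup Γ] {G : GradingData Γ}

namespace Bimod

variable {A C D E : DGCat.{u, w} k G}

/-! ### Total bimodules -/

section TotApi

variable {T : ℕ → Bimod C D} {δ : ∀ r, homSub (T (r + 1)) (T r) 0}
  {hd : ∀ (r : ℕ) Y Z (t : (T (r + 1)).obj Y Z),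
    (δ r).1 Y Z (((T (r + 1)).obj Y Z).d t) = ((T r).obj Y Z).d ((δ r).1 Y Z t)}
  {hδ : ∀ (r : ℕ) Y Z (t : (T (r + 2)).obj Y Z), (δ r).1 Y Z ((δ (r + 1)).1 Y Z t) = 0}
  {Y : C.Obj} {Z : D.Obj} {Q : Type*} [AddCommGroup Q] [Module k Q]

/-- The inclusion of the `r`-th summand of a total bimodule. -/
def tin (hd : ∀ (r : ℕ) Y Z (t : (T (r + 1)).obj Y Z),
    (δ r).1 Y Z (((T (r + 1)).obj Y Z).d t) = ((T r).obj Y Z).d ((δ r).1 Y Z t))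
    (hδ : ∀ (r : ℕ) Y Z (t : (T (r + 2)).obj Y Z), (δ r).1 Y Z ((δ (r + 1)).1 Y Z t) = 0)
    (r : ℕ) : Fam (T r) (tot T δ hd hδ) :=
  fun Y Z => bmk (T := T) (j := fun r => -(r • G.ι)) r Y Z

/-- The linear map out of a total bimodule given by its restrictions to the summands. -/
def tout (φ : ∀ r, (T r).obj Y Z →ₗ[k] Q) : (tot T δ hd hδ).obj Y Z →ₗ[k] Q :=
  blift (j := fun r => -(r • G.ι)) φ

@[simp] lemma tout_tin (φ : ∀ r, (T r).obj Y Z →ₗ[k] Q) (r : ℕ) (x : (T r).obj Y Z) :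
    tout φ (tin hd hδ r Y Z x) = φ r x :=
  blift_bmk ..

lemma tin_mem_deg {r : ℕ} {i n : Γ} {x : (T r).obj Y Z} (hx : x ∈ ((T r).obj Y Z).deg i)
    (h : i - r • G.ι = n) : tin hd hδ r Y Z x ∈ ((tot T δ hd hδ).obj Y Z).deg n := by
  subst h
  exact bmk_mem_deg (T := T) (j := fun r => -(r • G.ι)) (by simpa using hx)

lemma tot_mem_le {n : Γ} {S : Submodule k ((tot T δ hd hδ).obj Y Z)}
    (h : ∀ r i (x : (T r).obj Y Z), x ∈ ((T r).obj Y Z).deg i → i - r • G.ι = n →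
      tin hd hδ r Y Z x ∈ S) : ((tot T δ hd hδ).obj Y Z).deg n ≤ S :=
  shiftSum_mem_le (T := T) (j := fun r => -(r • G.ι)) fun r x hx => h r _ x hx (by abel)

lemma tot_ext {φ ψ : (tot T δ hd hδ).obj Y Z →ₗ[k] Q}
    (h : ∀ r i (x : (T r).obj Y Z), x ∈ ((T r).obj Y Z).deg i →
      φ (tin hd hδ r Y Z x) = ψ (tin hd hδ r Y Z x)) : φ = ψ :=
  DGMod.ext_hom fun _ => tot_mem_le (S := LinearMap.eqLocus φ ψ) fun r i x hx _ => h r i x hx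

lemma tot_d_zero (x : (T 0).obj Y Z) : ((tot T δ hd hδ).obj Y Z).d (tin hd hδ 0 Y Z x) =
    tin hd hδ 0 Y Z (((T 0).obj Y Z).d x) := by
  have h1 := shiftSum_d_bmk (T := T) (j := fun r => -(r • G.ι)) 0 x
  have h2 := totDiff_bmk_zero T δ x
  refine (congrArg₂ (· + ·) h1 h2).trans ?_
  simp only [zero_smul, neg_zero, sgn_zero_left, one_smul]
  exact add_zero _

/-- The shift by `-(r + 1)ι` puts a sign on the internal differential, while `δ` enters without one.
-/
lemma tot_d_succ (r : ℕ) (x : (T (r + 1)).obj Y Z) :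
    ((tot T δ hd hδ).obj Y Z).d (tin hd hδ (r + 1) Y Z x) =
      G.sgn k ((r + 1) • G.ι) G.ι • tin hd hδ (r + 1) Y Z (((T (r + 1)).obj Y Z).d x) +
        tin hd hδ r Y Z ((δ r).1 Y Z x) := by
  have h1 := shiftSum_d_bmk (T := T) (j := fun r => -(r • G.ι)) (r + 1) x
  have h2 := totDiff_bmk_succ T δ r x
  refine (congrArg₂ (· + ·) h1 h2).trans ?_
  rw [sgn_neg_left]
  rfl

lemma tot_lact_tin {Y' : C.Obj} {r : ℕ} {i : Γ} {f : C.bk Y' Y}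
    (hf : f ∈ (C.bk Y' Y).deg i) (x : (T r).obj Y Z) :
    (tot T δ hd hδ).lact f (tin hd hδ r Y Z x) =
      G.sgn k (r • G.ι) i • tin hd hδ r Y' Z ((T r).lact f x) := by
  rw [← sgn_neg_left]
  exact shiftSum_lact_bmk hf x

lemma tin_lact {Y' : C.Obj} {r : ℕ} {i : Γ} {f : C.bk Y' Y}
    (hf : f ∈ (C.bk Y' Y).deg i) (x : (T r).obj Y Z) :
    tin hd hδ r Y' Z ((T r).lact f x) =
      G.sgn k (r • G.ι) i • (tot T δ hd hδ).lact f (tin hd hδ r Y Z x) := by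
  rw [tot_lact_tin hf, smul_smul, sgn_mul_self, one_smul]

@[simp] lemma tot_ract_tin {Z' : D.Obj} {r : ℕ} (x : (T r).obj Y Z) (g : D.bk Z Z') :
    (tot T δ hd hδ).ract (tin hd hδ r Y Z x) g = tin hd hδ r Y Z' ((T r).ract x g) :=
  shiftSum_ract_bmk x g

/-- To check that a family of maps out of a total bimodule is a map of degree `l`, it suffices to
consider the summands. -/
lemma isMap_tot {a b : Prop} {l : Γ} {P : Bimod C D} {φ : Fam (tot T δ hd hδ) P}
    (h1 : ∀ r Y Z i (x : (T r).obj Y Z), x ∈ ((T r).obj Y Z).deg i →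
      φ Y Z (tin hd hδ r Y Z x) ∈ (P.obj Y Z).deg (i - r • G.ι + l))
    (hl : a → ∀ r Y' Y Z i p (f : C.bk Y' Y) (x : (T r).obj Y Z), f ∈ (C.bk Y' Y).deg p →
      x ∈ ((T r).obj Y Z).deg i → φ Y' Z (tin hd hδ r Y' Z ((T r).lact f x)) =
        (G.sgn k (r • G.ι) p * G.sgn k l p) • P.lact f (φ Y Z (tin hd hδ r Y Z x)))
    (hr : b → ∀ r Y Z Z' i (x : (T r).obj Y Z) (g : D.bk Z Z'), x ∈ ((T r).obj Y Z).deg i →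
      φ Y Z' (tin hd hδ r Y Z' ((T r).ract x g)) = P.ract (φ Y Z (tin hd hδ r Y Z x)) g) :
    IsMap a b φ l := by
  refine ⟨fun X Z n t ht => ?_, fun ha X' X Z p f hf t => ?_, fun hb X Z Z' t g => ?_⟩
  · refine tot_mem_le (S := ((P.obj X Z).deg (n + l)).comap (φ X Z)) ?_ ht
    rintro r i x hx rfl
    exact h1 _ _ _ _ _ hx
  · refine LinearMap.congr_fun (f := φ X' Z ∘ₗ (tot T δ hd hδ).lact f)
      (g := G.sgn k l p • (P.lact f ∘ₗ φ X Z)) (tot_ext fun r i x hx => ?_) t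
    simp only [LinearMap.comp_apply, tot_lact_tin hf, map_smul, hl ha _ _ _ _ _ _ _ _ hf hx,
      LinearMap.smul_apply]
    rw [smul_smul, ← mul_assoc, sgn_mul_self, one_mul]
  · refine LinearMap.congr_fun (f := φ X Z' ∘ₗ (tot T δ hd hδ).ract.flip g)
      (g := P.ract.flip g ∘ₗ φ X Z) (tot_ext fun r i x hx => ?_) t
    simpa using hr hb _ _ _ _ _ _ _ hx

end TotApi

/-! ### Cones -/

/-- Bimodule maps which exhibit `A` as the cone of a closed degree zero map `ε : P → M`, up to a
shift. -/
structure ConeData (M P A : Bimod C D) where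
  -- The model is `A = M ⊕ q^{-ι} P` as a graded object, with inclusions `i`, `j` and projections
  -- `q`, `p`. The arguments below need neither `q j = 0` nor `i q + j p = 1`, so these are not part
  -- of the data.
  i : Fam M A
  p : Fam A P
  q : Fam A M
  j : Fam P A
  ε : Fam P M
  isMap_i : IsMap True True i 0
  isMap_p : IsMap True True p G.ι
  isMap_q : IsMap True True q 0
  isMap_j : IsMap True True j (-G.ι)
  isMap_ε : IsMap True True ε 0
  d_i : IsChain i
  d_ε : IsChain ε
  d_p : ∀ X Y x, (P.obj X Y).d (p X Y x) = -p X Y ((A.obj X Y).d x)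
  d_q : ∀ X Y x, (M.obj X Y).d (q X Y x) = q X Y ((A.obj X Y).d x) - ε X Y (p X Y x)
  d_j : ∀ X Y x, (A.obj X Y).d (j X Y x) = i X Y (ε X Y x) - j X Y ((P.obj X Y).d x)
  p_i : ∀ X Y x, p X Y (i X Y x) = 0
  q_i : ∀ X Y x, q X Y (i X Y x) = x
  p_j : ∀ X Y x, p X Y (j X Y x) = x

namespace ConeData

variable {M P B : Bimod C D} {a b : Prop}

/-- If the inclusion of `M` into the cone is nullhomotopic, then `ε` has a homotopy section. -/
lemma exists_section (c : ConeData M P B) {η : Fam M B} (hη : IsMap a b η (-G.ι))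
    (e : ∀ X Y m, (B.obj X Y).d (η X Y m) + η X Y ((M.obj X Y).d m) = c.i X Y m) :
    ∃ (σ : Fam M P) (s : Fam M M), IsMap a b σ 0 ∧ IsMap a b s (-G.ι) ∧ IsChain σ ∧
      (∀ X Y m, c.ε X Y (σ X Y m) - m = (M.obj X Y).d (s X Y m) + s X Y ((M.obj X Y).d m)) ∧
      σ = fun X Y => c.p X Y ∘ₗ η X Y := by
  have e' (X Y m) : (B.obj X Y).d (η X Y m) = c.i X Y m - η X Y ((M.obj X Y).d m) := by
    rw [← e, add_sub_cancel_right]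
  -- Apply the projections to `d η + η d = i`. Since `p i = 0` and `p` anticommutes with `d`, the
  -- map `p η` is closed. Since `q i = 1` and `d q = q d - ε p`, the map `-q η` is a homotopy from
  -- the identity to `ε p η`.
  refine ⟨fun X Y => c.p X Y ∘ₗ η X Y, fun X Y => -(c.q X Y ∘ₗ η X Y),
    c.isMap_p.of_full.comp hη (neg_add_cancel _), (c.isMap_q.of_full.comp hη (add_zero _)).neg,
    fun X Y m => ?_, fun X Y m => ?_, rfl⟩
  · simp [c.d_p, e', c.p_i]
  · simp [c.d_q, e', c.q_i]
    abel

/-- If the cone is contractible, then `ε` is a homotopy equivalence. -/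
lemma hEquiv (c : ConeData M P B) (H : Contractible True True B) : P.HEquiv M := by
  obtain ⟨h, hh⟩ := H
  have e' (X Y m) : (B.obj X Y).d (h X Y m) = m - h X Y ((B.obj X Y).d m) := by
    rw [eq_sub_iff_add_eq, hh.eq]
  obtain ⟨σ, s, hσ, hs, cσ, e, rfl⟩ := c.exists_section (η := fun X Y => h X Y ∘ₗ c.i X Y)
    (hh.toIsMap.comp c.isMap_i (zero_add _)) (fun X Y m => by simp [← c.d_i X Y, hh.eq])
  -- Only the composite `σ ε = p h i ε` remains. Replacing `i ε` by `d j + j d` shows that it is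
  -- homotopic to `1` through `p h j`.
  refine HEquiv.mk c.isMap_ε hσ (h := fun X Y => c.p X Y ∘ₗ h X Y ∘ₗ c.j X Y)
    (c.isMap_p.comp (hh.toIsMap.comp c.isMap_j rfl) (by abel)) hs c.d_ε cσ (fun X Y m => ?_) e
  simp [c.d_p, e', c.d_j, c.p_j]
  abel

/-- If the cone and `P` are contractible, then so is `M`. -/
lemma contractible (c : ConeData M P B) (H : Contractible a b B)
    (H' : Contractible a b P) : Contractible a b M := by
  obtain ⟨h, hh⟩ := H
  obtain ⟨σ, s, hσ, hs, cσ, e, -⟩ := c.exists_section (η := fun X Y => h X Y ∘ₗ c.i X Y)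
    (hh.toIsMap.comp c.isMap_i.of_full (zero_add _)) (fun X Y m => by simp [← c.d_i X Y, hh.eq])
  -- The section `σ` makes `M` a homotopy retract of `P`, with exactly the linearity of the given
  -- contraction of the cone.
  exact H'.of_retract hσ c.isMap_ε.of_full hs cσ c.d_ε e

/-- The cone of `ε ⊗ 1`. -/
def tensorRight {M P B : Bimod A C} (c : ConeData M P B) (N : Bimod C D) :
    ConeData (M.tensor N) (P.tensor N) (B.tensor N) where
  i := rwh c.i (c.isMap_i.right trivial) N
  p := rwh c.p (c.isMap_p.right trivial) N
  q := rwh c.q (c.isMap_q.right trivial) N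
  j := rwh c.j (c.isMap_j.right trivial) N
  ε := rwh c.ε (c.isMap_ε.right trivial) N
  isMap_i := c.isMap_i.rwh _ N
  isMap_p := c.isMap_p.rwh _ N
  isMap_q := c.isMap_q.rwh _ N
  isMap_j := c.isMap_j.rwh _ N
  isMap_ε := c.isMap_ε.rwh _ N
  d_i := c.d_i.rwh c.isMap_i.of_full _ N
  d_ε := c.d_ε.rwh c.isMap_ε.of_full _ N
  d_p X Z t := by
    refine LinearMap.congr_fun (f := DGMod.d _ ∘ₗ rwh c.p (c.isMap_p.right trivial) N X Z)
      (g := -(rwh c.p (c.isMap_p.right trivial) N X Z ∘ₗ DGMod.d _))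
      (tensor_ext fun Y i j m n hm hn => ?_) t
    simp [tensor_d_tens hm, tensor_d_tens (c.isMap_p.deg _ _ _ _ hm), sgn_add_right, c.d_p,
      add_comm]
  d_q X Z t := by
    refine LinearMap.congr_fun (f := DGMod.d _ ∘ₗ rwh c.q (c.isMap_q.right trivial) N X Z)
      (g := rwh c.q (c.isMap_q.right trivial) N X Z ∘ₗ DGMod.d _ -
        rwh c.ε (c.isMap_ε.right trivial) N X Z ∘ₗ rwh c.p (c.isMap_p.right trivial) N X Z)
      (tensor_ext fun Y i j m n hm hn => ?_) t
    simp [tensor_d_tens hm, tensor_d_tens (c.isMap_q.deg_zero hm), c.d_q]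
    abel
  d_j X Z t := by
    refine LinearMap.congr_fun (f := DGMod.d _ ∘ₗ rwh c.j (c.isMap_j.right trivial) N X Z)
      (g := rwh c.i (c.isMap_i.right trivial) N X Z ∘ₗ rwh c.ε (c.isMap_ε.right trivial) N X Z -
        rwh c.j (c.isMap_j.right trivial) N X Z ∘ₗ DGMod.d _)
      (tensor_ext fun Y i j m n hm hn => ?_) t
    simp [tensor_d_tens hm, tensor_d_tens (c.isMap_j.deg _ _ _ _ hm), c.d_j, sgn_add_right,
      sgn_ι_neg_ι]
    abel
  p_i X Z t := LinearMap.congr_fun (f := rwh c.p (c.isMap_p.right trivial) N X Z ∘ₗ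
    rwh c.i (c.isMap_i.right trivial) N X Z) (g := 0)
    (tensor_ext fun Y i j m n hm hn => by simp [c.p_i]) t
  q_i X Z t := LinearMap.congr_fun (f := rwh c.q (c.isMap_q.right trivial) N X Z ∘ₗ
    rwh c.i (c.isMap_i.right trivial) N X Z) (g := LinearMap.id)
    (tensor_ext fun Y i j m n hm hn => by simp [c.q_i]) t
  p_j X Z t := LinearMap.congr_fun (f := rwh c.p (c.isMap_p.right trivial) N X Z ∘ₗ
    rwh c.j (c.isMap_j.right trivial) N X Z) (g := LinearMap.id)
    (tensor_ext fun Y i j m n hm hn => by simp [c.p_j]) t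

/-- The cone of `1 ⊗ ε`. -/
def tensorLeft {M P B : Bimod C D} (c : ConeData M P B) (N : Bimod A C) :
    ConeData (N.tensor M) (N.tensor P) (N.tensor B) where
  i := lwh 0 c.i (c.isMap_i.left trivial) N
  -- Unlike `i`, `q` and `ε`, the maps `p` and `j` have nonzero degree, so they pick up a Koszul
  -- sign when moved past `N`.
  p := lwh G.ι c.p (c.isMap_p.left trivial) N
  q := lwh 0 c.q (c.isMap_q.left trivial) N
  j := lwh (-G.ι) c.j (c.isMap_j.left trivial) N
  ε := lwh 0 c.ε (c.isMap_ε.left trivial) N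
  isMap_i := c.isMap_i.lwh _ N
  isMap_p := c.isMap_p.lwh _ N
  isMap_q := c.isMap_q.lwh _ N
  isMap_j := c.isMap_j.lwh _ N
  isMap_ε := c.isMap_ε.lwh _ N
  d_i := c.d_i.lwh _ N
  d_ε := c.d_ε.lwh _ N
  d_p X Z t := by
    refine LinearMap.congr_fun (f := DGMod.d _ ∘ₗ lwh G.ι c.p (c.isMap_p.left trivial) N X Z)
      (g := -(lwh G.ι c.p (c.isMap_p.left trivial) N X Z ∘ₗ DGMod.d _))
      (tensor_ext fun Y i j m n hm hn => ?_) t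
    simp [tensor_d_tens hm, lwh_tens _ _ hm, lwh_tens _ _ ((N.obj X Y).d_deg hm), sgn_add_right,
      c.d_p, add_comm]
  d_q X Z t := by
    refine LinearMap.congr_fun (f := DGMod.d _ ∘ₗ lwh 0 c.q (c.isMap_q.left trivial) N X Z)
      (g := lwh 0 c.q (c.isMap_q.left trivial) N X Z ∘ₗ DGMod.d _ -
        lwh 0 c.ε (c.isMap_ε.left trivial) N X Z ∘ₗ lwh G.ι c.p (c.isMap_p.left trivial) N X Z)
      (tensor_ext fun Y i j m n hm hn => ?_) t
    simp [tensor_d_tens hm, lwh_tens _ _ hm, c.d_q, smul_sub]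
    abel
  d_j X Z t := by
    refine LinearMap.congr_fun (f := DGMod.d _ ∘ₗ lwh (-G.ι) c.j (c.isMap_j.left trivial) N X Z)
      (g := lwh 0 c.i (c.isMap_i.left trivial) N X Z ∘ₗ
        lwh 0 c.ε (c.isMap_ε.left trivial) N X Z -
        lwh (-G.ι) c.j (c.isMap_j.left trivial) N X Z ∘ₗ DGMod.d _)
      (tensor_ext fun Y i j m n hm hn => ?_) t
    simp [tensor_d_tens hm, lwh_tens _ _ hm, lwh_tens _ _ ((N.obj X Y).d_deg hm), c.d_j,
      sgn_neg_left, sgn_add_right, smul_sub, smul_smul, sgn_mul_self]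
    abel
  p_i X Z t := LinearMap.congr_fun (f := lwh G.ι c.p (c.isMap_p.left trivial) N X Z ∘ₗ
    lwh 0 c.i (c.isMap_i.left trivial) N X Z) (g := 0)
    (tensor_ext fun Y i j m n hm hn => by simp [lwh_tens _ _ hm, c.p_i]) t
  q_i X Z t := LinearMap.congr_fun (f := lwh 0 c.q (c.isMap_q.left trivial) N X Z ∘ₗ
    lwh 0 c.i (c.isMap_i.left trivial) N X Z) (g := LinearMap.id)
    (tensor_ext fun Y i j m n hm hn => by simp [c.q_i]) t
  p_j X Z t := LinearMap.congr_fun (f := lwh G.ι c.p (c.isMap_p.left trivial) N X Z ∘ₗ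
    lwh (-G.ι) c.j (c.isMap_j.left trivial) N X Z) (g := LinearMap.id)
    (tensor_ext fun Y i j m n hm hn => by
      simp [lwh_tens _ _ hm, c.p_j, sgn_neg_left, smul_smul, sgn_mul_self]) t

/-- Replacing the target of `ε` by an isomorphic bimodule. -/
def changeTarget (c : ConeData M P B) {M' : Bimod C D} (f : Fam M M') (g : Fam M' M)
    (hf : IsMap True True f 0) (hg : IsMap True True g 0) (cf : IsChain f) (cg : IsChain g)
    (gf : ∀ X Y x, g X Y (f X Y x) = x)
    (fg : ∀ X Y x, f X Y (g X Y x) = x) : ConeData M' P B where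
  i X Y := c.i X Y ∘ₗ g X Y
  p := c.p
  q X Y := f X Y ∘ₗ c.q X Y
  j := c.j
  ε X Y := f X Y ∘ₗ c.ε X Y
  isMap_i := c.isMap_i.comp hg (zero_add _)
  isMap_p := c.isMap_p
  isMap_q := hf.comp c.isMap_q (zero_add _)
  isMap_j := c.isMap_j
  isMap_ε := hf.comp c.isMap_ε (zero_add _)
  d_i X Y x := by simp [c.d_i X Y, cg X Y]
  d_ε X Y x := by simp [c.d_ε X Y, cf X Y]
  d_p := c.d_p
  d_q X Y x := by simp [cf X Y, c.d_q]
  d_j X Y x := by simp [c.d_j, gf]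
  p_i X Y x := by simp [c.p_i]
  q_i X Y x := by simp [c.q_i, fg]
  p_j := c.p_j

end ConeData

end Bimod

end DG

end
noncomputable section

namespace DG

variable {k : Type u} [CommRing k] {Γ : Type w} [AddCommGroup Γ] {G : GradingData Γ}

namespace Bimod

variable {A C D E : DGCat.{u, w} k G}

/-! ### The cone of an augmentation -/

section TotCone

variable (T : ℕ → Bimod C D) (δ : ∀ r, homSub (T (r + 1)) (T r) 0)
  (hd : ∀ (r : ℕ) Y Z (t : (T (r + 1)).obj Y Z),
    (δ r).1 Y Z (((T (r + 1)).obj Y Z).d t) = ((T r).obj Y Z).d ((δ r).1 Y Z t))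
  (hδ : ∀ (r : ℕ) Y Z (t : (T (r + 2)).obj Y Z), (δ r).1 Y Z ((δ (r + 1)).1 Y Z t) = 0)

/-- The total bimodule of `⋯ → T_3 → T_2 → T_1`. -/
abbrev totTail : Bimod C D := tot (fun r => T (r + 1)) (fun r => δ (r + 1)) (fun r => hd (r + 1))
  (fun r => hδ (r + 1))

/-- The inclusion of the `r`-th summand of the tail. -/
abbrev tailIn (r : ℕ) : Fam (T (r + 1)) (totTail T δ hd hδ) :=
  tin (T := fun r => T (r + 1)) (δ := fun r => δ (r + 1)) (fun r => hd (r + 1))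
    (fun r => hδ (r + 1)) r

/-- The components of the projection to the tail. -/
def coneProj (Y : C.Obj) (Z : D.Obj) :
    ∀ r, (T r).obj Y Z →ₗ[k] (totTail T δ hd hδ).obj Y Z
  | 0 => 0
  | r + 1 => (-1 : k) ^ r • tailIn T δ hd hδ r Y Z

/-- The components of the projection to the zeroth term. -/
def coneHead (Y : C.Obj) (Z : D.Obj) : ∀ r, (T r).obj Y Z →ₗ[k] (T 0).obj Y Z
  | 0 => LinearMap.id
  | _ + 1 => 0

/-- The components of the augmentation of the tail. -/
def coneAug (Y : C.Obj) (Z : D.Obj) : ∀ r, (T (r + 1)).obj Y Z →ₗ[k] (T 0).obj Y Z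
  | 0 => (δ 0).1 Y Z
  | _ + 1 => 0

lemma sgn_succ_nsmul (r : ℕ) (i j : Γ) :
    G.sgn k ((r + 1) • i) j = G.sgn k (r • i) j * G.sgn k i j := by
  rw [succ_nsmul, sgn_add_left]

/-- The total bimodule of `⋯ → T_1 → T_0` is the cone of the augmentation of its tail. -/
def totCone : ConeData (T 0) (totTail T δ hd hδ) (tot T δ hd hδ) where
  i := tin hd hδ 0
  -- The summand `r` of the tail is the summand `r + 1` of the total bimodule. The two shifts
  -- already make the internal differentials opposite; the factor `(-1)^r` in `p` and `j` makes the
  -- `δ` parts anticommute as well.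
  p Y Z := tout (coneProj T δ hd hδ Y Z)
  q Y Z := tout (coneHead T Y Z)
  j Y Z := tout fun r => (-1 : k) ^ r • tin hd hδ (r + 1) Y Z
  ε Y Z := tout (coneAug T δ Y Z)
  isMap_i := by
    refine ⟨fun X Y i m hm => tin_mem_deg hm (by simp), fun _ X' X Y i f hf m => ?_,
      fun _ X Y Y' m g => (tot_ract_tin m g).symm⟩
    rw [tin_lact hf]
    simp
  isMap_p := by
    refine isMap_tot ?_ ?_ ?_
    · rintro (_ | r) Y Z i x hx
      · simp [coneProj]
      · rw [tout_tin]
        exact Submodule.smul_mem _ _ (tin_mem_deg hx (by rw [succ_nsmul]; abel))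
    · rintro - (_ | r) Y' Y Z i p f x hf hx
      · simp [coneProj]
      · rw [tout_tin, tout_tin, coneProj, coneProj, LinearMap.smul_apply, LinearMap.smul_apply,
          tin_lact (T := fun r => T (r + 1)) hf, sgn_succ_nsmul, mul_assoc, sgn_mul_self, mul_one,
          map_smul, smul_comm]
    · rintro - (_ | r) Y Z Z' i x g hx
      · simp [coneProj]
      · rw [tout_tin, tout_tin, coneProj, coneProj, LinearMap.smul_apply, LinearMap.smul_apply,
          LinearMap.map_smul₂]
        exact congrArg _ (tot_ract_tin (T := fun r => T (r + 1)) x g).symm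
  isMap_q := by
    refine isMap_tot ?_ ?_ ?_
    · rintro (_ | r) Y Z i x hx <;> simp [coneHead, hx]
    · rintro - (_ | r) Y' Y Z i p f x hf hx <;> simp [coneHead]
    · rintro - (_ | r) Y Z Z' i x g hx <;> simp [coneHead]
  isMap_j := by
    refine isMap_tot ?_ ?_ ?_
    · rintro r Y Z i x hx
      rw [tout_tin]
      exact Submodule.smul_mem _ _ (tin_mem_deg hx (by rw [succ_nsmul]; abel))
    · rintro - r Y' Y Z i p f x hf hx
      rw [tout_tin, tout_tin, LinearMap.smul_apply, LinearMap.smul_apply, tin_lact hf,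
        sgn_succ_nsmul, sgn_neg_left, map_smul, smul_comm]
    · rintro - r Y Z Z' i x g hx
      rw [tout_tin, tout_tin, LinearMap.smul_apply, LinearMap.smul_apply, LinearMap.map_smul₂,
        tot_ract_tin]
  isMap_ε := by
    refine isMap_tot ?_ ?_ ?_
    · rintro (_ | r) Y Z i x hx
      · simpa [coneAug] using homSub_deg (δ 0) hx
      · simp [coneAug]
    · rintro - (_ | r) Y' Y Z i p f x hf hx
      · simp [coneAug, homSub_lact]
      · simp [coneAug]
    · rintro - (_ | r) Y Z Z' i x g hx
      · simpa [coneAug] using (δ 0).2.2.2 _ _ _ x g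
      · simp [coneAug]
  d_i Y Z x := tot_d_zero x
  d_ε Y Z t := by
    refine LinearMap.congr_fun (f := DGMod.d _ ∘ₗ tout (coneAug T δ Y Z))
      (g := tout (coneAug T δ Y Z) ∘ₗ DGMod.d _) (tot_ext ?_) t
    -- The augmentation lives on summand `0` of the tail. There the claim is that `δ 0` commutes
    -- with `d`, on summand `1` it is `δ δ = 0`, and beyond that both sides vanish.
    rintro (_ | _ | r) i x -
    · simp [tot_d_zero, coneAug, hd]
    · simp [tot_d_succ, coneAug, hδ]
    · simp [tot_d_succ, coneAug]
  d_p Y Z t := by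
    refine LinearMap.congr_fun (f := DGMod.d _ ∘ₗ tout (coneProj T δ hd hδ Y Z))
      (g := -(tout (coneProj T δ hd hδ Y Z) ∘ₗ DGMod.d _)) (tot_ext ?_) t
    rintro (_ | _ | r) i x -
    · simp [tot_d_zero, coneProj]
    · simp [tot_d_succ, coneProj, tot_d_zero (T := fun r => T (r + 1))]
    · simp only [LinearMap.comp_apply, LinearMap.neg_apply, tout_tin, tot_d_succ, map_add,
        map_smul, coneProj, tot_d_succ (T := fun r => T (r + 1)), tailIn, LinearMap.smul_apply]
      rw [sgn_succ_nsmul (r + 1), sgn_ι_ι, pow_succ]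
      module
  d_q Y Z t := by
    refine LinearMap.congr_fun (f := DGMod.d _ ∘ₗ tout (coneHead T Y Z))
      (g := tout (coneHead T Y Z) ∘ₗ DGMod.d _ -
        tout (coneAug T δ Y Z) ∘ₗ tout (coneProj T δ hd hδ Y Z)) (tot_ext ?_) t
    rintro (_ | _ | r) i x -
    · simp [tot_d_zero, coneProj, coneHead]
    · simp [tot_d_succ, coneProj, coneHead, coneAug]
    · simp [tot_d_succ, coneProj, coneHead, coneAug]
  d_j Y Z t := by
    refine LinearMap.congr_fun (f := DGMod.d _ ∘ₗ
        tout fun r => (-1 : k) ^ r • tin hd hδ (r + 1) Y Z)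
      (g := tin hd hδ 0 Y Z ∘ₗ tout (coneAug T δ Y Z) -
        (tout fun r => (-1 : k) ^ r • tin hd hδ (r + 1) Y Z) ∘ₗ DGMod.d _) (tot_ext ?_) t
    rintro (_ | r) i x -
    · simp [tot_d_zero, tot_d_succ, coneAug]
      abel
    · simp only [LinearMap.comp_apply, LinearMap.sub_apply, tout_tin, tot_d_succ, map_add,
        map_smul, coneAug, LinearMap.zero_apply, map_zero, LinearMap.smul_apply]
      rw [sgn_succ_nsmul (r + 1), sgn_ι_ι, pow_succ]
      module
  p_i Y Z x := by simp [coneProj]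
  q_i Y Z x := by simp [coneHead]
  p_j Y Z t := LinearMap.congr_fun (f := tout (coneProj T δ hd hδ Y Z) ∘ₗ
    tout fun r => (-1 : k) ^ r • tin hd hδ (r + 1) Y Z) (g := LinearMap.id)
    (tot_ext fun r i x _ => by simp [coneProj, smul_smul, ← mul_pow]) t

end TotCone

/-! ### The augmented bar complex -/

section Aug

variable (C)

/-- The element `f ⊗ t` of `barTerm C (n + 1)`. -/
def bcons (n : ℕ) {Y Z : C.Obj} (X : C.Obj) :
    C.bk Y X →ₗ[k] (barTerm C n).obj X Z →ₗ[k] (barTerm C (n + 1)).obj Y Z :=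
  (barTerm C n).fmk X

/-- The linear map out of `barTerm C (n + 1)` given by bilinear maps. -/
def bdesc (n : ℕ) {Y Z : C.Obj} {Q : Type*} [AddCommGroup Q] [Module k Q]
    (φ : ∀ X, C.bk Y X →ₗ[k] (barTerm C n).obj X Z →ₗ[k] Q) :
    (barTerm C (n + 1)).obj Y Z →ₗ[k] Q :=
  flift (N := barTerm C n) φ

/-- The unit, as an element of `barTerm C 0`. -/
def bnil (Z : C.Obj) : (barTerm C 0).obj Z Z := C.id Z

variable {C} {n : ℕ} {Y Z : C.Obj}

@[simp] lemma bdesc_bcons {Q : Type*} [AddCommGroup Q] [Module k Q]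
    (φ : ∀ X, C.bk Y X →ₗ[k] (barTerm C n).obj X Z →ₗ[k] Q) {X : C.Obj} (f : C.bk Y X)
    (t : (barTerm C n).obj X Z) : bdesc C n φ (bcons C n X f t) = φ X f t :=
  flift_fmk ..

lemma bcons_mem_deg {X : C.Obj} {i j l : Γ} {f : C.bk Y X} {t : (barTerm C n).obj X Z}
    (hf : f ∈ (C.bk Y X).deg i) (ht : t ∈ ((barTerm C n).obj X Z).deg j) (h : i + j = l) :
    bcons C n X f t ∈ ((barTerm C (n + 1)).obj Y Z).deg l :=
  fmk_mem_deg hf ht h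

lemma barTerm_d_bcons {X : C.Obj} {i : Γ} {f : C.bk Y X} (hf : f ∈ (C.bk Y X).deg i)
    (t : (barTerm C n).obj X Z) : ((barTerm C (n + 1)).obj Y Z).d (bcons C n X f t) =
      bcons C n X ((C.bk Y X).d f) t +
        G.sgn k G.ι i • bcons C n X f (((barTerm C n).obj X Z).d t) :=
  free_d_fmk hf t

@[simp] lemma barTerm_lact_bcons {Y' X : C.Obj} (g : C.bk Y' Y) (f : C.bk Y X)
    (t : (barTerm C n).obj X Z) :
    (barTerm C (n + 1)).lact g (bcons C n X f t) = bcons C n X (C.comp g f) t :=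
  free_lact_fmk g f t

@[simp] lemma barTerm_ract_bcons {X Z' : C.Obj} (f : C.bk Y X)
    (t : (barTerm C n).obj X Z) (g : C.bk Z Z') :
    (barTerm C (n + 1)).ract (bcons C n X f t) g = bcons C n X f ((barTerm C n).ract t g) :=
  free_ract_fmk f t g

lemma barTerm_mem_le {l : Γ} {S : Submodule k ((barTerm C (n + 1)).obj Y Z)}
    (h : ∀ X i j (f : C.bk Y X) (t : (barTerm C n).obj X Z), f ∈ (C.bk Y X).deg i →
      t ∈ ((barTerm C n).obj X Z).deg j → i + j = l → bcons C n X f t ∈ S) :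
    ((barTerm C (n + 1)).obj Y Z).deg l ≤ S :=
  free_mem_le h

lemma barTerm_ext {Q : Type*} [AddCommGroup Q] [Module k Q]
    {φ ψ : (barTerm C (n + 1)).obj Y Z →ₗ[k] Q} (h : ∀ X i j (f : C.bk Y X)
      (t : (barTerm C n).obj X Z), f ∈ (C.bk Y X).deg i → t ∈ ((barTerm C n).obj X Z).deg j →
      φ (bcons C n X f t) = ψ (bcons C n X f t)) : φ = ψ :=
  free_ext h

lemma delta_zero_bcons {X : C.Obj} (f : C.bk Y X) (t : (barTerm C 0).obj X Z) :
    (delta C 0).1 Y Z (bcons C 0 X f t) = (barTerm C 0).lact f t :=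
  act_fmk (one C) f t

lemma delta_succ_bcons {X : C.Obj} (f : C.bk Y X) (t : (barTerm C (n + 1)).obj X Z) :
    (delta C (n + 1)).1 Y Z (bcons C (n + 1) X f t) =
      (barTerm C (n + 1)).lact f t - bcons C n X f ((delta C n).1 X Z t) :=
  step_fmk (delta C n) f t

lemma bnil_mem_deg (Z : C.Obj) : bnil C Z ∈ ((barTerm C 0).obj Z Z).deg 0 := C.id_deg Z

@[simp] lemma barTerm_d_bnil (Z : C.Obj) : ((barTerm C 0).obj Z Z).d (bnil C Z) = 0 := C.d_id Z

lemma barTerm_lact_bnil (t : (barTerm C 0).obj Y Z) : (barTerm C 0).lact t (bnil C Z) = t :=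
  C.comp_id t

@[simp] lemma barTerm_d_one_bcons (r : ℕ) (x : (barTerm C r).obj Y Z) :
    ((barTerm C (r + 1)).obj Y Z).d (bcons C r Y (C.id Y) x) =
      bcons C r Y (C.id Y) (((barTerm C r).obj Y Z).d x) := by
  rw [barTerm_d_bcons (C.id_deg Y)]
  simp [C.d_id]

variable (C)

/-- The augmented bar complex. -/
abbrev aug : Bimod C C := tot (barTerm C) (delta C) (delta_d C) (delta_delta C)

/-- The augmented bar complex is the cone of the augmentation of the bar complex. -/
def barCone : ConeData (one C) (bar C) (aug C) :=
  totCone (barTerm C) (delta C) (delta_d C) (delta_delta C)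

/-- The contraction `x ↦ 1 ⊗ x` of the augmented bar complex, as a complex of right modules. -/
lemma contractible_aug_right : Contractible False True (aug C) := by
  refine ⟨fun Y Z => tout fun r => tin (delta_d C) (delta_delta C) (r + 1) Y Z ∘ₗ
    bcons C r Y (C.id Y), isMap_tot ?_ False.elim ?_, fun Y Z t => ?_⟩
  · intro r Y Z i x hx
    rw [tout_tin]
    exact tin_mem_deg (bcons_mem_deg (C.id_deg Y) hx (zero_add _)) (by rw [succ_nsmul]; abel)
  · intro _ r Y Z Z' i x g hx
    simp
  · refine LinearMap.congr_fun
      (f := DGMod.d _ ∘ₗ (tout fun r => tin (delta_d C) (delta_delta C) (r + 1) Y Z ∘ₗ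
        bcons C r Y (C.id Y)) + (tout fun r => tin (delta_d C) (delta_delta C) (r + 1) Y Z ∘ₗ
        bcons C r Y (C.id Y)) ∘ₗ DGMod.d _) (g := LinearMap.id) (tot_ext ?_) t
    -- The identity `δ(1 ⊗ x) = x - 1 ⊗ δ x` leaves `x` after the second term cancels against the
    -- homotopy applied to `δ x`; in position `0` it is just `δ(1 ⊗ x) = x`. The internal
    -- differentials cancel because neighbouring shifts have opposite signs.
    rintro (_ | r) i x -
    · simp [tot_d_zero, tot_d_succ, delta_zero_bcons, Bimod.id_lact]
    · simp only [LinearMap.add_apply, LinearMap.comp_apply, tout_tin, tot_d_succ, map_add,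
        map_smul, barTerm_d_one_bcons, delta_succ_bcons, Bimod.id_lact, map_sub,
        LinearMap.id_apply]
      rw [sgn_succ_nsmul (r + 1), sgn_ι_ι]
      module

/-- The map `f_0 ⊗ ⋯ ⊗ f_n ↦ f_0 ⊗ ⋯ ⊗ f_n ⊗ 1`. -/
def lastOne : ∀ n, Fam (barTerm C n) (barTerm C (n + 1))
  | 0 => fun _ Z => (bcons C 0 Z).flip (bnil C Z)
  | n + 1 => fun _ Z => bdesc C n fun X => (bcons C (n + 1) X).compl₂ (lastOne n X Z)

variable {C}

@[simp] lemma lastOne_succ_bcons (n : ℕ) {X : C.Obj} (f : C.bk Y X)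
    (t : (barTerm C n).obj X Z) : lastOne C (n + 1) Y Z (bcons C n X f t) =
      bcons C (n + 1) X f (lastOne C n X Z t) :=
  bdesc_bcons ..

lemma lastOne_deg : ∀ (n : ℕ) {Y Z : C.Obj} {i : Γ} {t : (barTerm C n).obj Y Z},
    t ∈ ((barTerm C n).obj Y Z).deg i → lastOne C n Y Z t ∈ ((barTerm C (n + 1)).obj Y Z).deg i
  | 0, _, Z, _, _, ht => bcons_mem_deg ht (bnil_mem_deg Z) (add_zero _)
  | n + 1, Y, Z, i, t, ht => by
    refine barTerm_mem_le (S := (((barTerm C (n + 2)).obj Y Z).deg i).comap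
      (lastOne C (n + 1) Y Z)) ?_ ht
    rintro X i j f m hf hm rfl
    rw [Submodule.mem_comap, lastOne_succ_bcons]
    exact bcons_mem_deg hf (lastOne_deg n hm) rfl

lemma lastOne_lact : ∀ (n : ℕ) {Y' Y Z : C.Obj} (f : C.bk Y' Y) (t : (barTerm C n).obj Y Z),
    lastOne C n Y' Z ((barTerm C n).lact f t) = (barTerm C (n + 1)).lact f (lastOne C n Y Z t)
  | 0, _, _, Z, f, t => (barTerm_lact_bcons f t (bnil C Z)).symm
  | n + 1, Y', Y, Z, f, t => by
    refine LinearMap.congr_fun (f := lastOne C (n + 1) Y' Z ∘ₗ (barTerm C (n + 1)).lact f)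
      (g := (barTerm C (n + 2)).lact f ∘ₗ lastOne C (n + 1) Y Z) (barTerm_ext ?_) t
    intro X i j g m _ _
    simp

lemma lastOne_d : ∀ (n : ℕ) {Y Z : C.Obj} (t : (barTerm C n).obj Y Z),
    lastOne C n Y Z (((barTerm C n).obj Y Z).d t) =
      ((barTerm C (n + 1)).obj Y Z).d (lastOne C n Y Z t)
  | 0, Y, Z, t => by
    refine LinearMap.congr_fun (f := lastOne C 0 Y Z ∘ₗ ((barTerm C 0).obj Y Z).d)
      (g := ((barTerm C 1).obj Y Z).d ∘ₗ lastOne C 0 Y Z) (DGMod.ext_hom fun i f hf => ?_) t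
    have h := barTerm_d_bcons hf (bnil C Z)
    rw [barTerm_d_bnil, map_zero, smul_zero, add_zero] at h
    exact h.symm
  | n + 1, Y, Z, t => by
    refine LinearMap.congr_fun (f := lastOne C (n + 1) Y Z ∘ₗ ((barTerm C (n + 1)).obj Y Z).d)
      (g := ((barTerm C (n + 2)).obj Y Z).d ∘ₗ lastOne C (n + 1) Y Z) (barTerm_ext ?_) t
    intro X i j f m hf _
    simp [barTerm_d_bcons hf, lastOne_d n]

lemma delta_lastOne_zero (t : (barTerm C 0).obj Y Z) :
    (delta C 0).1 Y Z (lastOne C 0 Y Z t) = t :=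
  (delta_zero_bcons t (bnil C Z)).trans (barTerm_lact_bnil t)

/-- Appending `1` commutes with every face except the new last one, which multiplies the final
factor by `1` and carries the sign `(-1)^(n+1)`. As `δ` is defined by splitting off the first
factor, the proof is an induction on `n` using the left linearity of `lastOne`. -/
lemma delta_lastOne_succ : ∀ (n : ℕ) {Y Z : C.Obj} (t : (barTerm C (n + 1)).obj Y Z),
    (delta C (n + 1)).1 Y Z (lastOne C (n + 1) Y Z t) =
      lastOne C n Y Z ((delta C n).1 Y Z t) + (-1 : k) ^ (n + 1) • t
  | 0, Y, Z, t => by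
    refine LinearMap.congr_fun (f := (delta C 1).1 Y Z ∘ₗ lastOne C 1 Y Z)
      (g := lastOne C 0 Y Z ∘ₗ (delta C 0).1 Y Z + (-1 : k) ^ (0 + 1) • LinearMap.id)
      (barTerm_ext ?_) t
    intro X i j f m _ _
    simp only [LinearMap.comp_apply, lastOne_succ_bcons, delta_succ_bcons, delta_lastOne_zero,
      LinearMap.add_apply, delta_zero_bcons, lastOne_lact, LinearMap.smul_apply,
      LinearMap.id_apply]
    module
  | n + 1, Y, Z, t => by
    refine LinearMap.congr_fun (f := (delta C (n + 2)).1 Y Z ∘ₗ lastOne C (n + 2) Y Z)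
      (g := lastOne C (n + 1) Y Z ∘ₗ (delta C (n + 1)).1 Y Z +
        (-1 : k) ^ (n + 1 + 1) • LinearMap.id) (barTerm_ext ?_) t
    intro X i j f m _ _
    simp only [LinearMap.comp_apply, lastOne_succ_bcons, delta_succ_bcons, delta_lastOne_succ n,
      LinearMap.add_apply, lastOne_lact, LinearMap.smul_apply, map_sub, map_add, map_smul,
      LinearMap.id_apply]
    rw [pow_succ _ (n + 1)]
    module

variable (C)

/-- The augmented bar complex is contractible as a complex of left modules. -/
lemma contractible_aug_left : Contractible True False (aug C) := by
  -- The factor `(-1)^r` cancels the sign of the last face on `x ⊗ 1`, and makes the remaining faces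
  -- cancel between `d h` and `h d`.
  refine ⟨fun Y Z => tout fun r => (-1 : k) ^ r • tin (delta_d C) (delta_delta C) (r + 1) Y Z ∘ₗ
    lastOne C r Y Z, isMap_tot ?_ ?_ False.elim, fun Y Z t => ?_⟩
  · intro r Y Z i x hx
    rw [tout_tin]
    exact Submodule.smul_mem _ _ (tin_mem_deg (lastOne_deg r hx) (by rw [succ_nsmul]; abel))
  · intro _ r Y' Y Z i p f x hf hx
    rw [tout_tin, tout_tin]
    simp only [LinearMap.smul_apply, LinearMap.comp_apply, lastOne_lact, tin_lact hf, map_smul,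
      sgn_succ_nsmul, sgn_neg_left]
    rw [smul_comm]
  · refine LinearMap.congr_fun
      (f := DGMod.d _ ∘ₗ (tout fun r => (-1 : k) ^ r •
        tin (delta_d C) (delta_delta C) (r + 1) Y Z ∘ₗ lastOne C r Y Z) +
        (tout fun r => (-1 : k) ^ r •
          tin (delta_d C) (delta_delta C) (r + 1) Y Z ∘ₗ lastOne C r Y Z) ∘ₗ DGMod.d _)
      (g := LinearMap.id) (tot_ext ?_) t
    rintro (_ | r) i x -
    · simp only [LinearMap.add_apply, LinearMap.comp_apply, tout_tin, tot_d_zero, tot_d_succ,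
        map_smul, lastOne_d, delta_lastOne_zero, LinearMap.id_apply, LinearMap.smul_apply]
      simp
    · have h : (-1 : k) ^ (r + 1) * (-1) ^ (r + 1) = 1 := by
        rw [← mul_pow, neg_one_mul, neg_neg, one_pow]
      simp only [LinearMap.add_apply, LinearMap.comp_apply, tout_tin, tot_d_succ, map_add,
        map_smul, lastOne_d, delta_lastOne_succ, LinearMap.id_apply, LinearMap.smul_apply,
        smul_add, smul_smul, h, one_smul]
      rw [sgn_succ_nsmul (r + 1), sgn_ι_ι, pow_succ _ r]
      module

end Aug

end Bimod

end DG

end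
noncomputable section

namespace DG

variable {k : Type u} [CommRing k] {Γ : Type w} [AddCommGroup Γ] {G : GradingData Γ}

namespace Bimod

variable {A C D E : DGCat.{u, w} k G}

/-! ### Contractions of filtered bimodules -/

/-- Let `M` be assembled from bimodules `q^{-rι} S_r`, with differentials which differ from those
of the `S_r` by maps `S_{r+1} → S_r`. Then contractions of the `S_r` induce a contraction
of `M`. -/
lemma contractible_of_layers {a b : Prop} {M : Bimod C D} {S : ℕ → Bimod C D}
    {B : ∀ r, Fam (S r) M} (hB : ∀ r, IsMap True True (B r) (-(r • G.ι)))
    {Δ : ∀ r, Fam (S (r + 1)) (S r)}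
    (d_zero : ∀ X Y z, (M.obj X Y).d (B 0 X Y z) = B 0 X Y (((S 0).obj X Y).d z))
    (d_succ : ∀ r X Y z, (M.obj X Y).d (B (r + 1) X Y z) =
      G.sgn k ((r + 1) • G.ι) G.ι • B (r + 1) X Y (((S (r + 1)).obj X Y).d z) +
        B r X Y (Δ r X Y z))
    (span : ∀ X Y n (U : Submodule k (M.obj X Y)), (∀ r i z, z ∈ ((S r).obj X Y).deg i →
      i - r • G.ι = n → B r X Y z ∈ U) → (M.obj X Y).deg n ≤ U)
    {h : ∀ r, Fam (S r) (S r)} (hh : ∀ r, IsContraction a b (h r)) (h₀ : Fam M M)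
    (e : ∀ r X Y z, h₀ X Y (B r X Y z) = G.sgn k (r • G.ι) G.ι • B r X Y (h r X Y z)) :
    Contractible a b M := by
  -- Applied to an equalizer, the spanning hypothesis says that linear maps out of `M` are
  -- determined by the layers.
  have ext {Q : Type u} [AddCommGroup Q] [Module k Q] (X Y) (φ ψ : M.obj X Y →ₗ[k] Q)
      (H : ∀ r z, φ (B r X Y z) = ψ (B r X Y z)) : φ = ψ :=
    DGMod.ext_hom fun n => span X Y n (LinearMap.eqLocus φ ψ) fun r i z _ _ => H r z
  have hm : IsMap a b h₀ (-G.ι) := by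
    refine ⟨fun X Y n m hm => ?_, fun ha X' X Y i f hf m => ?_, fun hb X Y Y' m g => ?_⟩
    · refine span X Y n (((M.obj X Y).deg (n + -G.ι)).comap (h₀ X Y)) ?_ hm
      rintro r i z hz rfl
      rw [Submodule.mem_comap, e]
      have := (hB r).deg _ _ _ _ ((hh r).deg _ _ _ _ hz)
      rw [show i - r • G.ι + -G.ι = i + -G.ι + -(r • G.ι) by abel]
      exact Submodule.smul_mem _ _ this
    · refine LinearMap.congr_fun (f := h₀ X' Y ∘ₗ M.lact f)
        (g := G.sgn k (-G.ι) i • (M.lact f ∘ₗ h₀ X Y)) (ext _ _ _ _ fun r z => ?_) m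
      have h1 : M.lact f (B r X Y z) = G.sgn k (r • G.ι) i • B r X' Y ((S r).lact f z) := by
        rw [(hB r).left trivial _ _ _ _ f hf, sgn_neg_left, smul_smul, sgn_mul_self, one_smul]
      rw [LinearMap.comp_apply, LinearMap.smul_apply, LinearMap.comp_apply, h1, map_smul, e, e,
        (hh r).left ha _ _ _ _ f hf, map_smul, map_smul, (hB r).left trivial _ _ _ _ f hf,
        smul_smul, smul_smul, smul_smul, smul_smul, sgn_neg_left G k (r • G.ι)]
      congr 1
      have := sgn_mul_self G k (r • G.ι) i
      linear_combination (G.sgn k (r • G.ι) G.ι * G.sgn k (-G.ι) i) * this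
    · refine LinearMap.congr_fun (f := h₀ X Y' ∘ₗ M.ract.flip g)
        (g := M.ract.flip g ∘ₗ h₀ X Y) (ext _ _ _ _ fun r z => ?_) m
      simp only [LinearMap.comp_apply, LinearMap.flip_apply, ← (hB r).right trivial X Y Y', e,
        (hh r).right hb X Y Y', map_smul]
  -- The layerwise homotopy `h₀` ignores the maps `Δ`. Its error `ν = 1 - (d h₀ + h₀ d)` therefore
  -- vanishes on layer `0` and sends layer `r + 1` into layer `r`; the sign in `h₀` cancels that of
  -- the shifted differential.
  refine Contractible.of_nilpotent hm
    (fun X Y => LinearMap.id - ((M.obj X Y).d ∘ₗ h₀ X Y + h₀ X Y ∘ₗ (M.obj X Y).d))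
    (fun X Y m => by simp) fun X Y m => ?_
  set ν : Module.End k (M.obj X Y) :=
    LinearMap.id - ((M.obj X Y).d ∘ₗ h₀ X Y + h₀ X Y ∘ₗ (M.obj X Y).d) with hν
  have hν0 (z) : ν (B 0 X Y z) = 0 := by
    simp only [hν, LinearMap.sub_apply, LinearMap.add_apply, LinearMap.comp_apply,
      LinearMap.id_apply, d_zero, e, zero_smul, sgn_zero_left, one_smul, ← map_add, (hh 0).eq,
      sub_self]
  have hνs (r z) : ∃ y, ν (B (r + 1) X Y z) = B r X Y y := by
    -- The terms within layer `r + 1` add up to the identity by the contraction equation. What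
    -- survives is `Δ h` and `h Δ`, with their shift signs.
    refine ⟨-(G.sgn k ((r + 1) • G.ι) G.ι • Δ r X Y (h (r + 1) X Y z) +
      G.sgn k (r • G.ι) G.ι • h r X Y (Δ r X Y z)), ?_⟩
    have h1 := congrArg (B (r + 1) X Y) ((hh (r + 1)).eq X Y z)
    rw [map_add] at h1
    simp only [hν, LinearMap.sub_apply, LinearMap.add_apply, LinearMap.comp_apply,
      LinearMap.id_apply, d_succ, e, map_add, map_smul, map_neg, smul_add, smul_smul,
      sgn_mul_self, one_smul]
    nth_rewrite 1 [← h1]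
    abel
  have hnil : ∀ r z, (ν ^ (r + 1)) (B r X Y z) = 0 := by
    intro r
    induction r with
    | zero => intro z; simp [hν0]
    | succ r ih =>
      intro z
      obtain ⟨y, hy⟩ := hνs r z
      rw [pow_succ, Module.End.mul_apply, hy, ih]
  -- The vectors killed by a power of `ν` form a submodule, the generalized eigenspace for `0`, so
  -- local nilpotency need only be checked on the layers.
  have hmem : ∀ x, x ∈ ν.maxGenEigenspace 0 ↔ ∃ n, (ν ^ n) x = 0 := fun x => by
    simp [Module.End.mem_maxGenEigenspace]
  rw [← hmem]
  have : (⊤ : Submodule k (M.obj X Y)) ≤ ν.maxGenEigenspace 0 := by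
    rw [← DGMod.iSup_deg]
    exact iSup_le fun n => span X Y n _ fun r i z _ _ => (hmem _).2 ⟨r + 1, hnil r z⟩
  exact this trivial

/-! ### Tensor products with total bimodules -/

section TotTensor

variable {a b : Prop}

lemma isMap_tin {T : ℕ → Bimod C D} {δ : ∀ r, homSub (T (r + 1)) (T r) 0}
    {hd : ∀ (r : ℕ) Y Z (t : (T (r + 1)).obj Y Z),
      (δ r).1 Y Z (((T (r + 1)).obj Y Z).d t) = ((T r).obj Y Z).d ((δ r).1 Y Z t)}
    {hδ : ∀ (r : ℕ) Y Z (t : (T (r + 2)).obj Y Z), (δ r).1 Y Z ((δ (r + 1)).1 Y Z t) = 0}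
    (r : ℕ) : IsMap True True (tin hd hδ r) (-(r • G.ι)) := by
  refine ⟨fun X Y i m hm => tin_mem_deg hm (by abel), fun _ X' X Y i f hf m => ?_,
    fun _ X Y Y' m g => (tot_ract_tin m g).symm⟩
  rw [tin_lact hf, sgn_neg_left]

/-- If all `T_r ⊗ K` are contractible, then so is the tensor product of the total bimodule
with `K`. -/
lemma contractible_tot_tensor {T : ℕ → Bimod A C} {δ : ∀ r, homSub (T (r + 1)) (T r) 0}
    {hd : ∀ (r : ℕ) Y Z (t : (T (r + 1)).obj Y Z),
      (δ r).1 Y Z (((T (r + 1)).obj Y Z).d t) = ((T r).obj Y Z).d ((δ r).1 Y Z t)}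
    {hδ : ∀ (r : ℕ) Y Z (t : (T (r + 2)).obj Y Z), (δ r).1 Y Z ((δ (r + 1)).1 Y Z t) = 0}
    {K : Bimod C D} (H : ∀ r, Contractible a b ((T r).tensor K)) :
    Contractible a b ((tot T δ hd hδ).tensor K) := by
  choose h hh using H
  let B (r : ℕ) : Fam ((T r).tensor K) ((tot T δ hd hδ).tensor K) :=
    rwh (tin hd hδ r) ((isMap_tin r).right trivial) K
  let Δ (r : ℕ) : Fam ((T (r + 1)).tensor K) ((T r).tensor K) :=
    rwh (δ r).1 (δ r).2.2.2 K
  have hB (r : ℕ) : IsMap True True (B r) (-(r • G.ι)) := (isMap_tin r).rwh _ K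
  obtain ⟨h₀, hh₀⟩ : ∃ h₀ : Fam ((tot T δ hd hδ).tensor K) ((tot T δ hd hδ).tensor K),
      ∀ r X Y Z (m : (T r).obj X Y) (n : K.obj Y Z),
        h₀ X Z (tens (tot T δ hd hδ) K Y (tin hd hδ r X Y m) n) =
          G.sgn k (r • G.ι) G.ι • B r X Z (h r X Z (tens (T r) K Y m n)) := by
    -- The formula is balanced because each `h r` is already defined on the tensor product over `C`.
    -- No compatibility of the `h r` with `δ` is required.
    refine ⟨fun X Z => tdesc (fun Y => tout fun r => G.sgn k (r • G.ι) G.ι •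
      (tens (T r) K Y).compr₂ (B r X Z ∘ₗ h r X Z)) ?_, fun r X Y Z m n => by simp⟩
    intro Y Y' p q l t f κ _ hf _
    refine LinearMap.congr_fun (f := (LinearMap.flip (tout fun r => G.sgn k (r • G.ι) G.ι •
      (tens (T r) K Y').compr₂ (B r X Z ∘ₗ h r X Z)) κ) ∘ₗ (tot T δ hd hδ).ract.flip f)
      (g := LinearMap.flip (tout fun r => G.sgn k (r • G.ι) G.ι •
      (tens (T r) K Y).compr₂ (B r X Z ∘ₗ h r X Z)) (K.lact f κ)) (tot_ext fun r i x _ => ?_) t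
    simp [tens_ract]
  refine contractible_of_layers (S := fun r => (T r).tensor K) (B := B) (Δ := Δ) hB
    (fun X Z t => ?_) (fun r X Z (t : ((T (r + 1)).tensor K).obj X Z) => ?_)
    (fun X Z n U hU => ?_) hh
    h₀ (fun r X Z t => ?_)
  · refine LinearMap.congr_fun (f := DGMod.d _ ∘ₗ B 0 X Z) (g := B 0 X Z ∘ₗ DGMod.d _)
      (tensor_ext fun Y i j m n hm hn => ?_) t
    simp [B, tensor_d_tens hm, tensor_d_tens (tin_mem_deg hm rfl), tot_d_zero]
  · refine LinearMap.congr_fun (f := DGMod.d _ ∘ₗ B (r + 1) X Z)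
      (g := G.sgn k ((r + 1) • G.ι) G.ι • (B (r + 1) X Z ∘ₗ DGMod.d _) + B r X Z ∘ₗ Δ r X Z)
      (tensor_ext fun Y i j m n hm hn => ?_) t
    have hs : G.sgn k G.ι (i - (r + 1) • G.ι) =
        G.sgn k ((r + 1) • G.ι) G.ι * G.sgn k G.ι i := by
      rw [sub_eq_add_neg, sgn_add_right, sgn_symm G k G.ι (-_), sgn_neg_left, mul_comm]
    have hBΔ : B r X Z (Δ r X Z (tens (T (r + 1)) K Y m n)) =
        tens (tot T δ hd hδ) K Y (tin hd hδ r X Y ((δ r).1 X Y m)) n :=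
      (congrArg (B r X Z) (rwh_tens ..)).trans (rwh_tens ..)
    rw [LinearMap.add_apply, LinearMap.comp_apply (B r X Z), hBΔ]
    simp only [B, LinearMap.comp_apply, rwh_tens, tensor_d_tens hm,
      tensor_d_tens (tin_mem_deg hm rfl), tot_d_succ, map_add, map_smul, LinearMap.add_apply,
      LinearMap.smul_apply, hs, smul_add, smul_smul]
    abel
  · refine tensor_mem_le fun Y i j t κ ht hκ hij => ?_
    refine tot_mem_le (S := U.comap ((tens _ K Y).flip κ)) ?_ ht
    rintro r p x hx rfl
    have := hU r (p + j) (tens (T r) K Y x κ) (tens_mem_deg hx hκ rfl) (by rw [← hij]; abel)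
    simpa [B] using this
  · refine LinearMap.congr_fun (f := h₀ X Z ∘ₗ B r X Z)
      (g := G.sgn k (r • G.ι) G.ι • (B r X Z ∘ₗ h r X Z))
      (tensor_ext fun Y i j m n hm hn => ?_) t
    simp [B, hh₀]

/-- If all `K ⊗ T_r` are contractible, then so is the tensor product of `K` with the total
bimodule. -/
lemma contractible_tensor_tot {T : ℕ → Bimod C D} {δ : ∀ r, homSub (T (r + 1)) (T r) 0}
    {hd : ∀ (r : ℕ) Y Z (t : (T (r + 1)).obj Y Z),
      (δ r).1 Y Z (((T (r + 1)).obj Y Z).d t) = ((T r).obj Y Z).d ((δ r).1 Y Z t)}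
    {hδ : ∀ (r : ℕ) Y Z (t : (T (r + 2)).obj Y Z), (δ r).1 Y Z ((δ (r + 1)).1 Y Z t) = 0}
    {K : Bimod A C} (H : ∀ r, Contractible a b (K.tensor (T r))) :
    Contractible a b (K.tensor (tot T δ hd hδ)) := by
  choose h hh using H
  let B (r : ℕ) : Fam (K.tensor (T r)) (K.tensor (tot T δ hd hδ)) :=
    lwh (-(r • G.ι)) (tin hd hδ r) ((isMap_tin r).left trivial) K
  let Δ (r : ℕ) : Fam (K.tensor (T (r + 1))) (K.tensor (T r)) :=
    lwh 0 (δ r).1 (δ r).2.2.1 K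
  have hB (r : ℕ) : IsMap True True (B r) (-(r • G.ι)) := (isMap_tin r).lwh _ K
  -- The inclusion `1 ⊗ tin` has degree `-rι` and carries the sign `(-1)^⟨rι,|κ|⟩`. The sign
  -- operator undoes it, so that `h₀ B_r` equals `B_r h_r` up to the shift sign alone.
  let Ψ (r : ℕ) (X : A.Obj) (Y : C.Obj) (Z : D.Obj) :
      K.obj X Y →ₗ[k] (T r).obj Y Z →ₗ[k] (K.tensor (tot T δ hd hδ)).obj X Z :=
    ((tens K (T r) Y).compl₁₂ ((K.obj X Y).sOp (r • G.ι)) LinearMap.id).compr₂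
      (G.sgn k (r • G.ι) G.ι • (B r X Z ∘ₗ h r X Z))
  have hΨ {r : ℕ} {X : A.Obj} {Y : C.Obj} {Z : D.Obj} {i : Γ} {κ : K.obj X Y}
      (hκ : κ ∈ (K.obj X Y).deg i) (x : (T r).obj Y Z) : Ψ r X Y Z κ x =
      (G.sgn k (r • G.ι) G.ι * G.sgn k (r • G.ι) i) • B r X Z (h r X Z (tens K (T r) Y κ x)) := by
    simp [Ψ, DGMod.sOp_apply _ hκ, smul_smul, mul_comm]
  obtain ⟨h₀, hh₀⟩ : ∃ h₀ : Fam (K.tensor (tot T δ hd hδ)) (K.tensor (tot T δ hd hδ)),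
      ∀ r X Y Z i (m : K.obj X Y) (n : (T r).obj Y Z), m ∈ (K.obj X Y).deg i →
        h₀ X Z (tens K (tot T δ hd hδ) Y m (tin hd hδ r Y Z n)) =
          (G.sgn k (r • G.ι) G.ι * G.sgn k (r • G.ι) i) •
            B r X Z (h r X Z (tens K (T r) Y m n)) := by
    refine ⟨fun X Z => tdesc (fun Y => (tout fun r => (Ψ r X Y Z).flip).flip) ?_,
      fun r X Y Z i m n hm => by
        rw [tdesc_tens, LinearMap.flip_apply, tout_tin, LinearMap.flip_apply, hΨ hm]⟩
    intro Y Y' p q l κ f t hκ hf _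
    refine LinearMap.congr_fun
      (f := LinearMap.flip (tout fun r => (Ψ r X Y' Z).flip) (K.ract κ f))
      (g := LinearMap.flip (tout fun r => (Ψ r X Y Z).flip) κ ∘ₗ (tot T δ hd hδ).lact f)
      (tot_ext fun r i x _ => ?_) t
    simp only [LinearMap.comp_apply, LinearMap.flip_apply, tout_tin, tot_lact_tin hf, map_smul,
      hΨ hκ, hΨ (K.ract_deg hκ hf), tens_ract, sgn_add_right, smul_smul]
    congr 1
    ring
  refine contractible_of_layers (S := fun r => K.tensor (T r)) (B := B) (Δ := Δ) hB
    (fun X Z t => ?_) (fun r X Z (t : (K.tensor (T (r + 1))).obj X Z) => ?_)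
    (fun X Z n U hU => ?_) hh
    h₀ (fun r X Z t => ?_)
  · refine LinearMap.congr_fun (f := DGMod.d _ ∘ₗ B 0 X Z) (g := B 0 X Z ∘ₗ DGMod.d _)
      (tensor_ext fun Y i j m n hm hn => ?_) t
    simp [B, tensor_d_tens hm, lwh_tens _ _ hm, lwh_tens _ _ ((K.obj X Y).d_deg hm), tot_d_zero]
  · refine LinearMap.congr_fun (f := DGMod.d _ ∘ₗ B (r + 1) X Z)
      (g := G.sgn k ((r + 1) • G.ι) G.ι • (B (r + 1) X Z ∘ₗ DGMod.d _) + B r X Z ∘ₗ Δ r X Z)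
      (tensor_ext fun Y i j m n hm hn => ?_) t
    have hs := sgn_mul_self G k G.ι i
    have hs' := sgn_mul_self G k ((r + 1) • G.ι) G.ι
    have hBΔ : B r X Z (Δ r X Z (tens K (T (r + 1)) Y m n)) = G.sgn k (r • G.ι) i •
        tens K (tot T δ hd hδ) Y m (tin hd hδ r Y Z ((δ r).1 Y Z n)) := by
      refine (congrArg (B r X Z) (lwh_zero_tens ..)).trans ((lwh_tens _ _ hm _).trans ?_)
      rw [sgn_neg_left]
    rw [LinearMap.add_apply, LinearMap.comp_apply (B r X Z), hBΔ]
    simp only [B, LinearMap.comp_apply, lwh_tens _ _ hm, tensor_d_tens hm,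
      lwh_tens _ _ ((K.obj X Y).d_deg hm), tot_d_succ, map_add, map_smul,
      LinearMap.smul_apply, sgn_neg_left, sgn_add_right, smul_add, smul_smul]
    have h1 : G.sgn k ((r + 1) • G.ι) i * G.sgn k G.ι i = G.sgn k (r • G.ι) i := by
      rw [succ_nsmul, sgn_add_left, mul_assoc, hs, mul_one]
    have h2 : G.sgn k ((r + 1) • G.ι) G.ι * (G.sgn k ((r + 1) • G.ι) i *
        G.sgn k ((r + 1) • G.ι) G.ι) = G.sgn k ((r + 1) • G.ι) i := by
      rw [mul_left_comm, hs', mul_one]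
    rw [h2, ← h1]
    module
  · refine tensor_mem_le fun Y i j κ t hκ ht hij => ?_
    refine tot_mem_le (S := U.comap (tens K _ Y κ)) ?_ ht
    rintro r p x hx rfl
    have := hU r (i + p) (tens K (T r) Y κ x) (tens_mem_deg hκ hx rfl) (by rw [← hij]; abel)
    have := U.smul_mem (G.sgn k (r • G.ι) i) this
    simpa [B, lwh_tens _ _ hκ, sgn_neg_left, smul_smul, sgn_mul_self] using this
  · refine LinearMap.congr_fun (f := h₀ X Z ∘ₗ B r X Z)
      (g := G.sgn k (r • G.ι) G.ι • (B r X Z ∘ₗ h r X Z))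
      (tensor_ext fun Y i j m n hm hn => ?_) t
    rw [LinearMap.comp_apply]
    simp only [B, lwh_tens _ _ hm, map_smul]
    rw [hh₀ _ _ _ _ _ _ _ hm, smul_smul, sgn_neg_left, mul_left_comm, sgn_mul_self, mul_one]
    rfl

end TotTensor

/-! ### Free bimodules -/

section FreeTensor

variable {N : Bimod A C} {K : Bimod C D} {a b : Prop}

/-- A contraction of `N` induces a contraction of the free bimodule on `N`. -/
lemma Contractible.free {N : Bimod C D} (H : Contractible a b N) : Contractible True b N.free := by
  obtain ⟨h, hh⟩ := H
  -- The contraction is `f ⊗ n ↦ (-1)^⟨ι,|f|⟩ f ⊗ h(n)`. The left action only touches `f`, so left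
  -- linearity does not depend on `h`.
  have key {X X' : C.Obj} {Y : D.Obj} {i : Γ} {f : C.bk X X'} (hf : f ∈ (C.bk X X').deg i)
      (n : N.obj X' Y) : flift (fun W => (N.fmk W).compl₁₂ ((C.bk X W).sOp G.ι) (h W Y))
      (N.fmk X' f n) = G.sgn k G.ι i • N.fmk X' f (h X' Y n) := by
    simp [DGMod.sOp_apply _ hf]
  refine ⟨fun X Y => flift fun W => (N.fmk W).compl₁₂ ((C.bk X W).sOp G.ι) (h W Y),
    ⟨fun X Y l t ht => ?_, fun _ X' X Y p g hg t => ?_, fun hb X Y Y' t g => ?_⟩, fun X Y t => ?_⟩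
  · refine free_mem_le (S := ((N.free.obj X Y).deg (l + -G.ι)).comap
      (flift fun W => (N.fmk W).compl₁₂ ((C.bk X W).sOp G.ι) (h W Y))) ?_ ht
    rintro W i j f n hf hn rfl
    rw [Submodule.mem_comap, key hf]
    exact Submodule.smul_mem _ _ (fmk_mem_deg hf (hh.deg _ _ _ _ hn) (by abel))
  · refine LinearMap.congr_fun
      (f := (flift fun W => (N.fmk W).compl₁₂ ((C.bk X' W).sOp G.ι) (h W Y)) ∘ₗ N.free.lact g)
      (g := G.sgn k (-G.ι) p • (N.free.lact g ∘ₗ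
        flift fun W => (N.fmk W).compl₁₂ ((C.bk X W).sOp G.ι) (h W Y))) (free_ext ?_) t
    intro W i j f n hf hn
    rw [LinearMap.comp_apply, free_lact_fmk, key (C.comp_deg hg hf), LinearMap.smul_apply,
      LinearMap.comp_apply, key hf, map_smul, free_lact_fmk, sgn_add_right, sgn_neg_left, mul_smul]
  · refine LinearMap.congr_fun
      (f := (flift fun W => (N.fmk W).compl₁₂ ((C.bk X W).sOp G.ι) (h W Y')) ∘ₗ
        N.free.ract.flip g)
      (g := N.free.ract.flip g ∘ₗ
        flift fun W => (N.fmk W).compl₁₂ ((C.bk X W).sOp G.ι) (h W Y)) (free_ext ?_) t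
    intro W i j f n hf hn
    simp only [LinearMap.comp_apply, LinearMap.flip_apply, free_ract_fmk, key hf,
      hh.right hb W Y Y', map_smul]
  · refine LinearMap.congr_fun (f := DGMod.d _ ∘ₗ
        (flift fun W => (N.fmk W).compl₁₂ ((C.bk X W).sOp G.ι) (h W Y)) +
        (flift fun W => (N.fmk W).compl₁₂ ((C.bk X W).sOp G.ι) (h W Y)) ∘ₗ DGMod.d _)
      (g := LinearMap.id) (free_ext ?_) t
    intro W i j f n hf hn
    have h1 := congrArg (N.fmk W f) (hh.eq W Y n)
    rw [map_add] at h1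
    simp only [LinearMap.add_apply, LinearMap.comp_apply, key hf, free_d_fmk hf, map_add,
      map_smul, key ((C.bk X W).d_deg hf), sgn_add_right, sgn_ι_ι, smul_add, smul_smul,
      sgn_mul_self, one_smul, LinearMap.id_apply]
    rw [← h1]
    module

variable (N : Bimod C C) (K : Bimod C D)

/-- The bilinear map `(n ⊗ κ, f) ↦ (f ⊗ n) ⊗ κ`. -/
def freeTensorInvAux (Y X : C.Obj) (Z : D.Obj) :
    (N.tensor K).obj X Z →ₗ[k] C.bk Y X →ₗ[k] (N.free.tensor K).obj Y Z :=
  tdesc (fun W => LinearMap.mk₂ k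
      (fun n x => (tens N.free K W).flip x ∘ₗ (N.fmk X).flip n)
      (fun m m' n => by ext; simp) (fun c m n => by ext; simp)
      (fun m n n' => by ext; simp) (fun c m n => by ext; simp))
    (fun Z Z' p q l n g x _ _ _ => by ext m; simp [← tens_ract])

@[simp] lemma freeTensorInvAux_tens {Y X W : C.Obj} {Z : D.Obj} (f : C.bk Y X) (n : N.obj X W)
    (x : K.obj W Z) : freeTensorInvAux N K Y X Z (tens N K W n x) f =
      tens N.free K W (N.fmk X f n) x := by
  simp [freeTensorInvAux]

/-- The map `f ⊗ (n ⊗ κ) ↦ (f ⊗ n) ⊗ κ`. -/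
def freeTensorInv : Fam (N.tensor K).free (N.free.tensor K) := fun Y Z =>
  flift fun X => (freeTensorInvAux N K Y X Z).flip

@[simp] lemma freeTensorInv_fmk {Y X W : C.Obj} {Z : D.Obj} (f : C.bk Y X) (n : N.obj X W)
    (x : K.obj W Z) : freeTensorInv N K Y Z ((N.tensor K).fmk X f (tens N K W n x)) =
      tens N.free K W (N.fmk X f n) x := by
  simp [freeTensorInv]

/-- The bilinear map `(f ⊗ n, κ) ↦ f ⊗ (n ⊗ κ)`. -/
def freeTensorHomAux (Y W : C.Obj) (Z : D.Obj) :
    N.free.obj Y W →ₗ[k] K.obj W Z →ₗ[k] (N.tensor K).free.obj Y Z :=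
  flift fun X => LinearMap.mk₂ k
      (fun f n => (N.tensor K).fmk X f ∘ₗ tens N K W n)
      (fun m m' n => by ext; simp) (fun c m n => by ext; simp)
      (fun m n n' => by ext; simp) (fun c m n => by ext; simp)

@[simp] lemma freeTensorHomAux_fmk {Y X W : C.Obj} {Z : D.Obj} (f : C.bk Y X) (n : N.obj X W)
    (x : K.obj W Z) : freeTensorHomAux N K Y W Z (N.fmk X f n) x =
      (N.tensor K).fmk X f (tens N K W n x) := by
  simp [freeTensorHomAux]

/-- The map `(f ⊗ n) ⊗ κ ↦ f ⊗ (n ⊗ κ)`. -/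
def freeTensorHom : Fam (N.free.tensor K) (N.tensor K).free := fun Y Z =>
  tdesc (fun W => freeTensorHomAux N K Y W Z) (fun W W' p q l t c x _ _ _ => by
    refine LinearMap.congr_fun
      (f := (freeTensorHomAux N K Y W' Z).flip x ∘ₗ N.free.ract.flip c)
      (g := (freeTensorHomAux N K Y W Z).flip (K.lact c x)) (free_ext fun X i j f n _ _ => ?_) t
    simp [tens_ract])

@[simp] lemma freeTensorHom_tens {Y X W : C.Obj} {Z : D.Obj} (f : C.bk Y X) (n : N.obj X W)
    (x : K.obj W Z) : freeTensorHom N K Y Z (tens N.free K W (N.fmk X f n) x) =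
      (N.tensor K).fmk X f (tens N K W n x) :=
  (tdesc_tens ..).trans (freeTensorHomAux_fmk ..)

lemma free_tensor_ext {Y : C.Obj} {Z : D.Obj} {Q : Type*} [AddCommGroup Q] [Module k Q]
    {φ ψ : (N.free.tensor K).obj Y Z →ₗ[k] Q}
    (h : ∀ X W i j l (f : C.bk Y X) (n : N.obj X W) (x : K.obj W Z), f ∈ (C.bk Y X).deg i →
      n ∈ (N.obj X W).deg j → x ∈ (K.obj W Z).deg l →
      φ (tens N.free K W (N.fmk X f n) x) = ψ (tens N.free K W (N.fmk X f n) x)) : φ = ψ :=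
  tensor_ext fun W _ _ _ x _ hx => LinearMap.congr_fun
    (f := φ ∘ₗ (tens N.free K W).flip x) (g := ψ ∘ₗ (tens N.free K W).flip x)
    (free_ext fun _ _ _ _ _ hf hn => h _ _ _ _ _ _ _ _ hf hn hx) _

lemma tensor_free_ext {Y : C.Obj} {Z : D.Obj} {Q : Type*} [AddCommGroup Q] [Module k Q]
    {φ ψ : (N.tensor K).free.obj Y Z →ₗ[k] Q}
    (h : ∀ X W i j l (f : C.bk Y X) (n : N.obj X W) (x : K.obj W Z), f ∈ (C.bk Y X).deg i →
      n ∈ (N.obj X W).deg j → x ∈ (K.obj W Z).deg l →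
      φ ((N.tensor K).fmk X f (tens N K W n x)) = ψ ((N.tensor K).fmk X f (tens N K W n x))) :
    φ = ψ :=
  free_ext fun X _ _ f _ hf _ => LinearMap.congr_fun
    (f := φ ∘ₗ (N.tensor K).fmk X f) (g := ψ ∘ₗ (N.tensor K).fmk X f)
    (tensor_ext fun _ _ _ _ _ hn hx => h _ _ _ _ _ _ _ _ hf hn hx) _

/-- The free bimodule on a tensor product. -/
lemma free_tensor : (N.free.tensor K).HEquiv (N.tensor K).free := by
  have e (Y Z t) : freeTensorInv N K Y Z (freeTensorHom N K Y Z t) = t :=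
    LinearMap.congr_fun (f := freeTensorInv N K Y Z ∘ₗ freeTensorHom N K Y Z)
      (g := LinearMap.id) (free_tensor_ext N K fun X W i j l f n x _ _ _ => by simp) t
  have e' (Y Z t) : freeTensorHom N K Y Z (freeTensorInv N K Y Z t) = t :=
    LinearMap.congr_fun (f := freeTensorHom N K Y Z ∘ₗ freeTensorInv N K Y Z)
      (g := LinearMap.id) (tensor_free_ext N K fun X W i j l f n x _ _ _ => by simp) t
  have c : IsChain (freeTensorHom N K) := fun Y Z t => by
    refine LinearMap.congr_fun (f := DGMod.d _ ∘ₗ freeTensorHom N K Y Z)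
      (g := freeTensorHom N K Y Z ∘ₗ DGMod.d _)
      (free_tensor_ext N K fun X W i j l f n x hf hn hx => ?_) t
    simp [free_d_fmk hf, tensor_d_tens hn, tensor_d_tens (fmk_mem_deg hf hn rfl),
      sgn_add_right, mul_smul, add_assoc]
  have hl (Y' Y Z) (g : C.bk Y' Y) (t) : freeTensorHom N K Y' Z ((N.free.tensor K).lact g t) =
      (N.tensor K).free.lact g (freeTensorHom N K Y Z t) := by
    refine LinearMap.congr_fun (f := freeTensorHom N K Y' Z ∘ₗ (N.free.tensor K).lact g)
      (g := (N.tensor K).free.lact g ∘ₗ freeTensorHom N K Y Z)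
      (free_tensor_ext N K fun X W i j l f n x hf hn hx => ?_) t
    simp
  have hr : IsRightLinear (freeTensorHom N K) := fun Y Z Z' t g => by
    refine LinearMap.congr_fun (f := freeTensorHom N K Y Z' ∘ₗ (N.free.tensor K).ract.flip g)
      (g := (N.tensor K).free.ract.flip g ∘ₗ freeTensorHom N K Y Z)
      (free_tensor_ext N K fun X W i j l f n x hf hn hx => ?_) t
    simp
  -- As for associativity, the properties of the inverse follow from those of `freeTensorHom` by
  -- injectivity.
  have hinj (Y Z) : Function.Injective (freeTensorHom N K Y Z) := fun x y h => by
    rw [← e Y Z x, h, e]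
  refine HEquiv.of_iso (f := freeTensorHom N K) (g := freeTensorInv N K) ⟨fun Y Z n t ht => ?_,
    fun _ X' X W i f _ t => by rw [hl, sgn_zero_left, one_smul], fun _ => hr⟩
    ⟨fun Y Z n t ht => ?_, fun _ X' X W i f _ t => hinj _ _ ?_, fun _ X W W' t g => hinj _ _ ?_⟩
    c (fun X W t => hinj _ _ ?_) e e'
  · rw [add_zero]
    refine tensor_mem_le (S := (((N.tensor K).free.obj Y Z).deg n).comap
      (freeTensorHom N K Y Z)) ?_ ht
    rintro W i j s x hs hx rfl
    refine free_mem_le (S := (((N.tensor K).free.obj Y Z).deg (i + j)).comap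
      (freeTensorHom N K Y Z ∘ₗ (tens N.free K W).flip x)) ?_ hs
    rintro X i l f n hf hn rfl
    simpa using fmk_mem_deg hf (tens_mem_deg hn hx rfl) (add_assoc _ _ _).symm
  · rw [add_zero]
    refine free_mem_le (S := (((N.free.tensor K).obj Y Z).deg n).comap
      (freeTensorInv N K Y Z)) ?_ ht
    rintro X i j f s hf hs rfl
    refine tensor_mem_le (S := (((N.free.tensor K).obj Y Z).deg (i + j)).comap
      (freeTensorInv N K Y Z ∘ₗ (N.tensor K).fmk X f)) ?_ hs
    rintro W j l n x hn hx rfl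
    simpa using tens_mem_deg (fmk_mem_deg hf hn rfl) hx (add_assoc _ _ _)
  · rw [e', sgn_zero_left, one_smul, hl, e']
  · rw [e', hr, e']
  · rw [← c, e', e']

variable {K}

/-- A contraction of `N ⊗ K` induces a contraction of `N.free ⊗ K`. -/
lemma Contractible.free_tensor {a b : Prop} (H : Contractible a b (N.tensor K)) :
    Contractible True b (N.free.tensor K) :=
  H.free.of_hEquiv (Bimod.free_tensor N K)

end FreeTensor

/-! ### Tensoring with a free bimodule on the right: `K ⊗_C (C ⊗_k N)` is `K ⊗_k N`. -/

section TensorFree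

variable {K : Bimod A C} {a b : Prop}

/-- A contraction of `K` induces a contraction of `K ⊗ N.free`. -/
lemma Contractible.tensor_free (H : Contractible a b K) (N : Bimod C D) :
    Contractible a True (K.tensor N.free) := by
  obtain ⟨h, hh⟩ := H
  -- The homotopy is `κ ⊗ (f ⊗ n) ↦ h(κ f) ⊗ (1 ⊗ n)`. Absorbing `f` into `κ` before applying `h`
  -- makes this balanced even if `h` is not right linear.
  let Φ (X : A.Obj) (Y : C.Obj) (Z : D.Obj) :
      N.free.obj Y Z →ₗ[k] K.obj X Y →ₗ[k] (K.tensor N.free).obj X Z :=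
    flift fun W => LinearMap.mk₂ k (fun f n =>
        (tens K N.free W).flip (N.fmk W (C.id W) n) ∘ₗ h X W ∘ₗ K.ract.flip f)
      (fun m m' n => by ext; simp) (fun c m n => by ext; simp)
      (fun m n n' => by ext; simp) (fun c m n => by ext; simp)
  have hΦ {X : A.Obj} {Y W : C.Obj} {Z : D.Obj} (f : C.bk Y W) (n : N.obj W Z) (κ : K.obj X Y) :
      Φ X Y Z (N.fmk W f n) κ = tens K N.free W (h X W (K.ract κ f)) (N.fmk W (C.id W) n) := by
    simp [Φ]
  let θ : Fam (K.tensor N.free) (K.tensor N.free) := fun X Z =>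
    tdesc (fun Y => (Φ X Y Z).flip) (fun Y Y' p q l κ c t _ _ _ => by
      refine LinearMap.congr_fun (f := (Φ X Y' Z).flip (K.ract κ c))
        (g := (Φ X Y Z).flip κ ∘ₗ N.free.lact c) (free_ext fun W i j f n _ _ => ?_) t
      simp only [LinearMap.flip_apply, LinearMap.comp_apply, free_lact_fmk, hΦ, K.ract_ract])
  have hθ {X : A.Obj} {W : C.Obj} {Z : D.Obj} (n : N.obj W Z) (κ : K.obj X W) :
      θ X Z (tens K N.free W κ (N.fmk W (C.id W) n)) =
        tens K N.free W (h X W κ) (N.fmk W (C.id W) n) := by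
    simp only [θ, tdesc_tens, LinearMap.flip_apply, hΦ, K.ract_id]
  -- The elements `κ ⊗ (1 ⊗ n)` span. On them `θ` acts as `h` on `κ`, and the right action only
  -- touches `n`; hence right linearity is automatic.
  have gen {X : A.Obj} {Y W : C.Obj} {Z : D.Obj} (κ : K.obj X Y) (f : C.bk Y W) (n : N.obj W Z) :
      tens K N.free Y κ (N.fmk W f n) =
        tens K N.free W (K.ract κ f) (N.fmk W (C.id W) n) := by
    rw [tens_ract, free_lact_fmk, C.comp_id]
  have mem_le {X : A.Obj} {Z : D.Obj} {l : Γ} {U : Submodule k ((K.tensor N.free).obj X Z)}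
      (hU : ∀ W i j (κ : K.obj X W) (n : N.obj W Z), κ ∈ (K.obj X W).deg i →
        n ∈ (N.obj W Z).deg j → i + j = l → tens K N.free W κ (N.fmk W (C.id W) n) ∈ U) :
      ((K.tensor N.free).obj X Z).deg l ≤ U := by
    refine tensor_mem_le fun Y i j κ t hκ ht hij => ?_
    refine free_mem_le (S := U.comap (tens K N.free Y κ)) ?_ ht
    rintro W p q f n hf hn rfl
    rw [Submodule.mem_comap, gen]
    exact hU _ _ _ _ _ (K.ract_deg hκ hf) hn (by rw [← hij, add_assoc])
  have ext {Q : Type u} [AddCommGroup Q] [Module k Q] {X : A.Obj} {Z : D.Obj}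
      {φ ψ : (K.tensor N.free).obj X Z →ₗ[k] Q}
      (hU : ∀ W i (κ : K.obj X W) (n : N.obj W Z), κ ∈ (K.obj X W).deg i →
        φ (tens K N.free W κ (N.fmk W (C.id W) n)) =
          ψ (tens K N.free W κ (N.fmk W (C.id W) n))) : φ = ψ :=
    DGMod.ext_hom fun l => mem_le (U := LinearMap.eqLocus φ ψ)
      fun W i j κ n hκ _ _ => hU W i κ n hκ
  refine ⟨θ, ⟨fun X Z l t ht => ?_, fun ha X' X Z p g hg t => ?_, fun _ X Z Z' t g => ?_⟩,
    fun X Z t => ?_⟩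
  · refine mem_le (U := (((K.tensor N.free).obj X Z).deg (l + -G.ι)).comap (θ X Z)) ?_ ht
    rintro W i j κ n hκ hn rfl
    rw [Submodule.mem_comap, hθ]
    exact tens_mem_deg (hh.deg _ _ _ _ hκ) (fmk_mem_deg (C.id_deg W) hn (zero_add _)) (by abel)
  · refine LinearMap.congr_fun (f := θ X' Z ∘ₗ (K.tensor N.free).lact g)
      (g := G.sgn k (-G.ι) p • ((K.tensor N.free).lact g ∘ₗ θ X Z)) (ext fun W i κ n _ => ?_) t
    simp only [LinearMap.comp_apply, LinearMap.smul_apply, tensor_lact_tens, hθ,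
      hh.left ha _ _ _ _ g hg, map_smul]
  · refine LinearMap.congr_fun (f := θ X Z' ∘ₗ (K.tensor N.free).ract.flip g)
      (g := (K.tensor N.free).ract.flip g ∘ₗ θ X Z) (ext fun W i κ n _ => ?_) t
    simp only [LinearMap.comp_apply, LinearMap.flip_apply, tensor_ract_tens, free_ract_fmk, hθ]
  · refine LinearMap.congr_fun (f := DGMod.d _ ∘ₗ θ X Z + θ X Z ∘ₗ DGMod.d _)
      (g := LinearMap.id) (ext fun W i κ n hκ => ?_) t
    have h1 := hh.eq X W κ
    simp only [LinearMap.add_apply, LinearMap.comp_apply, hθ, tensor_d_tens hκ,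
      tensor_d_tens (hh.deg _ _ _ _ hκ), free_d_fmk (C.id_deg W), C.d_id, map_zero, map_add,
      map_smul, LinearMap.zero_apply, zero_add, sgn_zero_right, one_smul, sgn_add_right,
      sgn_ι_neg_ι, LinearMap.id_apply]
    have h2 : tens K N.free W ((K.obj X W).d (h X W κ)) (N.fmk W (C.id W) n) +
        tens K N.free W (h X W ((K.obj X W).d κ)) (N.fmk W (C.id W) n) =
        tens K N.free W κ (N.fmk W (C.id W) n) := by
      rw [← LinearMap.add_apply, ← map_add, h1]
    rw [← h2]
    module

end TensorFree

/-! ### Tensor products with the bar complex -/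

section Bar

variable {a b : Prop}

/-- The identity, as an element of the identity bimodule. -/
def oid (X : C.Obj) : (one C).obj X X := C.id X

lemma oid_mem_deg (X : C.Obj) : oid X ∈ ((one C).obj X X).deg 0 := C.id_deg X

/-- The map `f ⊗ m ↦ f m`. -/
def leftUnitor (M : Bimod C D) : Fam ((one C).tensor M) M := fun X Z =>
  tdesc (fun Y => M.lact (X' := X) (X := Y) (Y := Z)) fun _ _ _ _ _ f g m _ _ _ =>
    M.lact_lact f g m

@[simp] lemma leftUnitor_tens (M : Bimod C D) {X Y : C.Obj} {Z : D.Obj} (f : (one C).obj X Y)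
    (m : M.obj Y Z) : leftUnitor M X Z (tens (one C) M Y f m) = M.lact (X' := X) f m :=
  tdesc_tens ..

/-- The map `m ⊗ f ↦ m f`. -/
def rightUnitor (M : Bimod A C) : Fam (M.tensor (one C)) M := fun X Z =>
  tdesc (fun Y => M.ract (X := X) (Y := Y) (Y' := Z)) fun _ _ _ _ _ m f g _ _ _ =>
    (M.ract_ract m f g).symm

@[simp] lemma rightUnitor_tens (M : Bimod A C) {X : A.Obj} {Y Z : C.Obj} (m : M.obj X Y)
    (f : (one C).obj Y Z) : rightUnitor M X Z (tens M (one C) Y m f) = M.ract (Y' := Z) m f :=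
  tdesc_tens ..

/-- The inverse `m ↦ 1 ⊗ m` of the left unitor. -/
def leftUnitorInv (M : Bimod C D) : Fam M ((one C).tensor M) :=
  fun X _ => tens (one C) M X (oid X)

lemma isMap_leftUnitor (M : Bimod C D) : IsMap True True (leftUnitor M) 0 :=
  isMap_tensor
    (fun X Y Z i j f m hf hm => by
      rw [leftUnitor_tens, add_zero]; exact M.lact_deg hf hm)
    (fun _ X' X Y Z i j p g f m hg hf hm => by
      rw [leftUnitor_tens, leftUnitor_tens, sgn_zero_left, one_smul]; exact M.lact_lact g f m)
    (fun _ X Y Z Z' i j f m g hf hm => by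
      rw [leftUnitor_tens, leftUnitor_tens]; exact (M.lact_ract (X := Y) f m g).symm)

lemma isMap_leftUnitorInv (M : Bimod C D) : IsMap True True (leftUnitorInv M) 0 :=
  ⟨fun X Z i m hm => tens_mem_deg (oid_mem_deg X) hm (by abel),
    fun _ X' X Z i f hf m => by
      rw [sgn_zero_left, one_smul, leftUnitorInv, leftUnitorInv, tensor_lact_tens, ← tens_ract]
      exact congrArg (fun x => tens (one C) M X x m) ((C.id_comp f).trans (C.comp_id f).symm),
    fun _ X Z Z' m g => by rw [leftUnitorInv, leftUnitorInv, tensor_ract_tens]⟩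

lemma isChain_leftUnitor (M : Bimod C D) : IsChain (leftUnitor M) := fun X Z t => by
  refine LinearMap.congr_fun (f := DGMod.d _ ∘ₗ leftUnitor M X Z)
    (g := leftUnitor M X Z ∘ₗ DGMod.d _) (tensor_ext fun Y i j f m hf hm => ?_) t
  rw [LinearMap.comp_apply, LinearMap.comp_apply, tensor_d_tens hf, map_add, map_smul,
    leftUnitor_tens, leftUnitor_tens, leftUnitor_tens]
  exact M.lact_d m hf

lemma isChain_leftUnitorInv (M : Bimod C D) : IsChain (leftUnitorInv M) := fun X Z m => by
  have : ((one C).obj X X).d (oid X) = 0 := C.d_id X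
  rw [leftUnitorInv, tensor_d_tens (oid_mem_deg X), this]
  simp

lemma leftUnitorInv_leftUnitor (M : Bimod C D) {X : C.Obj} {Z : D.Obj}
    (t : ((one C).tensor M).obj X Z) : leftUnitorInv M X Z (leftUnitor M X Z t) = t := by
  refine LinearMap.congr_fun (f := leftUnitorInv M X Z ∘ₗ leftUnitor M X Z)
    (g := LinearMap.id) (tensor_ext fun Y i j f m hf hm => ?_) t
  rw [LinearMap.comp_apply, leftUnitor_tens]
  refine (tens_ract (M := one C) (oid X) f m).symm.trans ?_
  exact congrArg (fun x => tens (one C) M Y x m) (C.id_comp f)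

lemma leftUnitor_leftUnitorInv (M : Bimod C D) {X : C.Obj} {Z : D.Obj} (m : M.obj X Z) :
    leftUnitor M X Z (leftUnitorInv M X Z m) = m :=
  (leftUnitor_tens M _ m).trans (M.id_lact m)

lemma one_tensor (M : Bimod C D) : ((one C).tensor M).HEquiv M :=
  HEquiv.of_iso (isMap_leftUnitor M) (isMap_leftUnitorInv M) (isChain_leftUnitor M)
    (isChain_leftUnitorInv M) (fun _ _ => leftUnitorInv_leftUnitor M)
    fun _ _ => leftUnitor_leftUnitorInv M

/-- The bimodule `M` is the target of the augmentation of `Bar ⊗ M`, with cone `Aug ⊗ M`. -/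
def leftCone (M : Bimod C D) : ConeData M ((bar C).tensor M) ((aug C).tensor M) :=
  ((barCone C).tensorRight M).changeTarget (leftUnitor M) (leftUnitorInv M) (isMap_leftUnitor M)
    (isMap_leftUnitorInv M) (isChain_leftUnitor M) (isChain_leftUnitorInv M)
    (fun _ _ => leftUnitorInv_leftUnitor M) fun _ _ => leftUnitor_leftUnitorInv M

/-- This explicit form is what makes the augmentation natural with respect to bimodule maps of any
degree. -/
lemma leftCone_ε_tens (M : Bimod C D) {X Y : C.Obj} {Z : D.Obj} (b : (bar C).obj X Y)
    (m : M.obj Y Z) : (leftCone M).ε X Z (tens (bar C) M Y b m) =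
      M.lact (X' := X) ((barCone C).ε X Y b) m :=
  (congrArg (leftUnitor M X Z) (rwh_tens _ ((barCone C).isMap_ε.right trivial) _ _)).trans
    (leftUnitor_tens ..)

/-- The bimodule `M` is the target of the augmentation of `M ⊗ Bar`, with cone `M ⊗ Aug`. -/
def rightCone (M : Bimod A C) : ConeData M (M.tensor (bar C)) (M.tensor (aug C)) :=
  ((barCone C).tensorLeft M).changeTarget (rightUnitor M)
    (fun _ Z => (tens M (one C) Z).flip (oid Z))
    (isMap_tensor
      (fun X Y Z i j m f hm hf => by
        rw [rightUnitor_tens, add_zero]; exact M.ract_deg hm hf)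
      (fun _ X' X Y Z i j p g m f hg hm hf => by
        rw [rightUnitor_tens, rightUnitor_tens, sgn_zero_left, one_smul]
        exact M.lact_ract g m f)
      (fun _ X Y Z Z' i j m f g hm hf => by
        rw [rightUnitor_tens, rightUnitor_tens]; exact M.ract_ract m f g))
    ⟨fun X Z i m hm => tens_mem_deg hm (oid_mem_deg Z) (by abel),
      fun _ X' X Z i f hf m => by
        rw [sgn_zero_left, one_smul, LinearMap.flip_apply, LinearMap.flip_apply, tensor_lact_tens],
      fun _ X Z Z' m g => by
        rw [LinearMap.flip_apply, LinearMap.flip_apply, tensor_ract_tens, tens_ract]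
        exact congrArg (fun x => tens M (one C) Z m x) ((C.comp_id g).trans (C.id_comp g).symm)⟩
    (fun X Z t => by
      refine LinearMap.congr_fun (f := DGMod.d _ ∘ₗ rightUnitor M X Z)
        (g := rightUnitor M X Z ∘ₗ DGMod.d _) (tensor_ext fun Y i j m f hm hf => ?_) t
      rw [LinearMap.comp_apply, LinearMap.comp_apply, tensor_d_tens hm, map_add, map_smul,
        rightUnitor_tens, rightUnitor_tens, rightUnitor_tens]
      exact M.ract_d f hm)
    (fun X Z m => by
      have hZ : ((one C).obj Z Z).d (oid Z) = 0 := C.d_id Z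
      refine LinearMap.congr_fun (f := DGMod.d _ ∘ₗ (tens M (one C) Z).flip (oid Z))
        (g := (tens M (one C) Z).flip (oid Z) ∘ₗ DGMod.d _) (DGMod.ext_hom fun i m hm => ?_) m
      rw [LinearMap.comp_apply, LinearMap.flip_apply, tensor_d_tens hm, hZ]
      simp)
    (fun X Z t => by
      refine LinearMap.congr_fun (f := (tens M (one C) Z).flip (oid Z) ∘ₗ rightUnitor M X Z)
        (g := LinearMap.id) (tensor_ext fun Y i j m f hm hf => ?_) t
      rw [LinearMap.comp_apply, rightUnitor_tens, LinearMap.flip_apply]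
      refine (tens_ract m f (oid Z)).trans ?_
      exact congrArg (fun x => tens M (one C) Y m x) (C.comp_id f))
    (fun X Z m => (rightUnitor_tens M m _).trans (M.ract_id m))

lemma rightCone_ε_tens (M : Bimod A C) {X : A.Obj} {Y Z : C.Obj} (m : M.obj X Y)
    (b : (bar C).obj Y Z) : (rightCone M).ε X Z (tens M (bar C) Y m b) =
      M.ract (Y' := Z) m ((barCone C).ε Y Z b) :=
  (congrArg (rightUnitor M X Z) (lwh_zero_tens _ ((barCone C).isMap_ε.left trivial) _ _)).trans
    (rightUnitor_tens ..)

/-- The left module structure of `Bar ⊗ K` is free: a contraction of `K` can be made left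
linear on `Bar ⊗ K`. -/
lemma Contractible.bar_tensor {K : Bimod C D} (H : Contractible a b K) :
    Contractible True b ((bar C).tensor K) := by
  refine contractible_tot_tensor fun r => ?_
  -- The summand `r` of Bar is `barTerm C (r + 1)`, so the base case is the free bimodule on the
  -- identity bimodule, and each further factor adds one application of `free`.
  induction r with
  | zero => exact (H.of_hEquiv (one_tensor K)).free_tensor (N := one C)
  | succ r ih => exact ih.free_tensor

/-- No induction is needed on this side: every summand of Bar is `C ⊗_k N`, and tensoring over `C`
cancels the leading factor. -/
lemma Contractible.tensor_bar {K : Bimod A C} (H : Contractible a b K) :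
    Contractible a True (K.tensor (bar C)) :=
  contractible_tensor_tot fun r => H.tensor_free (barTerm C r)

/-- The left linear contraction of Aug becomes bilinear on Aug `⊗` Bar because the Bar factor
supplies right linearity; this then survives tensoring with `M`. -/
lemma contractible_aug_tensor_bar_tensor (M : Bimod C D) :
    Contractible True True ((aug C).tensor ((bar C).tensor M)) :=
  ((contractible_aug_left C).tensor_bar.tensorRight M).of_hEquiv (tensor_assoc _ _ M).symm

/-- Mirror image: the right linear contraction of Aug becomes bilinear on Bar `⊗` Aug. -/
lemma contractible_tensor_bar_tensor_aug (M : Bimod A C) :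
    Contractible True True ((M.tensor (bar C)).tensor (aug C)) :=
  ((contractible_aug_right C).bar_tensor.tensorLeft M).of_hEquiv (tensor_assoc M _ _)

end Bar

end Bimod

end DG

end
noncomputable section

namespace DG

variable {k : Type u} [CommRing k] {Γ : Type w} [AddCommGroup Γ] {G : GradingData Γ}

namespace Bimod

variable {A C D E : DGCat.{u, w} k G}

/-! ### Contractions of complexes of bimodule maps -/

section Hom

variable {P Z P' Z' : Bimod C D}

/-- A contraction of `Hom(P, Z)`, in terms of families of maps. -/
def HomContractible (P Z : Bimod C D) : Prop :=
  ∃ κ : ∀ l, homSub P Z l →ₗ[k] Fam P Z, (∀ l φ, IsMap True True (κ l φ) (l + -G.ι)) ∧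
    ∀ l φ X Y m, (Z.obj X Y).d (κ l φ X Y m) + G.sgn k G.ι l • κ l φ X Y ((P.obj X Y).d m) +
      κ (l + G.ι) (dHom P Z l φ) X Y m = φ.1 X Y m

open scoped Classical in
/-- The inclusion of the maps of degree `l`. -/
def homIn (l : Γ) : homSub P Z l →ₗ[k] Hom P Z :=
  DirectSum.lof k Γ (fun l => homSub P Z l) l

open scoped Classical in
/-- The linear map out of `Hom(P, Z)` given by its restrictions to the homogeneous parts. -/
def homDesc {Q : Type*} [AddCommGroup Q] [Module k Q] (φ : ∀ l, homSub P Z l →ₗ[k] Q) :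
    Hom P Z →ₗ[k] Q :=
  DirectSum.toModule k Γ Q φ

lemma homDesc_homIn {Q : Type*} [AddCommGroup Q] [Module k Q] (φ : ∀ l, homSub P Z l →ₗ[k] Q)
    (l : Γ) (f : homSub P Z l) : homDesc φ (homIn l f) = φ l f := by
  classical
  exact DirectSum.toModule_lof (M := fun l => homSub P Z l) k l f

lemma mem_hom_deg_iff {l : Γ} {x : Hom P Z} : x ∈ (Hom P Z).deg l ↔ ∃ f, homIn l f = x :=
  Iff.rfl

lemma hom_d_homIn {l : Γ} (f : homSub P Z l) :
    (Hom P Z).d (homIn l f) = homIn (l + G.ι) (dHom P Z l f) := by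
  classical
  exact DirectSum.toModule_lof (M := fun l => homSub P Z l) (N := ⨁ l, homSub P Z l) k l f

/-- The two terms of a contraction equation land in degrees `l - ι + ι` and `l + ι - ι`, which equal
`l` only propositionally. This compares them through the underlying families. -/
lemma homIn_add {l l' n : Γ} (h : l = n) (h' : l' = n) {f : homSub P Z l} {f' : homSub P Z l'}
    {g : homSub P Z n} (e : f.1 + f'.1 = g.1) :
    (homIn l f + homIn l' f' : Hom P Z) = homIn n g := by
  subst h
  subst h'
  rw [← map_add]
  exact congrArg _ (Subtype.ext e)

lemma sgn_ι_sub_ι (l : Γ) : G.sgn k G.ι (l + -G.ι) = -G.sgn k G.ι l := by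
  rw [sgn_add_right, sgn_ι_neg_ι, mul_neg_one]

/-- A contraction of the direct sum over all degrees amounts to one map per degree. In
`HomContractible` these take values in `Fam`, so that the equation needs no transport between equal
degrees. -/
lemma hom_hEquiv_zero_iff :
    (Hom P Z).HEquiv (DGMod.zero : DGMod.{u, u, w} k G) ↔ HomContractible P Z := by
  constructor
  · rintro ⟨f, g, h, -, -, -, hh, -, -, -, e, -⟩
    -- Summing the homogeneous components as families forgets the degree index and so removes the
    -- dependent types.
    let U : Hom P Z →ₗ[k] Fam P Z := homDesc fun l => (homSub P Z l).subtype
    have hU (l) (φ : homSub P Z l) : U (homIn l φ) = φ.1 := homDesc_homIn _ _ _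
    refine ⟨fun l => -(U ∘ₗ h ∘ₗ homIn l), fun l φ => ?_, fun l φ X Y m => ?_⟩
    · obtain ⟨ψ, hψ⟩ := mem_hom_deg_iff.1 (hh l _ (mem_hom_deg_iff.2 ⟨φ, rfl⟩))
      rw [← sub_eq_add_neg]
      simp only [LinearMap.neg_apply, LinearMap.comp_apply, ← hψ, hU]
      exact (isMap_iff.2 ψ.2).neg
    · obtain ⟨ψ, hψ⟩ := mem_hom_deg_iff.1 (hh l _ (mem_hom_deg_iff.2 ⟨φ, rfl⟩))
      have h0 : f (homIn l φ) = 0 := Subsingleton.elim (α := PUnit) _ _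
      have h1 := e (homIn l φ)
      rw [h0, map_zero, zero_sub, ← hψ, hom_d_homIn, hom_d_homIn] at h1
      have h2 := congrArg (fun F : Fam P Z => F X Y m) (congrArg U h1)
      simp only [map_neg, map_add, hU, Pi.neg_apply, Pi.add_apply, LinearMap.neg_apply,
        LinearMap.add_apply, dHom_apply, sub_eq_add_neg l, sgn_ι_sub_ι] at h2
      simp only [LinearMap.neg_apply, LinearMap.comp_apply, ← hψ, hU, Pi.neg_apply, map_neg]
      rw [neg_eq_iff_eq_neg.1 h2]
      module
  · rintro ⟨κ, hκ, e⟩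
    let h (l : Γ) : homSub P Z l →ₗ[k] homSub P Z (l + -G.ι) :=
      (κ l).codRestrict _ fun φ => isMap_iff.1 (hκ l φ)
    let H : Hom P Z →ₗ[k] Hom P Z := homDesc fun l => homIn (l + -G.ι) ∘ₗ h l
    have hH (l) (φ : homSub P Z l) : H (homIn l φ) = homIn (l + -G.ι) (h l φ) :=
      homDesc_homIn _ _ _
    have key (x : Hom P Z) : (Hom P Z).d (H x) + H ((Hom P Z).d x) = x := by
      refine LinearMap.congr_fun (f := (Hom P Z).d ∘ₗ H + H ∘ₗ (Hom P Z).d)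
        (g := LinearMap.id) (DGMod.ext_hom fun l x hx => ?_) x
      obtain ⟨φ, rfl⟩ := mem_hom_deg_iff.1 hx
      simp only [LinearMap.add_apply, LinearMap.comp_apply, hH, hom_d_homIn, LinearMap.id_apply]
      refine homIn_add (by abel) (by abel) ?_
      ext X Y m
      refine Eq.trans ?_ (e l φ X Y m)
      rw [Pi.add_apply, Pi.add_apply, LinearMap.add_apply, dHom_apply, sgn_ι_sub_ι, neg_smul,
        sub_neg_eq_add]
      rfl
    refine ⟨0, 0, -H, 0, by simp, by simp, fun l x hx => ?_, by simp, by simp, by simp,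
      fun x => ?_, fun x => Subsingleton.elim (α := PUnit) _ _⟩
    · obtain ⟨φ, rfl⟩ := mem_hom_deg_iff.1 hx
      rw [LinearMap.neg_apply, hH, sub_eq_add_neg]
      exact Submodule.neg_mem _ (mem_hom_deg_iff.2 ⟨_, rfl⟩)
    · simp [← neg_add, key]

/-- Maps to a contractible bimodule form a contractible complex. -/
lemma HomContractible.of_target (H : Contractible True True Z) (P : Bimod C D) :
    HomContractible P Z := by
  obtain ⟨h, hh⟩ := H
  refine ⟨fun l => LinearMap.pi fun X => LinearMap.pi fun Y =>
    LinearMap.compRight k (h X Y) ∘ₗ LinearMap.proj Y ∘ₗ LinearMap.proj X ∘ₗ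
      (homSub P Z l).subtype, fun l φ => hh.toIsMap.comp (isMap_iff.2 φ.2) rfl,
    fun l φ X Y m => ?_⟩
  change (Z.obj X Y).d (h X Y (φ.1 X Y m)) + G.sgn k G.ι l • h X Y (φ.1 X Y ((P.obj X Y).d m)) +
    h X Y ((dHom P Z l φ).1 X Y m) = φ.1 X Y m
  rw [dHom_apply, map_sub, map_smul]
  conv_rhs => rw [← hh.eq X Y (φ.1 X Y m)]
  abel

/-- A closed map of degree zero to `Z` is nullhomotopic if `Hom(P, Z)` is contractible. -/
lemma HomContractible.exists_homotopy (H : HomContractible P Z) {φ : Fam P Z}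
    (hφ : IsMap True True φ 0) (c : IsChain φ) : ∃ η : Fam P Z, IsMap True True η (-G.ι) ∧
      ∀ X Y m, (Z.obj X Y).d (η X Y m) + η X Y ((P.obj X Y).d m) = φ X Y m := by
  obtain ⟨κ, hκ, e⟩ := H
  -- For closed `φ` the term `κ(d φ)` drops out, and `κ φ` itself is the nullhomotopy.
  have h0 : dHom P Z 0 ⟨φ, isMap_iff.1 hφ⟩ = 0 := by
    ext X Y m
    simp [dHom_apply, c X Y]
  refine ⟨κ 0 ⟨φ, isMap_iff.1 hφ⟩, by simpa using hκ 0 ⟨φ, isMap_iff.1 hφ⟩, fun X Y m => ?_⟩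
  have := e 0 ⟨φ, isMap_iff.1 hφ⟩ X Y m
  rw [h0] at this
  simpa using this

/-- Let `σ : P → P'` be a homotopy section of `ε : P' → P`, and let `F` be a functorial lift of maps
`P → Z` along `ε` and `ε' : Z' → Z`. Then a contraction of `Hom(P, Z')` induces a contraction
of `Hom(P, Z)`. -/
lemma HomContractible.of_lift (H : HomContractible P Z') {ε : Fam P' P} {ε' : Fam Z' Z}
    (hε' : IsMap True True ε' 0) (cε' : IsChain ε')
    (F : ∀ l, homSub P Z l →ₗ[k] homSub P' Z' l)
    (hF : ∀ l φ X Y t, ε' X Y ((F l φ).1 X Y t) = φ.1 X Y (ε X Y t))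
    (hFd : ∀ l φ, dHom P' Z' l (F l φ) = F (l + G.ι) (dHom P Z l φ))
    {σ : Fam P P'} {s : Fam P P} (hσ : IsMap True True σ 0) (hs : IsMap True True s (-G.ι))
    (cσ : IsChain σ)
    (e : ∀ X Y m, ε X Y (σ X Y m) - m = (P.obj X Y).d (s X Y m) + s X Y ((P.obj X Y).d m)) :
    HomContractible P Z := by
  obtain ⟨κ, hκ, eκ⟩ := H
  -- The chain map `R(φ) = F(φ) σ` exhibits `Hom(P, Z)` as a homotopy retract of `Hom(P, Z')`:
  -- composing with `ε'` gives `φ ε σ`, which differs from `φ` by `φ (d s + s d)`. The contraction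
  -- `κ'` is the usual one for a retract, written out.
  let R (l : Γ) : homSub P Z l →ₗ[k] homSub P Z' l :=
    { toFun φ := ⟨fun X Y => (F l φ).1 X Y ∘ₗ σ X Y,
        isMap_iff.1 ((isMap_iff.2 (F l φ).2).comp hσ (zero_add _))⟩
      map_add' φ ψ := by ext X Y m; simp
      map_smul' c φ := by ext X Y m; simp }
  have hR (l φ X Y m) : (R l φ).1 X Y m = (F l φ).1 X Y (σ X Y m) := rfl
  have hRd (l φ) : dHom P Z' l (R l φ) = R (l + G.ι) (dHom P Z l φ) := by
    ext X Y m
    simp only [hR, dHom_apply, ← hFd, cσ X Y]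
  let κ' (l : Γ) : homSub P Z l →ₗ[k] Fam P Z :=
    { toFun φ X Y := ε' X Y ∘ₗ κ l (R l φ) X Y + -(G.sgn k G.ι l • (φ.1 X Y ∘ₗ s X Y))
      map_add' φ ψ := by
        ext X Y m
        simp only [map_add, Pi.add_apply, LinearMap.add_apply, LinearMap.comp_apply,
          LinearMap.neg_apply, LinearMap.smul_apply, Submodule.coe_add, smul_add, neg_add]
        abel
      map_smul' c φ := by
        ext X Y m
        simp only [map_smul, Pi.smul_apply, LinearMap.add_apply, LinearMap.comp_apply,
          LinearMap.neg_apply, LinearMap.smul_apply, SetLike.val_smul, smul_add, smul_neg,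
          RingHom.id_apply, smul_comm c] }
  have hκ' (l φ X Y m) : κ' l φ X Y m =
    ε' X Y (κ l (R l φ) X Y m) + -(G.sgn k G.ι l • φ.1 X Y (s X Y m)) := rfl
  refine ⟨κ', fun l φ => (hε'.comp (hκ l (R l φ)) (add_zero _)).add
    (((isMap_iff.2 φ.2).comp hs (add_comm _ _)).smul _).neg, fun l φ X Y m => ?_⟩
  have h1 := congrArg (ε' X Y) (eκ l (R l φ) X Y m)
  rw [hRd, map_add, map_add, map_smul, ← cε', hR, hF, sub_eq_iff_eq_add.1 (e X Y m), map_add,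
    map_add] at h1
  simp only [hκ', dHom_apply, map_add, map_neg, map_smul, sgn_add_right, sgn_ι_ι,
    smul_add, smul_sub, smul_neg, smul_smul, mul_neg, neg_mul, mul_one, neg_smul, sgn_mul_self,
    one_smul]
  rw [← sub_eq_zero] at h1 ⊢
  rw [← h1]
  module

end Hom

end Bimod

end DG

end
noncomputable section

namespace DG

variable {k : Type u} [CommRing k] {Γ : Type w} [AddCommGroup Γ] {G : GradingData Γ}

namespace Bimod

variable {A C D E : DGCat.{u, w} k G}

/-! ### Projective bimodules and the bar complex -/

section Projective

variable {P Z : Bimod C D}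

/-- The functor `Bar ⊗ -` on maps of degree `l`. -/
def barTensorMap (P Z : Bimod C D) (l : Γ) :
    homSub P Z l →ₗ[k] homSub ((bar C).tensor P) ((bar C).tensor Z) l where
  toFun φ := ⟨lwh l φ.1 φ.2.2.1 (bar C), isMap_iff.1 ((isMap_iff.2 φ.2).lwh _ _)⟩
  map_add' φ ψ := Subtype.ext <| funext fun X => funext fun Y =>
    tensor_ext fun W i j b p hb _ => by
      refine (lwh_tens _ (φ + ψ).2.2.1 hb p).trans (Eq.trans ?_
        (congrArg₂ (· + ·) (lwh_tens _ φ.2.2.1 hb p) (lwh_tens _ ψ.2.2.1 hb p)).symm)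
      simp
  map_smul' c φ := Subtype.ext <| funext fun X => funext fun Y =>
    tensor_ext fun W i j b p hb _ => by
      refine (lwh_tens _ (c • φ).2.2.1 hb p).trans (Eq.trans ?_
        (congrArg (c • ·) (lwh_tens _ φ.2.2.1 hb p)).symm)
      simp [smul_comm c]

/-- The functor `- ⊗ Bar` on maps of degree `l`. -/
def tensorBarMap (P Z : Bimod C D) (l : Γ) :
    homSub P Z l →ₗ[k] homSub (P.tensor (bar D)) (Z.tensor (bar D)) l where
  toFun φ := ⟨rwh φ.1 φ.2.2.2 (bar D), isMap_iff.1 ((isMap_iff.2 φ.2).rwh _ _)⟩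
  map_add' φ ψ := Subtype.ext <| funext fun X => funext fun Y =>
    tensor_ext fun W i j p b _ _ => by
      refine (rwh_tens _ (φ + ψ).2.2.2 p b).trans (Eq.trans ?_
        (congrArg₂ (· + ·) (rwh_tens _ φ.2.2.2 p b) (rwh_tens _ ψ.2.2.2 p b)).symm)
      simp
  map_smul' c φ := Subtype.ext <| funext fun X => funext fun Y =>
    tensor_ext fun W i j p b _ _ => by
      refine (rwh_tens _ (c • φ).2.2.2 p b).trans (Eq.trans ?_
        (congrArg (c • ·) (rwh_tens _ φ.2.2.2 p b)).symm)
      simp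

/-- If `Aug ⊗ P` is contractible, then contractibility of `Hom(P, -)` can be tested after
applying `Bar ⊗ -`. -/
lemma HomContractible.of_bar_tensor (h : Contractible True True ((aug C).tensor P))
    (H : HomContractible P ((bar C).tensor Z)) : HomContractible P Z := by
  obtain ⟨h, hh⟩ := h
  obtain ⟨σ, s, hσ, hs, cσ, e, -⟩ := (leftCone P).exists_section
    (η := fun X Y => h X Y ∘ₗ (leftCone P).i X Y)
    (hh.toIsMap.comp (leftCone P).isMap_i (zero_add _))
    (fun X Y m => by simp [← (leftCone P).d_i X Y, hh.eq])
  -- The lift of `φ` is `1 ⊗ φ`. Naturality `ε (1 ⊗ φ) = φ ε` uses the left linearity of `φ` and the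
  -- fact that the augmentation of Bar has degree zero.
  refine H.of_lift (leftCone Z).isMap_ε (leftCone Z).d_ε (barTensorMap P Z)
    (fun l φ X Y t => ?_) (fun l φ => ?_) hσ hs cσ e
  · refine LinearMap.congr_fun (f := (leftCone Z).ε X Y ∘ₗ (barTensorMap P Z l φ).1 X Y)
      (g := φ.1 X Y ∘ₗ (leftCone P).ε X Y) (tensor_ext fun W i j b p hb hp => ?_) t
    simp only [LinearMap.comp_apply, leftCone_ε_tens]
    refine (congrArg _ (lwh_tens _ φ.2.2.1 hb p)).trans ?_
    rw [map_smul, leftCone_ε_tens]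
    exact (φ.2.2.1 _ _ _ _ _ ((barCone C).isMap_ε.deg_zero hb) p).symm
  · ext X Y t
    exact lwh_d φ.2.2.1 (dHom P Z l φ).2.2.1 rfl (fun _ _ _ => rfl) X Y t

/-- If `P ⊗ Aug` is contractible, then contractibility of `Hom(P, -)` can be tested after
applying `- ⊗ Bar`. -/
lemma HomContractible.of_tensor_bar (h : Contractible True True (P.tensor (aug D)))
    (H : HomContractible P (Z.tensor (bar D))) : HomContractible P Z := by
  obtain ⟨h, hh⟩ := h
  obtain ⟨σ, s, hσ, hs, cσ, e, -⟩ := (rightCone P).exists_section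
    (η := fun X Y => h X Y ∘ₗ (rightCone P).i X Y)
    (hh.toIsMap.comp (rightCone P).isMap_i (zero_add _))
    (fun X Y m => by simp [← (rightCone P).d_i X Y, hh.eq])
  refine H.of_lift (rightCone Z).isMap_ε (rightCone Z).d_ε (tensorBarMap P Z)
    (fun l φ X Y t => ?_) (fun l φ => ?_) hσ hs cσ e
  · refine LinearMap.congr_fun (f := (rightCone Z).ε X Y ∘ₗ (tensorBarMap P Z l φ).1 X Y)
      (g := φ.1 X Y ∘ₗ (rightCone P).ε X Y) (tensor_ext fun W i j p b hp hb => ?_) t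
    simp only [LinearMap.comp_apply, rightCone_ε_tens]
    refine (congrArg _ (rwh_tens _ φ.2.2.2 p b)).trans ?_
    rw [rightCone_ε_tens]
    exact (φ.2.2.2 _ _ _ _ _).symm
  · ext X Y t
    exact rwh_d (isMap_iff.2 φ.2).of_full φ.2.2.2 (dHom P Z l φ).2.2.2 (fun _ _ _ => rfl) X Y t

lemma IsProjective.homContractible (H : P.IsProjective) {a b : Prop} (hZ : Contractible a b Z) :
    HomContractible P Z :=
  hom_hEquiv_zero_iff.1 (H Z (isAcyclic_iff.2 (hZ.mono False.elim False.elim)))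

lemma isProjective_of_homContractible
    (H : ∀ Z : Bimod C D, Contractible False False Z → HomContractible P Z) : P.IsProjective :=
  fun Z hZ => hom_hEquiv_zero_iff.2 (H Z (isAcyclic_iff.1 hZ))

/-- If the inclusion of `P` into the cone of `ε : P' → P` is nullhomotopic, then `P` is a homotopy
retract of `P'`. -/
lemma ConeData.isRetract {P' N : Bimod C D} (c : ConeData P P' N) (H : HomContractible P N) :
    IsRetract P P' := by
  obtain ⟨η, hη, e⟩ := H.exists_homotopy c.isMap_i c.d_i
  obtain ⟨σ, s, hσ, hs, cσ, e', -⟩ := c.exists_section hη e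
  exact ⟨σ, c.ε, s, hσ, c.isMap_ε, hs, cσ, c.d_ε, e'⟩

/-- Aug `⊗ P` is acyclic, so the inclusion of `P` into it is nullhomotopic and `P` is a homotopy
retract of Bar `⊗ P`. Tensoring with Aug makes Aug `⊗ P` a retract of the contractible Aug `⊗` Bar
`⊗ P`. -/
lemma IsProjective.contractible_aug_tensor (H : P.IsProjective) :
    Contractible True True ((aug C).tensor P) :=
  (((leftCone P).isRetract (H.homContractible
    ((contractible_aug_right C).tensorRight P))).tensorLeft (aug C)).contractible
      (contractible_aug_tensor_bar_tensor P)

lemma IsProjective.contractible_tensor_aug (H : P.IsProjective) :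
    Contractible True True (P.tensor (aug D)) :=
  (((rightCone P).isRetract (H.homContractible
    ((contractible_aug_left D).tensorLeft P))).tensorRight (aug D)).contractible
      (contractible_tensor_bar_tensor_aug P)

end Projective

/-! ### One-sided modules -/

section OneSided

/-- Linearity and unitality leave no freedom for an action of the one-object category `k`: a scalar
`c` is `c` times the identity. -/
lemma unit_ract {M : Bimod C (DGCat.unit : DGCat.{u, w} k G)} {X : C.Obj}
    {Y Y' : (DGCat.unit : DGCat.{u, w} k G).Obj} (m : M.obj X Y) (c : k) :
    M.ract (Y' := Y') m c = c • m := by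
  have h : M.ract (Y' := Y) m (c • DGCat.unit.id Y) = c • m := by rw [map_smul, M.ract_id]
  exact (congrArg (M.ract (Y' := Y) m) (mul_one c).symm).trans h

lemma unit_lact {M : Bimod (DGCat.unit : DGCat.{u, w} k G) D} {Y : D.Obj}
    {X' X : (DGCat.unit : DGCat.{u, w} k G).Obj} (c : k) (m : M.obj X Y) :
    M.lact (X' := X') (X := X) c m = c • m := by
  have h : M.lact (X' := X) (c • DGCat.unit.id X) m = c • m := by
    rw [LinearMap.map_smul₂, M.id_lact]
  exact (congrArg (fun x => M.lact (X' := X) (X := X) x m) (mul_one c).symm).trans h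

/-- Right linearity over `k` is plain linearity, so for one-sided modules only the linearity over
`C` is a real condition. -/
lemma Contractible.right_unit {a b : Prop} {M : Bimod C (DGCat.unit : DGCat.{u, w} k G)}
    (H : Contractible a b M) : Contractible a True M := by
  obtain ⟨h, hh⟩ := H
  refine ⟨h, ⟨hh.deg, hh.left, fun _ X Y Y' m c => ?_⟩, hh.eq⟩
  exact (congrArg (h X Y') (unit_ract m c)).trans
    (((h X Y').map_smul c m).trans (unit_ract (h X Y m) c).symm)

lemma Contractible.left_unit {a b : Prop} {M : Bimod (DGCat.unit : DGCat.{u, w} k G) D}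
    (H : Contractible a b M) : Contractible True b M := by
  obtain ⟨h, hh⟩ := H
  refine ⟨h, ⟨hh.deg, fun _ X' X Y i c hc m => ?_, hh.right⟩, hh.eq⟩
  have h1 : h X' Y (M.lact c m) = M.lact c (h X Y m) :=
    (congrArg (h X' Y) (unit_lact (k := k) c m)).trans
      (((h X' Y).map_smul c m).trans (unit_lact (k := k) c (h X Y m)).symm)
  rw [h1]
  -- A homogeneous scalar has degree zero or vanishes, so the Koszul sign required for left
  -- linearity never matters.
  obtain hi | h0 := ground_cases (k := k) (c := c) hc
  · rw [hi, sgn_zero_right, one_smul]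
  · have h2 : M.lact c (h X Y m) = 0 :=
      (unit_lact (k := k) c (h X Y m)).trans ((congrArg (· • h X Y m) h0).trans (zero_smul k _))
    rw [h2, smul_zero]

/-- The components of `N ⊗ B|Y⟩` are by definition those of `N ⊗ B` at `Y`. Without right linearity
over `D`, contractions for different `Y` are independent and may be chosen separately. -/
lemma contractible_tensor_ket_iff {N : Bimod A C} {B : Bimod C D} :
    (∀ Y, Contractible True True (N.tensor (B.ket Y))) ↔ Contractible True False (N.tensor B) := by
  constructor
  · intro H
    choose h hh using H
    exact ⟨fun X Y => h Y X PUnit.unit, ⟨fun X Y => (hh Y).deg X PUnit.unit,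
      fun _ X' X Y => (hh Y).left trivial X' X PUnit.unit, False.elim⟩,
      fun X Y => (hh Y).eq X PUnit.unit⟩
  · rintro ⟨h, hh⟩ Y
    refine Contractible.right_unit (b := False) ⟨fun X _ => h X Y, ⟨fun X _ => hh.deg X Y,
      fun _ X' X _ => hh.left trivial X' X Y, False.elim⟩, fun X _ => hh.eq X Y⟩

lemma contractible_bra_tensor_iff {N : Bimod D E} {B : Bimod C D} :
    (∀ X, Contractible True True ((B.bra X).tensor N)) ↔ Contractible False True (B.tensor N) := by
  constructor
  · intro H
    choose h hh using H
    exact ⟨fun X Y => h X PUnit.unit Y, ⟨fun X Y => (hh X).deg PUnit.unit Y, False.elim,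
      fun _ X Y Y' => (hh X).right trivial PUnit.unit Y Y'⟩, fun X Y => (hh X).eq PUnit.unit Y⟩
  · rintro ⟨h, hh⟩ X
    refine Contractible.left_unit (a := False) ⟨fun _ Y => h X Y, ⟨fun _ Y => hh.deg X Y,
      False.elim, fun _ _ Y Y' => hh.right trivial X Y Y'⟩, fun _ Y => hh.eq X Y⟩

/-- The one-sided form of the criterion for projectivity, for each `B|Y⟩`. When `Z` is an acyclic
left module, Bar `⊗ Z` has a left linear contraction, and this is already bilinear over `C` and `k`.
-/
lemma isLeftExact_iff {B : Bimod C D} :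
    B.IsLeftExact ↔ Contractible True False ((aug C).tensor B) := by
  rw [← contractible_tensor_ket_iff]
  exact forall_congr' fun Y => ⟨fun H => H.contractible_aug_tensor, fun H =>
    isProjective_of_homContractible fun Z hZ =>
      HomContractible.of_bar_tensor H (.of_target hZ.bar_tensor.right_unit _)⟩

lemma isRightExact_iff {B : Bimod C D} :
    B.IsRightExact ↔ Contractible False True (B.tensor (aug D)) := by
  rw [← contractible_bra_tensor_iff]
  exact forall_congr' fun X => ⟨fun H => H.contractible_tensor_aug, fun H =>
    isProjective_of_homContractible fun Z hZ =>
      HomContractible.of_tensor_bar H (.of_target hZ.tensor_bar.left_unit _)⟩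

end OneSided

/-! ### Characterizations by the bar complex -/

variable {B : Bimod C D}

/-- Each Bar factor upgrades a linear contraction by one side of linearity. Conversely, both
augmentations have linearly contractible cones, so linear contractibility descends from Bar `⊗ B ⊗`
Bar to `B`. -/
lemma isAcyclic_iff_bar :
    B.IsAcyclic ↔ (((bar C).tensor B).tensor (bar D)).HEquiv zero := by
  rw [isAcyclic_iff, hEquiv_zero_iff]
  refine ⟨fun H => H.bar_tensor.tensor_bar, fun H => ?_⟩
  -- The two Bar factors are removed one after the other, the left one of `B` being reduced to the
  -- right one of Bar `⊗ B`. Only linear contractions are used, so either contraction of Aug may be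
  -- weakened.
  refine (leftCone B).contractible
    (((contractible_aug_right C).tensorRight B).mono False.elim False.elim) ?_
  exact (rightCone _).contractible
    (((contractible_aug_left D).tensorLeft _).mono False.elim False.elim)
    (H.mono False.elim False.elim)

/-- Both sides are equivalent to bilinear contractibility of Aug `⊗ B` and `B ⊗` Aug: this makes the
two augmentations equivalences, and it holds for anything equivalent to Bar `⊗ B ⊗` Bar. -/
lemma isProjective_iff_bar :
    B.IsProjective ↔ (((bar C).tensor B).tensor (bar D)).HEquiv B := by
  constructor
  · intro H
    have h1 := (rightCone B).hEquiv H.contractible_tensor_aug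
    have h2 := (leftCone (B.tensor (bar D))).hEquiv
      ((H.contractible_aug_tensor.tensorRight (bar D)).of_hEquiv (tensor_assoc _ _ _).symm)
    exact ((tensor_assoc _ _ _).trans h2).trans h1
  · intro H
    have hl : Contractible True True ((aug C).tensor B) :=
      (H.symm.isRetract.tensorLeft (aug C)).contractible
        (((contractible_aug_tensor_bar_tensor B).tensorRight (bar D)).of_hEquiv
          (tensor_assoc _ _ _).symm)
    have hr : Contractible True True (B.tensor (aug D)) :=
      (H.symm.isRetract.tensorRight (aug D)).contractible
        (contractible_tensor_bar_tensor_aug _)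
    -- The target `Z` is replaced by `Z ⊗` Bar and then by Bar `⊗ (Z ⊗` Bar`)`, which is
    -- contractible as a bimodule.
    exact isProjective_of_homContractible fun Z hZ => HomContractible.of_tensor_bar hr
      (HomContractible.of_bar_tensor hl (.of_target hZ.tensor_bar.bar_tensor _))

/-- For exact `B` both sides are compared with Bar `⊗ B ⊗` Bar: the missing linearity of the
contraction of Aug `⊗ B` or `B ⊗` Aug is supplied by the additional Bar factor. -/
lemma isExact_iff_bar :
    B.IsExact ↔ ((bar C).tensor B).HEquiv (B.tensor (bar D)) := by
  rw [IsExact, isLeftExact_iff, isRightExact_iff]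
  constructor
  · rintro ⟨hl, hr⟩
    have h1 := (leftCone (B.tensor (bar D))).hEquiv
      (hl.tensor_bar.of_hEquiv (tensor_assoc _ _ _).symm)
    have h2 := (rightCone ((bar C).tensor B)).hEquiv
      (hr.bar_tensor.of_hEquiv (tensor_assoc _ _ _))
    exact (h2.symm.trans (tensor_assoc _ _ _)).trans h1
  · intro H
    -- Tensoring the equivalence with Aug on the left compares Aug `⊗ B ⊗` Bar with the contractible
    -- Aug `⊗` Bar `⊗ B`.
    have hl : Contractible True True (((aug C).tensor B).tensor (bar D)) :=
      ((H.symm.isRetract.tensorLeft (aug C)).contractible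
        (contractible_aug_tensor_bar_tensor B)).of_hEquiv (tensor_assoc _ _ _)
    have hr : Contractible True True ((bar C).tensor (B.tensor (aug D))) :=
      ((H.isRetract.tensorRight (aug D)).contractible
        (contractible_tensor_bar_tensor_aug B)).of_hEquiv (tensor_assoc _ _ _).symm
    -- To strip the outer Bar, the cone Aug `⊗ B ⊗` Aug is contracted left linearly by the
    -- right-hand Aug. This leaves a left linear contraction of Aug `⊗ B`, just what left exactness
    -- asks for; the other half is symmetric.
    exact ⟨(rightCone _).contractible ((contractible_aug_left D).tensorLeft _)
      (hl.mono id False.elim), (leftCone _).contractible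
      ((contractible_aug_right C).tensorRight _) (hr.mono False.elim id)⟩

end Bimod

end DG

end

/-! ### The three characterizations together. -/

theorem mainTheorem9 {k : Type u} [CommRing k] {Γ : Type w} [AddCommGroup Γ]
    {G : DG.GradingData Γ} (C D : DG.DGCat.{u, w} k G) (hC : C.HomProjective)
    (hD : D.HomProjective) (B : DG.Bimod C D) :
    (B.IsAcyclic ↔
      (((DG.Bimod.bar C).tensor B).tensor (DG.Bimod.bar D)).HEquiv DG.Bimod.zero) ∧
    (B.IsProjective ↔
      (((DG.Bimod.bar C).tensor B).tensor (DG.Bimod.bar D)).HEquiv B) ∧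
    (B.IsExact ↔
      ((DG.Bimod.bar C).tensor B).HEquiv (B.tensor (DG.Bimod.bar D))) :=
  ⟨DG.Bimod.isAcyclic_iff_bar, DG.Bimod.isProjective_iff_bar, DG.Bimod.isExact_iff_bar⟩
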